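/- Let $(G,M,\mathbb F)$ be one of $(O_o(n,n),SO_n,\mathbb R)$ with $n\ge 3$, $(SU(n,n),U_n,\mathbb C)$ with $n\ge 1$, or $(Sp(n,n),Sp_n,\mathbb H)$ with $n\ge 1$. Here, with $U(n,n,\mathbb F)$ the group of invertible $2n\times 2n$ matrices $A$ over $\mathbb F$ such that $\overline A^{T}\delta A=\delta$, $\delta=\operatorname{diag}(I_n,-I_n)$, we write $O_o(n,n)$ for the identity component of $U(n,n,\mathbb R)$, $SU(n,n)=\{A\in U(n,n,\mathbb C):\det A=1\}$ and $Sp(n,n)=U(n,n,\mathbb H)$. Let $M$ carry the Riemannian metric induced by the inner product $\langle X,Y\rangle=\operatorname{Re}\operatorname{tr}(\overline X^{T}Y)$ on $\mathbb F^{n\times n}$, and let $\mu$ be its Riemannian volume measure. The group $G$ acts on $M$ by the Möbius action $$\begin{pmatrix}A&B\\ C&D\end{pmatrix}*U=(AU+B)(CU+D)^{-1}.$$ Endow $G$ with the kinetic energy metric $$\langle X,Y\rangle_g=\int_M\langle\widetilde X(q),\widetilde Y(q)\rangle\,d\mu(q),\qquad g\in G,\ X,Y\in T_gG,$$ where $\widetilde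 X(q)=\frac{d}{dt}\big|_{0}\,c(t)*q$ for any smooth curve $c$ in $G$ with $c(0)=g$, $c'(0)=X$. Then the curve $\gamma:\mathbb R\to G$, $$\gamma(t)=\exp\left(t\begin{pmatrix}0&I_n\\ I_n&0\end{pmatrix}\right)=\begin{pmatrix}\cosh t\,I_n&\sinh t\,I_n\\ \sinh t\,I_n&\cosh t\,I_n\end{pmatrix},$$ is a reparametrization of an inextendible geodesic of $G$ of finite length: there are an open interval $J\subseteq\mathbb R$ and a diffeomorphism $\varphi:J\to\mathbb R$ such that $\gamma\circ\varphi$ is a geodesic of $G$ which does not extend to a geodesic on any strictly larger open interval and which has finite length. In particular, $G$ is not complete (neither geodesically nor as a metric space with the Riemannian distance), and the kinetic energy metric on $G$ is neither left-invariant nor right-invariant. -/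

import Mathlib

open MeasureTheory Set Filter
open scoped Topology ContDiff Matrix ENNReal Quaternion

/- Matrices carry the Frobenius norm, i.e. the norm of the real inner product `Re tr (Xᴴ Y)`. -/
attribute [local instance] Matrix.frobeniusNormedAddCommGroup Matrix.frobeniusNormedSpace

namespace MobiusKinetic

/-! ### Riemannian geometry of a submanifold of a normed space

`S` is (the underlying set of) an embedded submanifold of the normed space `E`, so that smooth maps
into `S` are the smooth maps into `E` with values in `S`. The metric is `B`, where `B g X Y` is the
inner product of the tangent vectors `X Y` of `S` at `g`. -/

section Riemannian

variable {E : Type*} [NormedAddCommGroup E] [NormedSpace ℝ E]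

/-- The tangent space of `S` at `g`: the velocities at `g` of the smooth curves in `S`. -/
def tangentAt (S : Set E) (g : E) : Set E :=
  {X | ∃ c : ℝ → E, ContDiff ℝ ∞ c ∧ (∀ t, c t ∈ S) ∧ c 0 = g ∧ deriv c 0 = X}

/-- `I` is a nonempty open interval of `ℝ`, bounded or not. -/
def IsOpenInterval (I : Set ℝ) : Prop := IsOpen I ∧ I.OrdConnected ∧ I.Nonempty

/-- The length of the curve `c`, defined on the interval `I`. -/
noncomputable def curveLength (B : E → E → E → ℝ) (c : ℝ → E) (I : Set ℝ) : ℝ≥0∞ :=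
  ∫⁻ t in I, ENNReal.ofReal (√(B (c t) (derivWithin c I t) (derivWithin c I t)))

/-- The energy of the curve `c` between the times `a` and `b`. -/
noncomputable def energy (B : E → E → E → ℝ) (c : ℝ → E) (a b : ℝ) : ℝ :=
  (1 / 2) * ∫ t in a..b, B (c t) (deriv c t) (deriv c t)

/-- `H` is a smooth variation, with parameter `s ∈ (-ε, ε)`, of the curve `c : I → S`
through curves in `S`, with the endpoints at the times `a` and `b` kept fixed. -/
structure IsVariation (S : Set E) (c : ℝ → E) (I : Set ℝ) (a b ε : ℝ) (H : ℝ → ℝ → E) : Prop where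
  smooth : ContDiffOn ℝ ∞ (fun p : ℝ × ℝ => H p.1 p.2) (Ioo (-ε) ε ×ˢ I)
  mem : ∀ s ∈ Ioo (-ε) ε, ∀ t ∈ I, H s t ∈ S
  zero : ∀ t ∈ I, H 0 t = c t
  left : ∀ s ∈ Ioo (-ε) ε, H s a = c a
  right : ∀ s ∈ Ioo (-ε) ε, H s b = c b

/-- `c` is a geodesic of `(S, B)` on the open interval `I`: it is smooth and, on each compact
subinterval, a critical point of the energy with respect to the variations with fixed endpoints. -/
structure IsGeodesic (B : E → E → E → ℝ) (S : Set E) (c : ℝ → E) (I : Set ℝ) : Prop where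
  interval : IsOpenInterval I
  smooth : ContDiffOn ℝ ∞ c I
  mem : ∀ t ∈ I, c t ∈ S
  critical : ∀ a ∈ I, ∀ b ∈ I, a < b → ∀ ε > 0, ∀ H, IsVariation S c I a b ε H →
    HasDerivAt (fun s => energy B (H s) a b) 0 0

/-- The geodesic `c` on `I` is inextendible: it is not the restriction of
a geodesic on a strictly larger open interval. -/
def IsInextendibleGeodesic (B : E → E → E → ℝ) (S : Set E) (c : ℝ → E) (I : Set ℝ) : Prop :=
  IsGeodesic B S c I ∧
    ∀ (I' : Set ℝ) (c' : ℝ → E), IsGeodesic B S c' I' → I ⊆ I' → EqOn c' c I → I' = I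

/-- `φ` restricts to a diffeomorphism from the open interval `I` onto `ℝ`. -/
structure IsReparametrization (φ : ℝ → ℝ) (I : Set ℝ) : Prop where
  interval : IsOpenInterval I
  smooth : ContDiffOn ℝ ∞ φ I
  bij : BijOn φ I univ
  deriv_ne : ∀ t ∈ I, deriv φ t ≠ 0

/-- Geodesic completeness: each geodesic extends to a geodesic defined on all of `ℝ`. -/
def GeodesicallyComplete (B : E → E → E → ℝ) (S : Set E) : Prop :=
  ∀ (c : ℝ → E) (I : Set ℝ), IsGeodesic B S c I →
    ∃ c' : ℝ → E, IsGeodesic B S c' univ ∧ EqOn c' c I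

/-- The Riemannian distance: the infimum of the lengths of the `C¹` curves in `S`
from `g` to `h`. -/
noncomputable def riemDist (B : E → E → E → ℝ) (S : Set E) (g h : E) : ℝ≥0∞ :=
  ⨅ (c : ℝ → E) (_ : ContDiffOn ℝ 1 c (Icc 0 1) ∧ (∀ t ∈ Icc (0 : ℝ) 1, c t ∈ S) ∧
    c 0 = g ∧ c 1 = h), curveLength B c (Icc 0 1)

/-- Metric completeness: each Cauchy sequence for the Riemannian distance converges. -/
def MetricallyComplete (B : E → E → E → ℝ) (S : Set E) : Prop :=
  ∀ u : ℕ → E, (∀ k, u k ∈ S) →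
    (∀ ε > 0, ∃ N, ∀ k ≥ N, ∀ l ≥ N, riemDist B S (u k) (u l) < ε) →
    ∃ g ∈ S, Tendsto (fun k => riemDist B S (u k) g) atTop (𝓝 0)

end Riemannian

/-! ### The groups and the Möbius action

The definitions are used for `F = ℝ`, `F = ℂ` and `F = ℍ`. -/

section Mobius

variable {F : Type*} [NormedDivisionRing F] [StarRing F] [InnerProductSpace ℝ F]

/-- The `n × n` matrices. -/
abbrev Mat (F : Type*) (n : ℕ) := Matrix (Fin n) (Fin n) F

/-- The `2n × 2n` matrices, split into four `n × n` blocks. -/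
abbrev Mat2 (F : Type*) (n : ℕ) := Matrix (Fin n ⊕ Fin n) (Fin n ⊕ Fin n) F

/-- The Borel `σ`-algebra of the space of matrices. -/
instance instMeasurableSpaceMat (n : ℕ) : MeasurableSpace (Mat F n) := borel _

instance instBorelSpaceMat (n : ℕ) : BorelSpace (Mat F n) := ⟨rfl⟩

/- The same for the topology of the Frobenius norm, which is by definition the topology above. -/
instance instBorelSpaceMatNorm (n : ℕ) :
    @BorelSpace (Mat F n) PseudoMetricSpace.toUniformSpace.toTopologicalSpace _ := ⟨rfl⟩

/-- The real part of a scalar. -/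
noncomputable def rePart (x : F) : ℝ := inner ℝ 1 x

theorem rePart_real (x : ℝ) : rePart x = x := by simp [rePart]

theorem rePart_complex (x : ℂ) : rePart x = x.re := by simp [rePart, Complex.inner]

theorem rePart_quaternion (x : ℍ[ℝ]) : rePart x = x.re := by simp [rePart, Quaternion.inner_def]

/-- The real inner product `Re tr (Xᴴ Y)` of `n × n` matrices. -/
noncomputable def matInner {n : ℕ} (X Y : Mat F n) : ℝ := rePart (Xᴴ * Y).trace

/-- The matrix `diag (Iₙ, -Iₙ)` of the Hermitian form of signature `(n, n)`. -/
def signature (F : Type*) [NormedDivisionRing F] (n : ℕ) : Mat2 F n := Matrix.fromBlocks 1 0 0 (-1)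

/-- `U(n, n, F)`: the automorphisms of the Hermitian form of signature `(n, n)` on `F²ⁿ`. -/
def splitUnitary (F : Type*) [NormedDivisionRing F] [StarRing F] (n : ℕ) : Set (Mat2 F n) :=
  {A | IsUnit A ∧ Aᴴ * signature F n * A = signature F n}

/-- `U(n, F)`. -/
def unitarySet (F : Type*) [NormedDivisionRing F] [StarRing F] (n : ℕ) : Set (Mat F n) :=
  {U | Uᴴ * U = 1}

/-- `O_o(n, n)`, the identity component of `O(n, n)`. -/
def Oo (n : ℕ) : Set (Mat2 ℝ n) := connectedComponentIn (splitUnitary ℝ n) 1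

/-- `SU(n, n)`. -/
def SU (n : ℕ) : Set (Mat2 ℂ n) := {A | A ∈ splitUnitary ℂ n ∧ A.det = 1}

/-- `Sp(n, n)`. -/
def Sp (n : ℕ) : Set (Mat2 ℍ[ℝ] n) := splitUnitary ℍ[ℝ] n

/-- `SO_n`. -/
def specialOrthogonal (n : ℕ) : Set (Mat ℝ n) := {U | U ∈ unitarySet ℝ n ∧ U.det = 1}

/-- `U_n`. -/
def unitaryGrp (n : ℕ) : Set (Mat ℂ n) := unitarySet ℂ n

/-- `Sp_n`. -/
def symplecticGrp (n : ℕ) : Set (Mat ℍ[ℝ] n) := unitarySet ℍ[ℝ] n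

/-- The Möbius transformation `U ↦ (A U + B) (C U + D)⁻¹` given by a matrix
with blocks `A B C D`. -/
noncomputable def mobius {n : ℕ} (g : Mat2 F n) (U : Mat F n) : Mat F n :=
  (g.toBlocks₁₁ * U + g.toBlocks₁₂) * Ring.inverse (g.toBlocks₂₁ * U + g.toBlocks₂₂)

/-- The dimension of `SO_n`, `U_n` or `Sp_n`, according to `F`: the real dimension of the space
of skew-Hermitian `n × n` matrices, which is the tangent space at the identity. -/
noncomputable def unitaryDim (F : Type*) [NormedDivisionRing F] [StarRing F]
    [InnerProductSpace ℝ F] (n : ℕ) : ℕ :=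
  Set.finrank ℝ {X : Mat F n | Xᴴ = -X}

/-- The Riemannian volume of `M ⊆ Mat F n`, one of `SO_n`, `U_n`, `Sp_n`, with the metric induced
by the inner product `Re tr (Xᴴ Y)`: the Hausdorff measure of dimension `dim M` on `M`
(normalized to agree with Lebesgue measure on Euclidean spaces). -/
noncomputable def riemVolume {n : ℕ} (M : Set (Mat F n)) : Measure (Mat F n) :=
  (μHE[unitaryDim F n] : Measure (Mat F n)).restrict M

/-- For a vector `X` tangent to the group at `g`, the map `X̃ : M → TM`: the velocity at `q` of the
motion `q ↦ γ(t) * q`, for any smooth curve `γ` of matrices with `γ(0) = g`, `γ'(0) = X`.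
It is the value at `X` of the differential at `g` of `h ↦ h * q`. -/
noncomputable def velocity {n : ℕ} (g X : Mat2 F n) (q : Mat F n) : Mat F n :=
  fderiv ℝ (fun h : Mat2 F n => mobius h q) g X

/-- The kinetic energy metric of the Möbius action on `M`:
`⟨X, Y⟩_g = ∫_M ⟨X̃(q), Ỹ(q)⟩ dμ(q)`. -/
noncomputable def kineticMetric {n : ℕ} (M : Set (Mat F n))
    (g X Y : Mat2 F n) : ℝ :=
  ∫ q, matInner (velocity g X q) (velocity g Y q) ∂(riemVolume M)

/-- The metric `B` on the matrix group `G` is left-invariant. -/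
def LeftInvariant {n : ℕ} (B : Mat2 F n → Mat2 F n → Mat2 F n → ℝ) (G : Set (Mat2 F n)) : Prop :=
  ∀ h ∈ G, ∀ g ∈ G, ∀ X ∈ tangentAt G g, ∀ Y ∈ tangentAt G g,
    B (h * g) (h * X) (h * Y) = B g X Y

/-- The metric `B` on the matrix group `G` is right-invariant. -/
def RightInvariant {n : ℕ} (B : Mat2 F n → Mat2 F n → Mat2 F n → ℝ) (G : Set (Mat2 F n)) : Prop :=
  ∀ h ∈ G, ∀ g ∈ G, ∀ X ∈ tangentAt G g, ∀ Y ∈ tangentAt G g,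
    B (g * h) (X * h) (Y * h) = B g X Y

/-- The one-parameter subgroup `t ↦ exp (t [[0, I], [I, 0]])`. -/
noncomputable def gamma (F : Type*) [NormedDivisionRing F] [InnerProductSpace ℝ F]
    (n : ℕ) (t : ℝ) : Mat2 F n :=
  NormedSpace.exp (t • (Matrix.fromBlocks 0 1 1 0 : Mat2 F n))

end Mobius

end MobiusKinetic

open MobiusKinetic

/-! # Geodesic incompleteness of the kinetic energy metric of the Möbius action -/

set_option linter.unusedSectionVars false

/-! Write V = γ(t) * u. The fractional linear form gives the Riccati equation V' = 1 - V², so the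
squared speed of γ is ∫ ‖1 - V²‖² dμ. Since V is unitary, this is expressed by the moments m_k(t) =
∫ Re tr(V^k) dμ, which satisfy m_k' = k (m_{k-1} - m_{k+1}). The argument runs in an algebra with an
involution and a trace τ, which covers the matrices over ℝ, ℂ and ℍ at once.

Geodesic. The metric is the L² product of velocity fields on M, so a curve is critical for the
energy as soon as its acceleration is L²-orthogonal to all variation fields. At γ(t) these are aV +
b - VcV - Vd, where the blocks a, b, c, d form an element of the Lie algebra. By the invariance of μ
under conjugation and adjoint, the mean of V^k over M is self-adjoint and commutes with M, hence is
a real scalar (`integral_mul_flow_pow`). Therefore only the traces of a, b, c, d matter, and τ a = τ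
d = 0, τ c = τ b. One scalar condition remains, and it is the derivative of the equation of unit
speed (`integral_acceleration_eq_zero`).

Finite length. The identity (1 - V)(1 + u) = exp(-2t) (1 - u)(1 + V) of `IsTrace.one_sub_flow_mul`
shows that V tends to 1 exponentially fast wherever 1 + u is invertible. Multiplying by an adjugate
gives |N(1 + u)| ‖1 - V‖ ≤ K exp(-2t), where N is the algebra norm. It remains to bound the measure
of {|N(1 + u)| ≤ δ} by a power of δ. For this u is moved along rational curves in M, on which N(1 +
u) is polynomial up to a denominator; a Remez inequality and the invariance of μ conclude
(`IsInvariantOn.exists_sublevel_le`). For t → -∞ the speed is even in t if -1 ∈ M. In SO_n with n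
odd, -1 is missing; there every u has an axis, and the determinant is replaced by one with a
modified column (`det_smul_one_sub_sq`).

Conclusion. Exponential decay of the speed at both ends makes the length finite, while the blocks of
γ grow like cosh t, so there is no continuation. The points γ(k) form a Cauchy sequence. The mean of
τ(g * q) over q is Lipschitz for the Riemannian distance, so a limit g would send all of M to 1,
against the injectivity of Möbius transformations. Finally γ'(t) is both a left and a right
translate of γ'(0), so an invariant metric would give γ constant speed. -/

namespace MobiusKinetic

/-! ### Algebras with a trace, and the Möbius action on their unitary elements. -/

section TraceAlgebra

variable {𝔸 : Type*} [NormedRing 𝔸] [NormedAlgebra ℝ 𝔸] [StarRing 𝔸]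

/-- `τ` is a tracial functional for which `τ (x⋆ y)` is the inner product of the norm. -/
structure IsTrace (τ : 𝔸 →ₗ[ℝ] ℝ) : Prop where
  comm : ∀ x y, τ (x * y) = τ (y * x)
  map_star : ∀ x, τ (star x) = τ x
  sq : ∀ x, τ (star x * x) = ‖x‖ ^ 2

/-- The relations between the blocks of an element of the split unitary group. -/
structure IsSplit (a b c d : 𝔸) : Prop where
  aa : star a * a - star c * c = 1
  ab : star a * b = star c * d
  ba : star b * a = star d * c
  bb : star d * d - star b * b = 1

section Algebra

variable [FiniteDimensional ℝ 𝔸]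

/-- In finite dimension an injective left multiplication is surjective, which gives a right inverse;
injectivity again makes it two-sided. This replaces determinants, which are not available over ℍ. -/
theorem isUnit_of_mul_eq_zero {x : 𝔸} (h : ∀ y, x * y = 0 → y = 0) : IsUnit x := by
  have hinj : Function.Injective (LinearMap.mulLeft ℝ x) := by
    rw [← LinearMap.ker_eq_bot, LinearMap.ker_eq_bot']
    intro y hy
    exact h y hy
  obtain ⟨y, hy⟩ := LinearMap.injective_iff_surjective.1 hinj 1
  have hy' : x * y = 1 := hy
  refine ⟨⟨x, y, hy', ?_⟩, rfl⟩
  have : x * (y * x - 1) = 0 := by rw [mul_sub, ← mul_assoc, hy']; simp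
  exact sub_eq_zero.1 (h _ this)

theorem isUnit_of_mul_eq_one {x y : 𝔸} (h : y * x = 1) : IsUnit x :=
  isUnit_of_mul_eq_zero fun z hz => by rw [← one_mul z, ← h, mul_assoc, hz, mul_zero]

theorem mul_star_of_star_mul {u : 𝔸} (hu : star u * u = 1) : u * star u = 1 := by
  have h : (u * star u - 1) * u = 0 := by rw [sub_mul, mul_assoc, hu]; simp
  exact sub_eq_zero.1 (((isUnit_of_mul_eq_one hu).mul_left_eq_zero).1 h)

end Algebra

namespace IsTrace

variable {τ : 𝔸 →ₗ[ℝ] ℝ}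

theorem star_mul_self_eq_zero (hτ : IsTrace τ) {x : 𝔸} (h : star x * x = 0) : x = 0 := by
  have := hτ.sq x
  rw [h, map_zero] at this
  simpa using this.symm

theorem symm (hτ : IsTrace τ) (x y : 𝔸) : τ (star x * y) = τ (star y * x) := by
  rw [← hτ.map_star (star x * y), star_mul, star_star]

theorem norm_mul_left (hτ : IsTrace τ) {u : 𝔸} (hu : star u * u = 1) (x : 𝔸) :
    ‖u * x‖ = ‖x‖ := by
  have : ‖u * x‖ ^ 2 = ‖x‖ ^ 2 := by
    rw [← hτ.sq, ← hτ.sq, star_mul, mul_assoc, ← mul_assoc (star u), hu, one_mul]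
  exact (sq_eq_sq₀ (norm_nonneg _) (norm_nonneg _)).1 this

theorem norm_star (hτ : IsTrace τ) (x : 𝔸) : ‖star x‖ = ‖x‖ := by
  have : ‖star x‖ ^ 2 = ‖x‖ ^ 2 := by
    rw [← hτ.sq, ← hτ.sq, star_star, hτ.comm]
  exact (sq_eq_sq₀ (norm_nonneg _) (norm_nonneg _)).1 this

theorem norm_mul_right (hτ : IsTrace τ) {u : 𝔸} (hu : u * star u = 1) (x : 𝔸) :
    ‖x * u‖ = ‖x‖ := by
  rw [← hτ.norm_star, star_mul, hτ.norm_mul_left (by rwa [star_star]), hτ.norm_star]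

theorem norm_unitary (hτ : IsTrace τ) {u : 𝔸} (hu : star u * u = 1) : ‖u‖ = ‖(1 : 𝔸)‖ := by
  rw [← mul_one u, hτ.norm_mul_left hu]

theorem norm_one_sq (hτ : IsTrace τ) : τ 1 = ‖(1 : 𝔸)‖ ^ 2 := by
  rw [← hτ.sq]; simp

theorem norm_add_sq (hτ : IsTrace τ) (x y : 𝔸) :
    ‖x + y‖ ^ 2 = ‖x‖ ^ 2 + 2 * τ (star x * y) + ‖y‖ ^ 2 := by
  rw [← hτ.sq, ← hτ.sq, ← hτ.sq, star_add, add_mul, mul_add, mul_add, map_add, map_add, map_add,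
    hτ.symm y x]
  ring

/-- Cauchy–Schwarz, read off from the triangle inequality for x + y and x - y. -/
theorem abs_inner_le (hτ : IsTrace τ) (x y : 𝔸) : |τ (star x * y)| ≤ ‖x‖ * ‖y‖ := by
  have h1 := hτ.norm_add_sq x y
  have h2 := hτ.norm_add_sq x (-y)
  have h3 := norm_add_le x y
  have h4 := norm_add_le x (-y)
  rw [mul_neg, map_neg, norm_neg] at h2
  rw [norm_neg] at h4
  have h5 := norm_nonneg (x + y)
  have h6 := norm_nonneg (x + -y)
  rw [abs_le]
  constructor <;> nlinarith

theorem skew_eq_zero (hτ : IsTrace τ) {x : 𝔸} (hx : star x = -x) : τ x = 0 := by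
  have := hτ.map_star x
  rw [hx, map_neg] at this
  linarith

/-- Turns distances to 1 into traces, so that the speed and the convergence to 1 become statements
about moments. -/
theorem norm_one_sub_sq (hτ : IsTrace τ) {u : 𝔸} (hu : star u * u = 1) :
    ‖1 - u‖ ^ 2 = 2 * (τ 1 - τ u) := by
  rw [sub_eq_add_neg, hτ.norm_add_sq, norm_neg, hτ.norm_unitary hu, hτ.norm_one_sq]
  simp
  ring

variable [FiniteDimensional ℝ 𝔸]

/-- For skew x the elements y and xy are orthogonal, so (1 + x)y = 0 forces y = 0 by Pythagoras. -/
theorem isUnit_one_add_skew (hτ : IsTrace τ) {x : 𝔸} (hx : star x = -x) : IsUnit (1 + x) := by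
  refine isUnit_of_mul_eq_zero fun y hy => ?_
  have h : ‖y + x * y‖ ^ 2 = 0 := by
    rw [show y + x * y = (1 + x) * y by noncomm_ring, hy]; simp
  have h2 : τ (star y * (x * y)) = 0 := by
    apply hτ.skew_eq_zero
    rw [star_mul, star_mul, star_star, hx]
    noncomm_ring
  rw [hτ.norm_add_sq, h2] at h
  have h3 : ‖y‖ ^ 2 = 0 := by nlinarith [sq_nonneg ‖y‖, sq_nonneg ‖x * y‖]
  simpa using h3

variable {a b c d q : 𝔸}

/-- For unitary q the column (q, 1) is isotropic for the form diag(1, -1), and the block matrix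
preserves this form, so the image column is isotropic as well. -/
theorem mobius_num_den (h : IsSplit a b c d) (hq : star q * q = 1) :
    star (a * q + b) * (a * q + b) = star (c * q + d) * (c * q + d) := by
  have h1 : star a * a = 1 + star c * c := by rw [← h.aa]; abel
  have h2 : star d * d = 1 + star b * b := by rw [← h.bb]; abel
  calc star (a * q + b) * (a * q + b)
      = star q * (star a * a) * q + star q * (star a * b) + star b * a * q + star b * b := by
        simp only [star_add, star_mul]; noncomm_ring
    _ = star q * (star c * c) * q + star q * (star c * d) + star d * c * q + star d * d := by
        rw [h1, h2, h.ab, h.ba, mul_add, add_mul, mul_one, hq]; noncomm_ring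
    _ = _ := by simp only [star_add, star_mul]; noncomm_ring

/-- What the denominator annihilates is annihilated by the numerator too, by isotropy. The image
column then vanishes, and the relations of the split unitary group recover the original column. -/
theorem isUnit_den (hτ : IsTrace τ) (h : IsSplit a b c d) (hq : star q * q = 1) :
    IsUnit (c * q + d) := by
  refine isUnit_of_mul_eq_zero fun x hx => ?_
  have hp : (a * q + b) * x = 0 := by
    apply hτ.star_mul_self_eq_zero
    rw [star_mul, mul_assoc, ← mul_assoc _ _ x, mobius_num_den h hq, mul_assoc _ _ x, hx]
    simp
  have h0 : q * x = 0 := by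
    calc q * x = (star a * a - star c * c) * (q * x) := by rw [h.aa, one_mul]
      _ = star a * ((a * q + b) * x) - star c * ((c * q + d) * x)
          - (star a * b - star c * d) * x := by noncomm_ring
      _ = 0 := by rw [hp, hx, h.ab]; simp
  rw [← one_mul x, ← hq, mul_assoc, h0, mul_zero]

end IsTrace

/-- The Möbius transformation with blocks `a b c d`. -/
noncomputable def mob (a b c d q : 𝔸) : 𝔸 := (a * q + b) * Ring.inverse (c * q + d)

namespace IsTrace

variable [FiniteDimensional ℝ 𝔸] {τ : 𝔸 →ₗ[ℝ] ℝ} {a b c d q : 𝔸}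

theorem star_mob_mul (hτ : IsTrace τ) (h : IsSplit a b c d) (hq : star q * q = 1) :
    star (mob a b c d q) * mob a b c d q = 1 := by
  have hu := hτ.isUnit_den h hq
  have hu' : IsUnit (star (c * q + d)) := hu.star
  rw [mob, star_mul, ← Ring.inverse_star, mul_assoc, ← mul_assoc (star (a * q + b)),
    mobius_num_den h hq, mul_assoc, Ring.mul_inverse_cancel _ hu, mul_one,
    Ring.inverse_mul_cancel _ hu']

/-- The inverse block matrix has rows (a⋆, -c⋆) and (-b⋆, d⋆). Applied to the column (w, 1) times
the denominator it returns (p, 1). Hence w determines the denominator, and then the point p. -/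
theorem mob_injective (hτ : IsTrace τ) (h : IsSplit a b c d) {q q' : 𝔸} (hq : star q * q = 1)
    (hq' : star q' * q' = 1) (he : mob a b c d q = mob a b c d q') : q = q' := by
  obtain ⟨w, hw⟩ : ∃ w, mob a b c d q = w := ⟨_, rfl⟩
  have key : ∀ p, star p * p = 1 → mob a b c d p = w →
      (star d - star b * w) * (c * p + d) = 1 ∧ (star a * w - star c) * (c * p + d) = p := by
    intro p hp hpw
    have hu := hτ.isUnit_den h hp
    have hP : a * p + b = w * (c * p + d) := by
      rw [← hpw, mob, mul_assoc, Ring.inverse_mul_cancel _ hu, mul_one]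
    constructor
    · calc _ = star d * (c * p + d) - star b * (w * (c * p + d)) := by noncomm_ring
        _ = (star d * c - star b * a) * p + (star d * d - star b * b) := by
          rw [← hP]; noncomm_ring
        _ = 1 := by rw [h.ba, h.bb]; simp
    · calc _ = star a * (w * (c * p + d)) - star c * (c * p + d) := by noncomm_ring
        _ = (star a * a - star c * c) * p + (star a * b - star c * d) := by
          rw [← hP]; noncomm_ring
        _ = p := by rw [h.ab, h.aa]; simp
  obtain ⟨h1, h2⟩ := key q hq hw
  obtain ⟨h3, h4⟩ := key q' hq' (he ▸ hw)
  have hR : IsUnit (star d - star b * w) := by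
    have hx := hτ.isUnit_den h hq
    have h5 := (Ring.eq_mul_inverse_iff_mul_eq (star d - star b * w) 1 _ hx).2 h1
    rw [one_mul] at h5
    rw [h5]
    exact hx.ringInverse
  have h6 : c * q + d = c * q' + d := hR.mul_left_cancel (h1.trans h3.symm)
  rw [← h2, ← h4, h6]

end IsTrace

/-! ### The hyperbolic flow -/

/-- The motion of `u` under the one-parameter group with blocks `cosh t`, `sinh t`. -/
noncomputable def flow (t : ℝ) (u : 𝔸) : 𝔸 :=
  mob (Real.cosh t • 1) (Real.sinh t • 1) (Real.sinh t • 1) (Real.cosh t • 1) u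

theorem isSplit_flow [StarModule ℝ 𝔸] (t : ℝ) : IsSplit (Real.cosh t • (1 : 𝔸))
    (Real.sinh t • 1) (Real.sinh t • 1) (Real.cosh t • 1) := by
  have h : Real.cosh t * Real.cosh t - Real.sinh t * Real.sinh t = 1 := by
    linarith [Real.cosh_sq t]
  constructor
  · simp [smul_smul, ← sub_smul, h]
  · simp [smul_smul, mul_comm]
  · simp [smul_smul, mul_comm]
  · simp [smul_smul, ← sub_smul, h]

namespace IsTrace

variable [FiniteDimensional ℝ 𝔸] [StarModule ℝ 𝔸] {τ : 𝔸 →ₗ[ℝ] ℝ}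

/-- Names the inverse r of the denominator and records that it commutes with u, so that later
identities are plain computations in a ring. -/
theorem exists_flow_inverse (hτ : IsTrace τ) {u : 𝔸} (hu : star u * u = 1) (t : ℝ) :
    ∃ r : 𝔸, (Real.sinh t • u + Real.cosh t • 1) * r = 1 ∧
      r * (Real.sinh t • u + Real.cosh t • 1) = 1 ∧
      flow t u = (Real.cosh t • u + Real.sinh t • 1) * r ∧ Commute u r := by
  have hU := hτ.isUnit_den (isSplit_flow t) hu
  have e : (Real.sinh t • (1 : 𝔸)) * u + Real.cosh t • 1 = Real.sinh t • u + Real.cosh t • 1 := by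
    simp
  rw [e] at hU
  have h1 := Ring.mul_inverse_cancel _ hU
  have h2 := Ring.inverse_mul_cancel _ hU
  refine ⟨_, h1, h2, ?_, ?_⟩
  · rw [flow, mob, e]; simp
  · have hc : Commute u (Real.sinh t • u + Real.cosh t • 1) :=
      ((Commute.refl u).smul_right _).add_right ((Commute.one_right u).smul_right _)
    set Q := Real.sinh t • u + Real.cosh t • 1
    have : u * Ring.inverse Q = Ring.inverse Q * u := by
      calc u * Ring.inverse Q = Ring.inverse Q * (Q * u) * Ring.inverse Q := by
            rw [← mul_assoc, h2, one_mul]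
        _ = Ring.inverse Q * u := by rw [← hc.eq, mul_assoc, mul_assoc, h1, mul_one]
    exact this

theorem star_flow_mul (hτ : IsTrace τ) {u : 𝔸} (hu : star u * u = 1) (t : ℝ) :
    star (flow t u) * flow t u = 1 :=
  hτ.star_mob_mul (isSplit_flow t) hu

theorem commute_flow (hτ : IsTrace τ) {u : 𝔸} (hu : star u * u = 1) (t : ℝ) :
    Commute u (flow t u) := by
  obtain ⟨r, h1, h2, h3, h4⟩ := hτ.exists_flow_inverse hu t
  rw [h3]
  exact (((Commute.refl u).smul_right _).add_right ((Commute.one_right u).smul_right _)).mul_right h4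

/-- The Cayley transform linearizes the flow: 1 - V = exp(-t) (1 - u) r and 1 + V = exp(t) (1 + u)
r. Without inverses the relation also holds where 1 + u is singular, and it is the source of all
decay estimates. -/
theorem one_sub_flow_mul (hτ : IsTrace τ) {u : 𝔸} (hu : star u * u = 1) (t : ℝ) :
    (1 - flow t u) * (1 + u) = Real.exp (-2 * t) • ((1 - u) * (1 + flow t u)) := by
  obtain ⟨r, h1, h2, h3, h4⟩ := hτ.exists_flow_inverse hu t
  have e1 : 1 - flow t u = Real.exp (-t) • ((1 - u) * r) := by
    rw [h3, ← Real.cosh_sub_sinh]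
    nth_rewrite 1 [← h1]
    rw [← sub_mul, ← smul_mul_assoc]
    congr 1
    module
  have e2 : 1 + flow t u = Real.exp t • ((1 + u) * r) := by
    rw [h3, ← Real.cosh_add_sinh]
    nth_rewrite 1 [← h1]
    rw [← add_mul, ← smul_mul_assoc]
    congr 1
    module
  rw [e1, e2, mul_smul_comm, smul_smul, ← Real.exp_add, show -2 * t + t = -t by ring,
    smul_mul_assoc, mul_assoc]
  congr 2
  exact ((Commute.one_right r).add_right h4.symm).eq

theorem flow_star (hτ : IsTrace τ) {u : 𝔸} (hu : star u * u = 1) (t : ℝ) :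
    flow t (star u) = star (flow t u) := by
  obtain ⟨r, h1, h2, h3, h4⟩ := hτ.exists_flow_inverse hu t
  have hu' : star (star u) * star u = 1 := by rw [star_star, mul_star_of_star_mul hu]
  obtain ⟨r', h1', h2', h3', h4'⟩ := hτ.exists_flow_inverse hu' t
  have hr : r' = star r := by
    have : star r * (Real.sinh t • star u + Real.cosh t • 1) = 1 := by
      have := congrArg star h1
      simpa using this
    exact (left_inv_eq_right_inv this h1').symm
  have h5 : star u * star r = star r * star u := by
    have := congrArg star h4.eq
    simpa using this.symm
  rw [h3', h3, hr]
  simp [add_mul, h5]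

/-- Conjugation by k is the action of the block matrix diag(k, k), which commutes with the
hyperbolic group. This and `flow_star` supply the equivariance needed for averaging. -/
theorem flow_conj (hτ : IsTrace τ) {u k : 𝔸} (hu : star u * u = 1) (hk : star k * k = 1) (t : ℝ) :
    flow t (k * u * star k) = k * flow t u * star k := by
  have hk' := mul_star_of_star_mul hk
  obtain ⟨r, h1, h2, h3, h4⟩ := hτ.exists_flow_inverse hu t
  have hu' : star (k * u * star k) * (k * u * star k) = 1 := by
    calc _ = k * (star u * (star k * k) * u) * star k := by simp [mul_assoc]
      _ = 1 := by rw [hk, mul_one, hu, mul_one, hk']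
  obtain ⟨r', h1', h2', h3', h4'⟩ := hτ.exists_flow_inverse hu' t
  have hQ : ∀ x y : ℝ, x • (k * u * star k) + y • 1 = k * (x • u + y • 1) * star k := by
    intro x y
    rw [mul_add, add_mul, mul_smul_comm, smul_mul_assoc, mul_smul_comm, mul_one, smul_mul_assoc,
      hk']
  have hr : r' = k * r * star k := by
    have : (k * r * star k) * (Real.sinh t • (k * u * star k) + Real.cosh t • 1) = 1 := by
      rw [hQ]
      calc _ = k * (r * (star k * k) * (Real.sinh t • u + Real.cosh t • 1)) * star k := by
            simp only [mul_assoc]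
        _ = 1 := by rw [hk, mul_one, h2, mul_one, hk']
    exact (left_inv_eq_right_inv this h1').symm
  rw [h3', hr, hQ, h3]
  calc _ = k * ((Real.cosh t • u + Real.sinh t • 1) * (star k * k) * r) * star k := by
        simp only [mul_assoc]
    _ = _ := by rw [hk, mul_one]

/-- Time reversal: it transfers estimates at +∞ to -∞ whenever M contains -1. -/
theorem flow_neg (hτ : IsTrace τ) {u : 𝔸} (hu : star u * u = 1) (t : ℝ) :
    flow t (-u) = - flow (-t) u := by
  obtain ⟨r, h1, h2, h3, h4⟩ := hτ.exists_flow_inverse hu (-t)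
  have hu' : star (-u) * (-u) = 1 := by simpa using hu
  obtain ⟨r', h1', h2', h3', h4'⟩ := hτ.exists_flow_inverse hu' t
  rw [Real.sinh_neg, Real.cosh_neg] at *
  have e : Real.sinh t • -u + Real.cosh t • (1 : 𝔸) = -Real.sinh t • u + Real.cosh t • 1 := by
    module
  rw [e] at h1'
  rw [h3, h3', left_inv_eq_right_inv h2 h1', ← neg_mul]
  congr 1
  module

variable [CompleteSpace 𝔸]

/-- Numerator P and denominator Q satisfy P' = Q and Q' = P, so the quotient V = P Q⁻¹ solves the
Riccati equation. -/
theorem hasDerivAt_flow (hτ : IsTrace τ) {u : 𝔸} (hu : star u * u = 1) (t : ℝ) :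
    HasDerivAt (fun t => flow t u) (1 - flow t u * flow t u) t := by
  obtain ⟨r, h1, h2, h3, h4⟩ := hτ.exists_flow_inverse hu t
  have hP : HasDerivAt (fun t => Real.cosh t • u + Real.sinh t • (1 : 𝔸))
      (Real.sinh t • u + Real.cosh t • 1) t :=
    ((Real.hasDerivAt_cosh t).smul_const u).add ((Real.hasDerivAt_sinh t).smul_const 1)
  have hQ : HasDerivAt (fun t => Real.sinh t • u + Real.cosh t • (1 : 𝔸))
      (Real.cosh t • u + Real.sinh t • 1) t :=
    ((Real.hasDerivAt_sinh t).smul_const u).add ((Real.hasDerivAt_cosh t).smul_const 1)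
  have hI := (hasFDerivAt_ringInverse (𝕜 := ℝ) (⟨_, r, h1, h2⟩ : 𝔸ˣ)).comp_hasDerivAt t hQ
  have hir : Ring.inverse (Real.sinh t • u + Real.cosh t • (1 : 𝔸)) = r :=
    Ring.inverse_unit (⟨_, r, h1, h2⟩ : 𝔸ˣ)
  have := hP.mul hI
  simp only [Function.comp_apply, hir] at this
  convert this using 1
  · funext s
    simp [flow, mob]
  · simp only [neg_apply, ContinuousLinearMap.mulLeftRight_apply,
      Units.inv_mk, h1, h3]
    rw [mul_neg, ← sub_eq_add_neg]
    congr 1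
    simp only [mul_assoc]

end IsTrace

end TraceAlgebra
-- The Cayley transform as a locally bi-Lipschitz chart.
section Cayley

variable {𝔸 : Type*} [NormedRing 𝔸] [NormedAlgebra ℝ 𝔸] [StarRing 𝔸]

/-- The Cayley transform. -/
noncomputable def cay (x : 𝔸) : 𝔸 := (1 - x) * Ring.inverse (1 + x)

theorem cay_eq {x : 𝔸} (hx : IsUnit (1 + x)) : cay x = (2 : ℝ) • Ring.inverse (1 + x) - 1 := by
  have h : (1 - x : 𝔸) = (2 : ℝ) • 1 - (1 + x) := by module
  rw [cay, h, sub_mul, Ring.mul_inverse_cancel _ hx, smul_mul_assoc, one_mul]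

theorem one_add_cay {x : 𝔸} (hx : IsUnit (1 + x)) :
    1 + cay x = (2 : ℝ) • Ring.inverse (1 + x) := by
  rw [cay_eq hx]; abel

theorem isUnit_one_add_cay {x : 𝔸} (hx : IsUnit (1 + x)) : IsUnit (1 + cay x) := by
  rw [one_add_cay hx]
  exact hx.ringInverse.smul (Units.mk0 (2 : ℝ) two_ne_zero)

/-- Being an involution, the transform is bi-Lipschitz on compact sets as soon as it is Lipschitz on
them. -/
theorem cay_cay {x : 𝔸} (hx : IsUnit (1 + x)) : cay (cay x) = x := by
  have h1 := isUnit_one_add_cay hx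
  have h2 : Ring.inverse (1 + cay x) = (2⁻¹ : ℝ) • (1 + x) := by
    have h3 : (1 + cay x) * ((2⁻¹ : ℝ) • (1 + x)) = 1 := by
      rw [one_add_cay hx, smul_mul_smul_comm, Ring.inverse_mul_cancel _ hx]
      norm_num
    exact left_inv_eq_right_inv (Ring.inverse_mul_cancel _ h1) h3
  rw [cay_eq h1, h2]
  module

theorem cay_zero : cay (0 : 𝔸) = 1 := by simp [cay]

theorem commute_one_add_inverse {x : 𝔸} (hx : IsUnit (1 + x)) :
    Commute (1 - x) (Ring.inverse (1 + x)) := by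
  have h : (1 - x : 𝔸) = (2 : ℝ) • 1 - (1 + x) := by module
  rw [h]
  refine ((Commute.one_left _).smul_left _).sub_left ?_
  exact (Ring.mul_inverse_cancel _ hx).trans (Ring.inverse_mul_cancel _ hx).symm

theorem star_cay_mul [StarModule ℝ 𝔸] {x : 𝔸} (hx : IsUnit (1 + x)) (hs : star x = -x) :
    star (cay x) * cay x = 1 := by
  have hm : IsUnit (1 - x) := by
    have := hx.star
    rwa [star_add, star_one, hs, ← sub_eq_add_neg] at this
  have h1 : star (cay x) = Ring.inverse (1 - x) * (1 + x) := by
    rw [cay, star_mul, ← Ring.inverse_star, star_add, star_sub, star_one, hs, sub_neg_eq_add,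
      ← sub_eq_add_neg]
  rw [h1, cay, (commute_one_add_inverse hx).eq, mul_assoc, ← mul_assoc (1 + x),
    Ring.mul_inverse_cancel _ hx, one_mul, Ring.inverse_mul_cancel _ hm]

theorem star_cay_of_unitary [FiniteDimensional ℝ 𝔸] [StarModule ℝ 𝔸] {u : 𝔸}
    (hu : star u * u = 1) (h : IsUnit (1 + u)) : star (cay u) = -cay u := by
  have h2 : IsUnit (1 + star u) := by simpa using h.star
  have h1 : star (cay u) = Ring.inverse (1 + star u) * (1 - star u) := by
    rw [cay, star_mul, ← Ring.inverse_star, star_add, star_sub, star_one]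
  have h3 : (1 + star u) * (-((1 - u) * Ring.inverse (1 + u))) = 1 - star u := by
    have h4 : (1 + star u) * (1 - u) = -((1 - star u) * (1 + u)) := by
      simp only [mul_add, add_mul, mul_sub, sub_mul, hu]; noncomm_ring
    rw [mul_neg, ← mul_assoc, h4, neg_mul, neg_neg, mul_assoc, Ring.mul_inverse_cancel _ h, mul_one]
  rw [h1, cay, ← h3, ← mul_assoc, Ring.inverse_mul_cancel _ h2, one_mul]

theorem exists_lipschitzOnWith_cay [CompleteSpace 𝔸] {T : Set 𝔸} (hT : IsCompact T)
    (h : ∀ x ∈ T, IsUnit (1 + x)) : ∃ K, LipschitzOnWith K cay T := by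
  have hc : ContinuousOn (fun x : 𝔸 => Ring.inverse (1 + x)) T := by
    intro x hx
    have h1 : ContinuousAt Ring.inverse (1 + x) := by
      obtain ⟨v, hv⟩ := h x hx
      rw [← hv]
      exact NormedRing.inverse_continuousAt v
    exact (ContinuousAt.comp (f := fun x : 𝔸 => 1 + x) h1 (by fun_prop)).continuousWithinAt
  obtain ⟨C, hC⟩ := hT.exists_bound_of_continuousOn hc
  refine ⟨Real.toNNReal (2 * (max C 0) ^ 2), LipschitzOnWith.of_dist_le_mul fun x hx y hy => ?_⟩
  -- The resolvent identity: the difference of two inverses is a product containing y - x.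
  have h1 : cay x - cay y
      = (2 : ℝ) • (Ring.inverse (1 + x) * (y - x) * Ring.inverse (1 + y)) := by
    have h2 : Ring.inverse (1 + x) * (y - x) * Ring.inverse (1 + y)
        = Ring.inverse (1 + x) * ((1 + y) * Ring.inverse (1 + y))
          - (Ring.inverse (1 + x) * (1 + x)) * Ring.inverse (1 + y) := by noncomm_ring
    rw [h2, Ring.mul_inverse_cancel _ (h y hy), Ring.inverse_mul_cancel _ (h x hx),
      cay_eq (h x hx), cay_eq (h y hy), mul_one, one_mul]
    module
  rw [dist_eq_norm, dist_eq_norm, h1, Real.coe_toNNReal _ (by positivity), norm_smul]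
  have h3 : ‖Ring.inverse (1 + x)‖ ≤ max C 0 := (hC x hx).trans (le_max_left _ _)
  have h4 : ‖Ring.inverse (1 + y)‖ ≤ max C 0 := (hC y hy).trans (le_max_left _ _)
  calc ‖(2 : ℝ)‖ * ‖Ring.inverse (1 + x) * (y - x) * Ring.inverse (1 + y)‖
      ≤ 2 * (‖Ring.inverse (1 + x)‖ * ‖y - x‖ * ‖Ring.inverse (1 + y)‖) := by
        rw [Real.norm_ofNat]
        gcongr
        exact (norm_mul_le _ _).trans (mul_le_mul_of_nonneg_right (norm_mul_le _ _) (norm_nonneg _))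
    _ ≤ 2 * (max C 0 * ‖y - x‖ * max C 0) := by gcongr
    _ = 2 * max C 0 ^ 2 * ‖x - y‖ := by rw [norm_sub_rev]; ring

end Cayley

/-! ### The Hausdorff volume of M: finiteness, positivity on open sets, invariance. -/

section Volume

variable {𝔸 : Type*} [NormedRing 𝔸] [NormedAlgebra ℝ 𝔸] [StarRing 𝔸] [StarModule ℝ 𝔸]

/-- The space of skew-adjoint elements. -/
def skew (𝔸 : Type*) [NormedRing 𝔸] [NormedAlgebra ℝ 𝔸] [StarRing 𝔸] [StarModule ℝ 𝔸] :
    Submodule ℝ 𝔸 where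
  carrier := {x | star x = -x}
  add_mem' {x y} hx hy := by
    simp only [mem_ofPred_eq] at *
    rw [star_add, hx, hy]; abel
  zero_mem' := by simp
  smul_mem' r x hx := by
    simp only [mem_ofPred_eq] at *
    rw [star_smul, hx]; simp

/-- `M` is a closed group of unitary elements that contains the Cayley transforms of
skew-adjoint elements. -/
structure IsUnitaryModel (M : Set 𝔸) : Prop where
  unitary : ∀ u ∈ M, star u * u = 1
  closed : IsClosed M
  mul_mem : ∀ u ∈ M, ∀ v ∈ M, u * v ∈ M
  star_mem : ∀ u ∈ M, star u ∈ M
  cay_mem : ∀ x, star x = -x → cay x ∈ M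
  cover : ∀ u ∈ M, ∃ k, star k * k = 1 ∧ IsUnit (1 + k * u)

/-- `μ` is a finite measure on `M`, invariant under the symmetries of `M`, with full support. -/
structure IsInvariantOn [MeasurableSpace 𝔸] (M : Set 𝔸) (μ : Measure 𝔸) : Prop where
  finite : IsFiniteMeasure μ
  ae_mem : ∀ᵐ u ∂μ, u ∈ M
  left : ∀ k ∈ M, MeasurePreserving (fun u => k * u) μ μ
  right : ∀ k ∈ M, MeasurePreserving (fun u => u * k) μ μ
  adjoint : MeasurePreserving (fun u => star u) μ μ
  pos : ∀ u ∈ M, ∀ O, IsOpen O → u ∈ O → 0 < μ O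

theorem LipschitzOnWith.euclideanHausdorffMeasure_image_le {X Y : Type*} [EMetricSpace X]
    [EMetricSpace Y] [MeasurableSpace X] [BorelSpace X] [MeasurableSpace Y] [BorelSpace Y]
    {K : NNReal} {f : X → Y} {s : Set X} (h : LipschitzOnWith K f s) (d : ℕ) :
    (μHE[d] : Measure Y) (f '' s) ≤ (K : ℝ≥0∞) ^ (d : ℝ) * (μHE[d] : Measure X) s := by
  rw [Measure.euclideanHausdorffMeasure_def, Measure.euclideanHausdorffMeasure_def,
    Measure.smul_apply, Measure.smul_apply, ENNReal.smul_def, ENNReal.smul_def, smul_eq_mul,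
    smul_eq_mul, mul_left_comm]
  gcongr
  exact h.hausdorffMeasure_image_le (Nat.cast_nonneg d)

variable [FiniteDimensional ℝ 𝔸] [CompleteSpace 𝔸] [MeasurableSpace 𝔸] [BorelSpace 𝔸]
  {τ : 𝔸 →ₗ[ℝ] ℝ} {M : Set 𝔸}

theorem IsUnitaryModel.isCompact (hM : IsUnitaryModel M) (hτ : IsTrace τ) : IsCompact M := by
  have := FiniteDimensional.proper ℝ 𝔸
  refine Metric.isCompact_of_isClosed_isBounded hM.closed ?_
  refine (Metric.isBounded_closedBall (x := (0 : 𝔸)) (r := ‖(1 : 𝔸)‖)).subset fun u hu => ?_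
  rw [mem_closedBall_zero_iff, hτ.norm_unitary (hM.unitary u hu)]

theorem IsUnitaryModel.one_mem (hM : IsUnitaryModel M) : (1 : 𝔸) ∈ M := by
  have := hM.cay_mem 0 (by simp)
  rwa [cay_zero] at this

/-- On a linear space the Hausdorff measure of its own dimension is a Haar measure, finite on
compact sets; the inclusion into the algebra is an isometry. -/
theorem euclideanHausdorffMeasure_skew_lt_top {S : Set 𝔸} (hS : IsCompact S)
    (h : S ⊆ skew 𝔸) : (μHE[Module.finrank ℝ (skew 𝔸)] : Measure 𝔸) S < ⊤ := by
  have h1 : S = Subtype.val '' ((Subtype.val : skew 𝔸 → 𝔸) ⁻¹' S) := by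
    refine (image_preimage_eq_of_subset fun x hx => ⟨⟨x, h hx⟩, rfl⟩).symm
  have hc : IsClosed ((skew 𝔸 : Submodule ℝ 𝔸) : Set 𝔸) := Submodule.closed_of_finiteDimensional _
  rw [h1, Isometry.euclideanHausdorffMeasure_image isometry_subtype_coe]
  have h2 : IsCompact ((Subtype.val : skew 𝔸 → 𝔸) ⁻¹' S) :=
    hc.isClosedEmbedding_subtypeVal.isCompact_preimage hS
  have := isAddHaarMeasure_euclideanHausdorffMeasure (E := skew 𝔸)
  exact h2.measure_lt_top

/-- Local finiteness is enough by compactness. Near u, after multiplication by a suitable k, the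
Cayley transform carries M into the skew space, and its inverse is Lipschitz. -/
theorem IsUnitaryModel.volume_lt_top (hM : IsUnitaryModel M) (hτ : IsTrace τ) :
    (μHE[Module.finrank ℝ (skew 𝔸)] : Measure 𝔸) M < ⊤ := by
  refine (hM.isCompact hτ).measure_lt_top_of_nhdsWithin fun u hu => ?_
  -- The element k need not lie in M (in the orthogonal case it may have determinant -1). It is only
  -- used as an isometry of the whole algebra.
  obtain ⟨k, hk, hku⟩ := hM.cover u hu
  have hopen : IsOpen {v : 𝔸 | IsUnit (1 + k * v)} :=
    Units.isOpen.preimage (f := fun v : 𝔸 => 1 + k * v) (by fun_prop)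
  obtain ⟨r, hr, hrO⟩ := Metric.nhds_basis_closedBall.mem_iff.1 (hopen.mem_nhds hku)
  refine ⟨M ∩ Metric.closedBall u r,
    inter_mem_nhdsWithin _ (Metric.closedBall_mem_nhds u hr), ?_⟩
  have hT : IsCompact (M ∩ Metric.closedBall u r) :=
    (hM.isCompact hτ).inter_right Metric.isClosed_closedBall
  have hkT : IsCompact ((fun v => k * v) '' (M ∩ Metric.closedBall u r)) :=
    hT.image (by fun_prop)
  have hkU : ∀ x ∈ (fun v => k * v) '' (M ∩ Metric.closedBall u r), IsUnit (1 + x) := by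
    rintro _ ⟨v, hv, rfl⟩
    exact hrO hv.2
  obtain ⟨K, hK⟩ := exists_lipschitzOnWith_cay hkT hkU
  have hS := hkT.image_of_continuousOn hK.continuousOn
  have hSU : ∀ x ∈ cay '' ((fun v => k * v) '' (M ∩ Metric.closedBall u r)), IsUnit (1 + x) := by
    rintro _ ⟨v, hv, rfl⟩
    exact isUnit_one_add_cay (hkU v hv)
  have hSs : cay '' ((fun v => k * v) '' (M ∩ Metric.closedBall u r)) ⊆ skew 𝔸 := by
    rintro _ ⟨_, ⟨v, hv, rfl⟩, rfl⟩
    refine star_cay_of_unitary ?_ (hkU _ ⟨v, hv, rfl⟩)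
    rw [star_mul, mul_assoc, ← mul_assoc (star k), hk, one_mul, hM.unitary v hv.1]
  obtain ⟨K', hK'⟩ := exists_lipschitzOnWith_cay hS hSU
  have h1 := LipschitzOnWith.euclideanHausdorffMeasure_image_le hK' (Module.finrank ℝ (skew 𝔸))
  have h2 : cay '' (cay '' ((fun v => k * v) '' (M ∩ Metric.closedBall u r)))
      = (fun v => k * v) '' (M ∩ Metric.closedBall u r) := by
    rw [image_image]
    exact (image_congr fun x hx => cay_cay (hkU x hx)).trans (image_id' _)
  have hiso : Isometry (fun v : 𝔸 => k * v) := Isometry.of_dist_eq fun x y => by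
    rw [dist_eq_norm, dist_eq_norm, ← mul_sub, hτ.norm_mul_left hk]
  rw [h2, hiso.euclideanHausdorffMeasure_image] at h1
  refine h1.trans_lt (ENNReal.mul_lt_top ?_ (euclideanHausdorffMeasure_skew_lt_top hS hSs))
  exact ENNReal.rpow_lt_top_of_nonneg (Nat.cast_nonneg _) ENNReal.coe_ne_top

/-- The chart is used the other way round: a small ball of skew elements is carried by x ↦ cay x · u
into the open set, and it is the Lipschitz image of a part of M, which therefore cannot be null. -/
theorem IsUnitaryModel.volume_inter_pos (hM : IsUnitaryModel M) (hτ : IsTrace τ) {u : 𝔸}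
    (hu : u ∈ M) {O : Set 𝔸} (hO : IsOpen O) (huO : u ∈ O) :
    0 < (μHE[Module.finrank ℝ (skew 𝔸)] : Measure 𝔸) (O ∩ M) := by
  have := FiniteDimensional.proper ℝ 𝔸
  have hcont : ContinuousAt (fun x : 𝔸 => cay x * u) 0 := by
    have h1 : ContinuousAt (Ring.inverse : 𝔸 → 𝔸) (1 + 0) := by
      simpa using NormedRing.inverse_continuousAt (1 : 𝔸ˣ)
    have h2 : ContinuousAt (fun x : 𝔸 => Ring.inverse (1 + x)) 0 :=
      ContinuousAt.comp (f := fun x : 𝔸 => 1 + x) h1 (by fun_prop)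
    unfold cay
    fun_prop
  have hmem : (fun x : 𝔸 => cay x * u) ⁻¹' O ∈ 𝓝 (0 : 𝔸) :=
    hcont (hO.mem_nhds (by simpa [cay_zero] using huO))
  obtain ⟨r, hr, hrO⟩ := Metric.nhds_basis_closedBall.mem_iff.1 hmem
  set S' : Set (skew 𝔸) := Metric.closedBall 0 r
  set S : Set 𝔸 := Subtype.val '' S' with hSdef
  have hSs : ∀ x ∈ S, star x = -x := by rintro _ ⟨x, _, rfl⟩; exact x.2
  have hSc : IsCompact S := (isCompact_closedBall _ _).image continuous_subtype_val
  have hSU : ∀ x ∈ S, IsUnit (1 + x) := fun x hx => hτ.isUnit_one_add_skew (hSs x hx)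
  obtain ⟨K, hK⟩ := exists_lipschitzOnWith_cay hSc hSU
  have hT := hSc.image_of_continuousOn hK.continuousOn
  have hTU : ∀ x ∈ cay '' S, IsUnit (1 + x) := by
    rintro _ ⟨v, hv, rfl⟩
    exact isUnit_one_add_cay (hSU v hv)
  obtain ⟨K', hK'⟩ := exists_lipschitzOnWith_cay hT hTU
  have h1 := LipschitzOnWith.euclideanHausdorffMeasure_image_le hK' (Module.finrank ℝ (skew 𝔸))
  have h2 : cay '' (cay '' S) = S := by
    rw [image_image]
    exact (image_congr fun x hx => cay_cay (hSU x hx)).trans (image_id' _)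
  have hu' := mul_star_of_star_mul (hM.unitary u hu)
  have hiso : Isometry (fun v : 𝔸 => v * u) := Isometry.of_dist_eq fun x y => by
    rw [dist_eq_norm, dist_eq_norm, ← sub_mul, hτ.norm_mul_right hu']
  have hsub : (fun v : 𝔸 => v * u) '' (cay '' S) ⊆ O ∩ M := by
    rintro _ ⟨_, ⟨x, hx, rfl⟩, rfl⟩
    refine ⟨?_, hM.mul_mem _ (hM.cay_mem x (hSs x hx)) _ hu⟩
    obtain ⟨y, hy, rfl⟩ := hx
    apply hrO
    simpa [S'] using hy
  have hpos : 0 < (μHE[Module.finrank ℝ (skew 𝔸)] : Measure 𝔸) S := by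
    rw [hSdef, Isometry.euclideanHausdorffMeasure_image isometry_subtype_coe]
    exact Metric.measure_closedBall_pos _ _ hr
  refine lt_of_lt_of_le ?_ (measure_mono hsub)
  rw [hiso.euclideanHausdorffMeasure_image]
  rw [h2] at h1
  refine pos_iff_ne_zero.2 fun h0 => ?_
  rw [h0, mul_zero] at h1
  exact absurd hpos (not_lt.2 h1)

theorem IsUnitaryModel.measurePreserving (hM : IsUnitaryModel M) (e : 𝔸 ≃ᵢ 𝔸) (d : ℕ)
    (he : e ⁻¹' M = M) :
    MeasurePreserving e ((μHE[d] : Measure 𝔸).restrict M) ((μHE[d] : Measure 𝔸).restrict M) := by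
  have := (e.measurePreserving_euclideanHausdorffMeasure d).restrict_preimage hM.closed.measurableSet
  rwa [he] at this

theorem IsUnitaryModel.isInvariantOn (hM : IsUnitaryModel M) (hτ : IsTrace τ) :
    IsInvariantOn M ((μHE[Module.finrank ℝ (skew 𝔸)] : Measure 𝔸).restrict M) where
  finite := ⟨by rw [Measure.restrict_apply_univ]; exact hM.volume_lt_top hτ⟩
  ae_mem := ae_restrict_mem hM.closed.measurableSet
  left k hk := by
    have h1 := hM.unitary k hk
    have h2 := mul_star_of_star_mul h1
    refine hM.measurePreserving ⟨⟨fun u => k * u, fun u => star k * u, fun u => ?_, fun u => ?_⟩,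
      Isometry.of_dist_eq fun x y => ?_⟩ _ ?_
    · simp [← mul_assoc, h1]
    · simp [← mul_assoc, h2]
    · simp [dist_eq_norm, ← mul_sub, hτ.norm_mul_left h1]
    · ext u
      refine ⟨fun h => ?_, fun h => hM.mul_mem _ hk _ h⟩
      have := hM.mul_mem _ (hM.star_mem k hk) _ h
      simpa [← mul_assoc, h1] using this
  right k hk := by
    have h1 := hM.unitary k hk
    have h2 := mul_star_of_star_mul h1
    refine hM.measurePreserving ⟨⟨fun u => u * k, fun u => u * star k, fun u => ?_, fun u => ?_⟩,
      Isometry.of_dist_eq fun x y => ?_⟩ _ ?_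
    · simp [mul_assoc, h2]
    · simp [mul_assoc, h1]
    · simp [dist_eq_norm, ← sub_mul, hτ.norm_mul_right h2]
    · ext u
      refine ⟨fun h => ?_, fun h => hM.mul_mem _ h _ hk⟩
      have := hM.mul_mem _ h _ (hM.star_mem k hk)
      simpa [mul_assoc, h2] using this
  adjoint := by
    refine hM.measurePreserving ⟨⟨fun u => star u, fun u => star u, star_star, star_star⟩,
      Isometry.of_dist_eq fun x y => ?_⟩ _ ?_
    · simp [dist_eq_norm, ← star_sub, hτ.norm_star]
    · ext u
      refine ⟨fun h => ?_, fun h => hM.star_mem _ h⟩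
      have := hM.star_mem _ h
      simpa using this
  pos u hu O hO huO := by
    rw [Measure.restrict_apply hO.measurableSet]
    exact hM.volume_inter_pos hτ hu hO huO

end Volume
-- A Remez inequality for polynomials on the unit interval.
/-- `f` is a polynomial function of degree at most `D`. -/
def IsPolyFun (D : ℕ) (f : ℝ → ℝ) : Prop := ∃ p : Polynomial ℝ, p.natDegree ≤ D ∧ ∀ s, f s = p.eval s

theorem IsPolyFun.mono {D D' : ℕ} {f : ℝ → ℝ} (h : IsPolyFun D f) (hD : D ≤ D') :
    IsPolyFun D' f := by
  obtain ⟨p, hp, hf⟩ := h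
  exact ⟨p, hp.trans hD, hf⟩

/-- A greedy choice: intervals of length 2r around the points already chosen cannot cover S, so one
more point fits. -/
theorem exists_separated_finset {S : Set ℝ} {r : ℝ} (hr : 0 < r) (k : ℕ)
    (h : ENNReal.ofReal (2 * r * k) < volume S) :
    ∃ T : Finset ℝ, ↑T ⊆ S ∧ T.card = k + 1 ∧ ∀ x ∈ T, ∀ y ∈ T, x ≠ y → r ≤ |x - y| := by
  induction k with
  | zero =>
    have : S.Nonempty := by
      rw [nonempty_iff_ne_empty]
      rintro rfl
      simp at h
    obtain ⟨x, hx⟩ := this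
    exact ⟨{x}, by simpa using hx, by simp, by simp⟩
  | succ k ih =>
    obtain ⟨T, hTS, hTc, hT⟩ := ih (lt_of_le_of_lt (ENNReal.ofReal_le_ofReal (by
      push_cast; nlinarith)) h)
    have hU : volume (⋃ x ∈ T, Ioo (x - r) (x + r)) ≤ ENNReal.ofReal (2 * r * ↑(k + 1)) := by
      refine (measure_biUnion_finset_le _ _).trans ?_
      simp only [Real.volume_Ioo]
      rw [Finset.sum_congr rfl (g := fun _ => ENNReal.ofReal (2 * r))
        (fun x _ => by congr 1; ring), Finset.sum_const, hTc, nsmul_eq_mul,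
        mul_comm (2 * r), ENNReal.ofReal_mul (Nat.cast_nonneg _), ENNReal.ofReal_natCast]
    have hne : (S \ ⋃ x ∈ T, Ioo (x - r) (x + r)).Nonempty := by
      rw [nonempty_iff_ne_empty]
      intro h0
      exact absurd (measure_mono (sdiff_eq_empty.1 h0)) (not_le.2 (hU.trans_lt h))
    obtain ⟨y, hyS, hy⟩ := hne
    have hy' : ∀ x ∈ T, r ≤ |x - y| := by
      intro x hx
      by_contra hlt
      rw [not_le, abs_lt] at hlt
      exact hy (mem_biUnion hx ⟨by linarith, by linarith⟩)
    have hyT : y ∉ T := fun hyT => by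
      have h0 := hy' y hyT
      rw [sub_self, abs_zero] at h0
      exact absurd hr (not_lt.2 h0)
    refine ⟨insert y T, ?_, by rw [Finset.card_insert_of_notMem hyT, hTc], ?_⟩
    · rw [Finset.coe_insert]
      exact insert_subset hyS hTS
    · intro x hx z hz hxz
      rw [Finset.mem_insert] at hx hz
      rcases hx with rfl | hx <;> rcases hz with rfl | hz
      · exact absurd rfl hxz
      · rw [abs_sub_comm]; exact hy' z hz
      · exact hy' x hx
      · exact hT x hx z hz hxz

/-- A Remez type inequality. -/
theorem IsPolyFun.mul_pow_le {D : ℕ} {f : ℝ → ℝ} (hf : IsPolyFun D f) {S : Set ℝ}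
    (hS : S ⊆ Icc 0 1) {r η : ℝ} (hr : 0 < r) (hη : ∀ s ∈ S, |f s| ≤ η)
    (hvol : ENNReal.ofReal (2 * r * D) < volume S) : |f 1| * r ^ D ≤ (D + 1) * η := by
  obtain ⟨p, hp, hfp⟩ := hf
  -- D + 1 nodes determine the polynomial by Lagrange interpolation. In a basis polynomial evaluated
  -- at 1, each of the D factors |1 - y| / |x - y| is at most 1 / r.
  obtain ⟨T, hTS, hTc, hT⟩ := exists_separated_finset hr D hvol
  have hdeg : p.degree < (T.card : ℕ) := by
    rw [hTc]
    exact lt_of_le_of_lt Polynomial.degree_le_natDegree (by exact_mod_cast Nat.lt_succ_of_le hp)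
  have h1 := Lagrange.eq_interpolate (s := T) (v := id) (f := p) (injOn_id _) hdeg
  have h2 : f 1 = ∑ x ∈ T, f x * ∏ y ∈ T.erase x, ((x - y)⁻¹ * (1 - y)) := by
    rw [hfp, h1, Lagrange.interpolate_apply, Polynomial.eval_finsetSum]
    refine Finset.sum_congr rfl fun x _ => ?_
    rw [Polynomial.eval_mul, Polynomial.eval_C, hfp, id, Lagrange.basis, Polynomial.eval_prod]
    congr 1
    refine Finset.prod_congr rfl fun y _ => ?_
    simp [Lagrange.basisDivisor]
  have h3 : ∀ x ∈ T, |f x * ∏ y ∈ T.erase x, ((x - y)⁻¹ * (1 - y))| * r ^ D ≤ η := by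
    intro x hx
    have hc : (T.erase x).card = D := by rw [Finset.card_erase_of_mem hx, hTc]; simp
    have hle : ∏ y ∈ T.erase x, (|(x - y)⁻¹ * (1 - y)| * r) ≤ 1 := by
      refine Finset.prod_le_one (fun y _ => by positivity) fun y hy => ?_
      have hyT := Finset.mem_of_mem_erase hy
      have hxy := hT x hx y hyT (Finset.ne_of_mem_erase hy).symm
      have hy01 := hS (hTS hyT)
      rw [abs_mul, abs_inv]
      have hpos : 0 < |x - y| := hr.trans_le hxy
      have h5 : |1 - y| ≤ 1 := by rw [abs_le]; constructor <;> linarith [hy01.1, hy01.2]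
      calc |x - y|⁻¹ * |1 - y| * r ≤ |x - y|⁻¹ * 1 * |x - y| := by gcongr
        _ = 1 := by field_simp
    rw [abs_mul, Finset.abs_prod, mul_assoc, ← hc, ← Finset.prod_const, ← Finset.prod_mul_distrib]
    have h0 : 0 ≤ |f x| := abs_nonneg _
    calc |f x| * ∏ y ∈ T.erase x, (|(x - y)⁻¹ * (1 - y)| * r) ≤ |f x| * 1 := by gcongr
      _ ≤ η := by rw [mul_one]; exact hη x (hTS hx)
  calc |f 1| * r ^ D ≤ (∑ x ∈ T, |f x * ∏ y ∈ T.erase x, ((x - y)⁻¹ * (1 - y))|) * r ^ D := by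
        rw [h2]
        gcongr
        exact Finset.abs_sum_le_sum_abs _ _
    _ = ∑ x ∈ T, |f x * ∏ y ∈ T.erase x, ((x - y)⁻¹ * (1 - y))| * r ^ D := Finset.sum_mul ..
    _ ≤ ∑ x ∈ T, η := Finset.sum_le_sum h3
    _ = (D + 1) * η := by rw [Finset.sum_const, hTc, nsmul_eq_mul]; push_cast; ring

/-- The Remez inequality solved for the measure of S: a polynomial of size at least c at 1 is below
η only on a set of measure of order (η / c)^(1/D). -/
theorem IsPolyFun.volume_le {D : ℕ} (hD : D ≠ 0) {f : ℝ → ℝ} (hf : IsPolyFun D f) {S : Set ℝ}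
    (hS : S ⊆ Icc 0 1) {c η : ℝ} (hc : 0 < c) (hη0 : 0 < η) (hη : ∀ s ∈ S, |f s| ≤ η)
    (hc1 : c ≤ |f 1|) :
    volume S ≤ ENNReal.ofReal (2 * (D + 1) * ((D + 1) * η / c) ^ (1 / D : ℝ)) := by
  by_contra hlt
  rw [not_le] at hlt
  set r : ℝ := ((D + 1) * η / c) ^ (1 / D : ℝ)
  have hr : 0 < r := by positivity
  -- a slightly larger separation is still possible
  have hfin : volume S ≠ ⊤ := ne_top_of_le_ne_top (by simp) (measure_mono hS)
  have h1 : 2 * (D + 1) * r < (volume S).toReal := by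
    rwa [ENNReal.ofReal_lt_iff_lt_toReal (by positivity) hfin] at hlt
  set r' : ℝ := (volume S).toReal / (2 * (D + 1))
  have hrr' : r < r' := by
    rw [lt_div_iff₀ (by positivity)]; linarith
  have hvol : ENNReal.ofReal (2 * r' * D) < volume S := by
    rw [ENNReal.ofReal_lt_iff_lt_toReal (by positivity) hfin]
    have : (volume S).toReal = 2 * r' * (D + 1) := by
      simp only [r']; field_simp
    rw [this]
    have : 0 < r' := hr.trans hrr'
    nlinarith
  have h2 := hf.mul_pow_le hS (hr.trans hrr') hη hvol
  have h3 : r ^ D = (D + 1) * η / c := by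
    simp only [r]
    rw [← Real.rpow_natCast, ← Real.rpow_mul (by positivity), one_div,
      inv_mul_cancel₀ (by exact_mod_cast hD), Real.rpow_one]
  have h4 : r ^ D < r' ^ D := pow_lt_pow_left₀ hrr' hr.le hD
  have h5 : c * r' ^ D ≤ |f 1| * r' ^ D := by gcongr
  rw [h3, div_lt_iff₀ hc] at h4
  linarith

/-! ### Power bounds for the measure of sublevel sets. -/

section Sublevel

variable {𝔸 : Type*} [NormedRing 𝔸] [NormedAlgebra ℝ 𝔸] [StarRing 𝔸]

/-- A curve in `M` from `1` to `w` along which `f` is, up to a positive factor,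
polynomial on each translate. -/
structure IsPolyCurve (M : Set 𝔸) (f : 𝔸 → ℝ) (κ : ℝ → 𝔸) (D : ℕ) (d : ℝ → ℝ) : Prop where
  cont : Continuous κ
  zero : κ 0 = 1
  mem : ∀ s, κ s ∈ M
  cont_factor : Continuous d
  pos : ∀ s, 0 < d s
  poly : ∀ v, IsPolyFun D fun s => d s * f (κ s * v)

variable [MeasurableSpace 𝔸] [BorelSpace 𝔸] {τ : 𝔸 →ₗ[ℝ] ℝ} {M : Set 𝔸} {μ : Measure 𝔸}

theorem IsTrace.continuous_star (hτ : IsTrace τ) : Continuous (star : 𝔸 → 𝔸) :=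
  (Isometry.of_dist_eq fun x y => by
    rw [dist_eq_norm, dist_eq_norm, ← star_sub, hτ.norm_star]).continuous

/-- The measure of the sublevel set does not change under translation by κ(s). Averaging over s and
exchanging the integrals leaves, for fixed v, the set of times s with f(κ(s)v) small. The Remez
inequality bounds its length, because near u the polynomial stays away from zero at s = 1. -/
theorem IsInvariantOn.exists_nhds_sublevel_le (hτ : IsTrace τ)
    (hM : ∀ u ∈ M, star u * u = 1) (hμ : IsInvariantOn M μ)
    {f : 𝔸 → ℝ} (hf : Continuous f) {u : 𝔸} {κ : ℝ → 𝔸} {D : ℕ} {d : ℝ → ℝ}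
    (hκ : IsPolyCurve M f κ D d) (hu : f (κ 1 * u) ≠ 0) :
    ∃ O ∈ 𝓝 u, ∃ C a : ℝ, 0 ≤ C ∧ 0 < a ∧ ∀ δ ∈ Ioc (0 : ℝ) 1,
      μ (O ∩ {v | |f v| ≤ δ}) ≤ ENNReal.ofReal (C * δ ^ a) := by
  have hfin := hμ.finite
  have hκc := hκ.cont
  have hstar := hτ.continuous_star
  set c : ℝ := |d 1 * f (κ 1 * u)| / 2 with hcdef
  have hc : 0 < c := by
    have : d 1 * f (κ 1 * u) ≠ 0 := mul_ne_zero (hκ.pos 1).ne' hu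
    positivity
  set O' : Set 𝔸 := {v | c < |d 1 * f (κ 1 * v)|}
  have hO' : IsOpen O' := isOpen_lt continuous_const (by fun_prop)
  have huO' : star (κ 0) * u ∈ O' := by
    rw [hκ.zero, star_one, one_mul]
    change c < |d 1 * f (κ 1 * u)|
    linarith
  have hpre : (fun p : ℝ × 𝔸 => star (κ p.1) * p.2) ⁻¹' O' ∈ 𝓝 ((0 : ℝ), u) :=
    (Continuous.continuousAt (by fun_prop)).preimage_mem_nhds (hO'.mem_nhds huO')
  rw [nhds_prod_eq, mem_prod_iff] at hpre
  obtain ⟨R, hR, O, hO, hRO⟩ := hpre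
  obtain ⟨ρ₀, hρ₀, hρR⟩ := Metric.nhds_basis_closedBall.mem_iff.1 hR
  set ρ : ℝ := min ρ₀ 1
  have hρ : 0 < ρ := lt_min hρ₀ one_pos
  obtain ⟨O₁, hO₁O, hO₁, huO₁⟩ := mem_nhds_iff.1 hO
  obtain ⟨dm, hdm⟩ := (isCompact_Icc (a := (0 : ℝ)) (b := 1)).exists_bound_of_continuousOn
    hκ.cont_factor.continuousOn
  have hdm0 : 0 < dm := by
    have := hdm 0 (by simp)
    rw [Real.norm_of_nonneg (hκ.pos 0).le] at this
    exact (hκ.pos 0).trans_le this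
  -- The degree bound is raised by one so that the exponent 1 / D' makes sense for constant
  -- polynomials too.
  set D' : ℕ := D + 1 with hD'
  set K : ℝ := 2 * (D' + 1) * ((D' + 1) * dm / c) ^ (1 / D' : ℝ) with hK
  have hK0 : 0 ≤ K := by positivity
  refine ⟨O₁, hO₁.mem_nhds huO₁, ρ⁻¹ * (K * (μ univ).toReal), 1 / D', by positivity, by positivity,
    fun δ hδ => ?_⟩
  set A : Set 𝔸 := {v | |f v| ≤ δ}
  have hA : MeasurableSet A := (isClosed_le (by fun_prop) continuous_const).measurableSet
  -- Slices of Z at fixed s contain a translate of the sublevel set near u; slices at fixed v are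
  -- controlled by Remez. Fubini compares the two.
  set Z : Set (ℝ × 𝔸) := {p | p.1 ∈ Icc 0 ρ ∧ p.2 ∈ O' ∧ |f (κ p.1 * p.2)| ≤ δ}
  have hZ : MeasurableSet Z := by
    refine MeasurableSet.inter (measurable_fst measurableSet_Icc)
      (MeasurableSet.inter (measurable_snd hO'.measurableSet) ?_)
    exact (isClosed_le (f := fun p : ℝ × 𝔸 => |f (κ p.1 * p.2)|) (by fun_prop)
      continuous_const).measurableSet
  have h1 : ∀ s ∈ Icc 0 ρ, μ (O₁ ∩ A) ≤ μ (Prod.mk s ⁻¹' Z) := by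
    intro s hs
    rw [← (hμ.left _ (hκ.mem s)).measure_preimage (hO₁.measurableSet.inter hA).nullMeasurableSet]
    refine measure_mono fun v hv => ⟨hs, ?_, hv.2⟩
    have h2 : (s, κ s * v) ∈ R ×ˢ O := by
      refine ⟨hρR ?_, hO₁O hv.1⟩
      rw [mem_closedBall_zero_iff, Real.norm_of_nonneg hs.1]
      exact hs.2.trans (min_le_left _ _)
    have h3 := hRO h2
    simpa [← mul_assoc, hM _ (hκ.mem s)] using h3
  have h2 : ∀ v, volume ((fun s => (s, v)) ⁻¹' Z) ≤ ENNReal.ofReal (K * δ ^ (1 / D' : ℝ)) := by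
    intro v
    by_cases hv : v ∈ O'
    · have hpoly := (hκ.poly v).mono (Nat.le_succ D)
      have hsub : (fun s => (s, v)) ⁻¹' Z ⊆ Icc 0 1 := fun s hs =>
        ⟨hs.1.1, hs.1.2.trans (min_le_right _ _)⟩
      refine (hpoly.volume_le (Nat.succ_ne_zero D) hsub hc (η := dm * δ)
        (mul_pos hdm0 hδ.1) (fun s hs => ?_) hv.le).trans (ENNReal.ofReal_le_ofReal (le_of_eq ?_))
      · rw [abs_mul]
        have h5 := hdm s (hsub hs)
        rw [Real.norm_eq_abs] at h5
        have h6 : |f (κ s * v)| ≤ δ := hs.2.2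
        gcongr
      · have h7 : ((D' + 1) * (dm * δ) / c : ℝ) = (D' + 1) * dm / c * δ := by ring
        change 2 * ((D' : ℝ) + 1) * ((D' + 1) * (dm * δ) / c) ^ (1 / D' : ℝ) = _
        rw [h7, Real.mul_rpow (by positivity) hδ.1.le, hK]
        ring
    · have : (fun s => (s, v)) ⁻¹' Z = ∅ := by
        ext s
        simp only [mem_preimage, mem_empty_iff_false, iff_false]
        exact fun hs => hv hs.2.1
      rw [this, measure_empty]
      exact zero_le
  have h3 : ENNReal.ofReal ρ * μ (O₁ ∩ A) ≤ ENNReal.ofReal (K * δ ^ (1 / D' : ℝ)) * μ univ := by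
    calc ENNReal.ofReal ρ * μ (O₁ ∩ A) = ∫⁻ s in Icc 0 ρ, μ (O₁ ∩ A) := by
          rw [setLIntegral_const, Real.volume_Icc, sub_zero, mul_comm]
      _ ≤ ∫⁻ s in Icc 0 ρ, μ (Prod.mk s ⁻¹' Z) := setLIntegral_mono' measurableSet_Icc h1
      _ ≤ ∫⁻ s, μ (Prod.mk s ⁻¹' Z) := setLIntegral_le_lintegral _ _
      _ = (volume.prod μ) Z := (Measure.prod_apply hZ).symm
      _ = ∫⁻ v, volume ((fun s => (s, v)) ⁻¹' Z) ∂μ := Measure.prod_apply_symm hZ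
      _ ≤ ∫⁻ _, ENNReal.ofReal (K * δ ^ (1 / D' : ℝ)) ∂μ := lintegral_mono h2
      _ = _ := by rw [lintegral_const]
  have h4 : ENNReal.ofReal (K * δ ^ (1 / D' : ℝ)) * μ univ
      = ENNReal.ofReal (K * δ ^ (1 / D' : ℝ) * (μ univ).toReal) := by
    rw [ENNReal.ofReal_mul (mul_nonneg hK0 (Real.rpow_nonneg hδ.1.le _)),
      ENNReal.ofReal_toReal (measure_ne_top μ _)]
  have h5 : μ (O₁ ∩ A) = ENNReal.ofReal (μ (O₁ ∩ A)).toReal :=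
    (ENNReal.ofReal_toReal (measure_ne_top μ _)).symm
  have h6 : 0 ≤ K * δ ^ (1 / D' : ℝ) * (μ univ).toReal :=
    mul_nonneg (mul_nonneg hK0 (Real.rpow_nonneg hδ.1.le _)) ENNReal.toReal_nonneg
  rw [h5]
  rw [h4, h5, ← ENNReal.ofReal_mul hρ.le, ENNReal.ofReal_le_ofReal_iff h6] at h3
  refine ENNReal.ofReal_le_ofReal ?_
  calc (μ (O₁ ∩ A)).toReal = ρ⁻¹ * (ρ * (μ (O₁ ∩ A)).toReal) := by field_simp
    _ ≤ ρ⁻¹ * (K * δ ^ (1 / D' : ℝ) * (μ univ).toReal) := by gcongr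
    _ = _ := by ring

/-- The local bounds are patched by compactness of M. A union takes the smaller exponent, which is
harmless for δ ≤ 1. -/
theorem IsInvariantOn.exists_sublevel_le (hτ : IsTrace τ) (hMc : IsCompact M)
    (hM : ∀ u ∈ M, star u * u = 1) (hμ : IsInvariantOn M μ)
    {f : 𝔸 → ℝ} (hf : Continuous f)
    (h : ∀ u ∈ M, ∃ κ D d, IsPolyCurve M f κ D d ∧ f (κ 1 * u) ≠ 0) :
    ∃ C a : ℝ, 0 ≤ C ∧ 0 < a ∧ ∀ δ ∈ Ioc (0 : ℝ) 1, μ.real {v | |f v| ≤ δ} ≤ C * δ ^ a := by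
  have hfin := hμ.finite
  have key : ∃ C a : ℝ, 0 ≤ C ∧ 0 < a ∧ ∀ δ ∈ Ioc (0 : ℝ) 1,
      μ (M ∩ {v | |f v| ≤ δ}) ≤ ENNReal.ofReal (C * δ ^ a) := by
    refine hMc.induction_on (p := fun s => ∃ C a : ℝ, 0 ≤ C ∧ 0 < a ∧ ∀ δ ∈ Ioc (0 : ℝ) 1,
      μ (s ∩ {v | |f v| ≤ δ}) ≤ ENNReal.ofReal (C * δ ^ a)) ?_ ?_ ?_ ?_
    · exact ⟨0, 1, le_rfl, one_pos, by simp⟩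
    · rintro s t hst ⟨C, a, hC, ha, hb⟩
      exact ⟨C, a, hC, ha, fun δ hδ =>
        (measure_mono (inter_subset_inter_left _ hst)).trans (hb δ hδ)⟩
    · rintro s t ⟨C, a, hC, ha, hb⟩ ⟨C', a', hC', ha', hb'⟩
      refine ⟨C + C', min a a', by positivity, lt_min ha ha', fun δ hδ => ?_⟩
      have hpow : ∀ b, min a a' ≤ b → δ ^ b ≤ δ ^ (min a a') := fun b hb =>
        Real.rpow_le_rpow_of_exponent_ge hδ.1 hδ.2 hb
      have hp : 0 ≤ δ ^ (min a a') := Real.rpow_nonneg hδ.1.le _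
      rw [union_inter_distrib_right, add_mul, ENNReal.ofReal_add (by positivity) (by positivity)]
      refine (measure_union_le _ _).trans (add_le_add ((hb δ hδ).trans ?_) ((hb' δ hδ).trans ?_))
      · exact ENNReal.ofReal_le_ofReal (mul_le_mul_of_nonneg_left (hpow _ (min_le_left _ _)) hC)
      · exact ENNReal.ofReal_le_ofReal (mul_le_mul_of_nonneg_left (hpow _ (min_le_right _ _)) hC')
    · intro u hu
      obtain ⟨κ, D, d, hκ, hne⟩ := h u hu
      obtain ⟨O, hO, hb⟩ := hμ.exists_nhds_sublevel_le hτ hM hf hκ hne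
      exact ⟨O, mem_nhdsWithin_of_mem_nhds hO, hb⟩
  obtain ⟨C, a, hC, ha, hb⟩ := key
  refine ⟨C, a, hC, ha, fun δ hδ => ?_⟩
  have h1 : μ {v | |f v| ≤ δ} ≤ μ (M ∩ {v | |f v| ≤ δ}) := by
    refine measure_mono_ae ?_
    filter_upwards [hμ.ae_mem] with v hv hvf using ⟨hv, hvf⟩
  have hp : 0 ≤ δ ^ a := Real.rpow_nonneg hδ.1.le _
  exact ENNReal.toReal_le_of_le_ofReal (by positivity) (h1.trans (hb δ hδ))

end Sublevel
-- Integrals over a compact set depending on parameters.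
section Parametric

variable {X Y : Type*} [TopologicalSpace X] [FirstCountableTopology X] [LocallyCompactSpace X]
  [TopologicalSpace Y] [MeasurableSpace Y] [OpensMeasurableSpace Y] [T2Space Y]
  {μ : Measure Y} [IsFiniteMeasure μ] {M : Set Y}

theorem aestronglyMeasurable_of_continuousOn (hM : IsCompact M) (hμ : ∀ᵐ y ∂μ, y ∈ M)
    {f : Y → ℝ} (hf : ContinuousOn f M) : AEStronglyMeasurable f μ := by
  rw [← Measure.restrict_eq_self_of_ae_mem hμ]
  exact hf.aestronglyMeasurable hM.measurableSet

theorem integrable_of_continuousOn (hM : IsCompact M) (hμ : ∀ᵐ y ∂μ, y ∈ M)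
    {f : Y → ℝ} (hf : ContinuousOn f M) : Integrable f μ := by
  obtain ⟨C, hC⟩ := hM.exists_bound_of_continuousOn hf
  refine Integrable.of_bound (aestronglyMeasurable_of_continuousOn hM hμ hf) C ?_
  filter_upwards [hμ] with y hy using hC y hy

/-- A compact neighbourhood of the parameter times the compact M yields a constant bound, integrable
because μ is finite. The lemma on derivatives is dominated in the same way. -/
theorem continuousAt_integral_of_continuousOn (hM : IsCompact M) (hμ : ∀ᵐ y ∂μ, y ∈ M)
    {U : Set X} (hU : IsOpen U) {Ψ : X → Y → ℝ}
    (hΨ : ContinuousOn (Function.uncurry Ψ) (U ×ˢ M)) {p : X} (hp : p ∈ U) :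
    ContinuousAt (fun p => ∫ y, Ψ p y ∂μ) p := by
  obtain ⟨K, hKp, hKU, hK⟩ := local_compact_nhds (hU.mem_nhds hp)
  obtain ⟨C, hC⟩ := (hK.prod hM).exists_bound_of_continuousOn
    (hΨ.mono (prod_mono hKU Subset.rfl))
  refine continuousAt_of_dominated (bound := fun _ => C) ?_ ?_ (integrable_const _) ?_
  · filter_upwards [hKp] with q hq
    refine aestronglyMeasurable_of_continuousOn hM hμ ?_
    exact hΨ.comp (f := fun y => (q, y)) (by fun_prop) fun y hy => ⟨hKU hq, hy⟩
  · filter_upwards [hKp] with q hq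
    filter_upwards [hμ] with y hy using hC (q, y) ⟨hq, hy⟩
  · filter_upwards [hμ] with y hy
    have h1 : ContinuousOn (fun q => Ψ q y) U :=
      hΨ.comp (f := fun q => (q, y)) (by fun_prop) fun q hq => ⟨hq, hy⟩
    exact h1.continuousAt (hU.mem_nhds hp)

theorem hasDerivAt_integral_of_continuousOn (hM : IsCompact M) (hμ : ∀ᵐ y ∂μ, y ∈ M)
    {U : Set ℝ} (hU : IsOpen U) {Ψ Ψ' : ℝ → Y → ℝ}
    (hc : ∀ s ∈ U, ContinuousOn (Ψ s) M)
    (hΨ : ContinuousOn (Function.uncurry Ψ') (U ×ˢ M))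
    (hd : ∀ s ∈ U, ∀ y ∈ M, HasDerivAt (fun s => Ψ s y) (Ψ' s y) s) {s : ℝ} (hs : s ∈ U) :
    HasDerivAt (fun s => ∫ y, Ψ s y ∂μ) (∫ y, Ψ' s y ∂μ) s := by
  obtain ⟨K, hKp, hKU, hK⟩ := local_compact_nhds (hU.mem_nhds hs)
  obtain ⟨C, hC⟩ := (hK.prod hM).exists_bound_of_continuousOn
    (hΨ.mono (prod_mono hKU Subset.rfl))
  refine (hasDerivAt_integral_of_dominated_loc_of_deriv_le (bound := fun _ => C) hKp ?_
    (integrable_of_continuousOn hM hμ (hc s hs)) ?_ ?_ (integrable_const _) ?_).2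
  · filter_upwards [hU.mem_nhds hs] with q hq
    exact aestronglyMeasurable_of_continuousOn hM hμ (hc q hq)
  · refine aestronglyMeasurable_of_continuousOn hM hμ ?_
    exact hΨ.comp (f := fun y => (s, y)) (by fun_prop) fun y hy => ⟨hs, hy⟩
  · filter_upwards [hμ] with y hy q hq using hC (q, y) ⟨hq, hy⟩
  · filter_upwards [hμ] with y hy q hq using hd q (hKU hq) y hy

end Parametric

/-! ### Smoothness of the flow, its moments and its speed. -/

section Flow

variable {𝔸 : Type*} [NormedRing 𝔸] [NormedAlgebra ℝ 𝔸] [CompleteSpace 𝔸]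

theorem contDiffAt_mob {Z : Type*} [NormedAddCommGroup Z] [NormedSpace ℝ Z] {a b c d q : Z → 𝔸}
    {z : Z} {n : ℕ∞ω} (ha : ContDiffAt ℝ n a z) (hb : ContDiffAt ℝ n b z)
    (hc : ContDiffAt ℝ n c z) (hd : ContDiffAt ℝ n d z) (hq : ContDiffAt ℝ n q z)
    (hu : IsUnit (c z * q z + d z)) :
    ContDiffAt ℝ n (fun z => mob (a z) (b z) (c z) (d z) (q z)) z := by
  obtain ⟨v, hv⟩ := hu
  have h1 : ContDiffAt ℝ n (Ring.inverse : 𝔸 → 𝔸) (c z * q z + d z) := by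
    rw [← hv]; exact contDiffAt_ringInverse ℝ v
  have h2 : ContDiffAt ℝ n (fun z => Ring.inverse (c z * q z + d z)) z :=
    h1.comp (f := fun z => c z * q z + d z) z ((hc.mul hq).add hd)
  exact ((ha.mul hq).add hb).mul h2

variable [StarRing 𝔸] [StarModule ℝ 𝔸] [FiniteDimensional ℝ 𝔸] {τ : 𝔸 →ₗ[ℝ] ℝ} {M : Set 𝔸}

theorem IsTrace.contDiffAt_flow (hτ : IsTrace τ) {u : 𝔸} (hu : star u * u = 1) (t : ℝ) :
    ContDiffAt ℝ ∞ (fun p : ℝ × 𝔸 => flow p.1 p.2) (t, u) := by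
  have h1 : ContDiff ℝ ∞ (fun p : ℝ × 𝔸 => Real.cosh p.1 • (1 : 𝔸)) :=
    (Real.contDiff_cosh.comp contDiff_fst).smul contDiff_const
  have h2 : ContDiff ℝ ∞ (fun p : ℝ × 𝔸 => Real.sinh p.1 • (1 : 𝔸)) :=
    (Real.contDiff_sinh.comp contDiff_fst).smul contDiff_const
  exact contDiffAt_mob h1.contDiffAt h2.contDiffAt h2.contDiffAt h1.contDiffAt
    contDiff_snd.contDiffAt (hτ.isUnit_den (isSplit_flow t) hu)

theorem IsTrace.continuousOn_flow (hτ : IsTrace τ) (hM : ∀ u ∈ M, star u * u = 1) :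
    ContinuousOn (fun p : ℝ × 𝔸 => flow p.1 p.2) (univ ×ˢ M) := fun p hp =>
  (hτ.contDiffAt_flow (hM p.2 hp.2) p.1).continuousAt.continuousWithinAt

theorem IsTrace.continuousOn_flow_right (hτ : IsTrace τ) (hM : ∀ u ∈ M, star u * u = 1) (t : ℝ) :
    ContinuousOn (fun u : 𝔸 => flow t u) M :=
  (hτ.continuousOn_flow hM).comp (f := fun u => (t, u)) (by fun_prop) fun u hu => ⟨mem_univ _, hu⟩

theorem star_pow_mul_pow {v : 𝔸} (hv : star v * v = 1) (k : ℕ) : star (v ^ k) * v ^ k = 1 := by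
  induction k with
  | zero => simp
  | succ k ih =>
    rw [pow_succ, star_mul, mul_assoc, ← mul_assoc (star (v ^ k)), ih, one_mul, hv]

theorem HasDerivAt.pow_of_flow {f : ℝ → 𝔸} {t : ℝ}
    (hf : HasDerivAt f (1 - f t * f t) t) (k : ℕ) :
    HasDerivAt (fun t => f t ^ k) ((k : ℝ) • (f t ^ (k - 1) * (1 - f t * f t))) t := by
  induction k with
  | zero => simpa using hasDerivAt_const t (1 : 𝔸)
  | succ k ih =>
    have h := ih.mul hf
    have e : (fun t => f t ^ (k + 1)) = (fun t => f t ^ k) * f := by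
      funext s; simp [pow_succ]
    rw [e]
    convert h using 1
    rcases k with _ | k
    · simp
    · have hc : (1 - f t * f t) * f t = f t * (1 - f t * f t) := by noncomm_ring
      simp only [Nat.add_sub_cancel]
      rw [smul_mul_assoc, mul_assoc, hc, ← mul_assoc, ← pow_succ]
      push_cast
      module

variable [MeasurableSpace 𝔸] [BorelSpace 𝔸] {μ : Measure 𝔸}

/-- The moments `∫ τ (Vᵏ) dμ` of the flow. -/
noncomputable def moment (τ : 𝔸 →ₗ[ℝ] ℝ) (μ : Measure 𝔸) (k : ℕ) (t : ℝ) : ℝ :=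
  ∫ u, τ (flow t u ^ k) ∂μ

/-- The squared speed of the flow in the kinetic metric. -/
noncomputable def speedSq (μ : Measure 𝔸) (t : ℝ) : ℝ :=
  ∫ u, ‖1 - flow t u * flow t u‖ ^ 2 ∂μ

/-- Since V commutes with V' = 1 - V², the power V^k has derivative k (V^(k-1) - V^(k+1)). -/
theorem hasDerivAt_moment (hτ : IsTrace τ) (hMc : IsCompact M) (hM : ∀ u ∈ M, star u * u = 1)
    [IsFiniteMeasure μ] (hμ : ∀ᵐ u ∂μ, u ∈ M) (k : ℕ) (t : ℝ) :
    HasDerivAt (moment τ μ k)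
      ((k : ℝ) * (moment τ μ (k - 1) t - moment τ μ (k + 1) t)) t := by
  have hc := hτ.continuousOn_flow hM
  have hτc := LinearMap.continuous_of_finiteDimensional τ
  have hcp : ∀ j, ContinuousOn (fun p : ℝ × 𝔸 => τ (flow p.1 p.2 ^ j)) (univ ×ˢ M) := fun j =>
    hτc.comp_continuousOn (hc.pow j)
  have hcr : ∀ s j, ContinuousOn (fun u : 𝔸 => τ (flow s u ^ j)) M := fun s j =>
    (hcp j).comp (f := fun u => (s, u)) (by fun_prop) fun u hu => ⟨mem_univ _, hu⟩
  -- For k = 0 the truncated index k - 1 is 0, but the factor k cancels the term.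
  rcases k with _ | k
  · have : moment τ μ 0 = fun _ => ∫ _, τ (1 : 𝔸) ∂μ := by funext t; simp [moment]
    rw [this]
    simpa using hasDerivAt_const t (∫ _, τ (1 : 𝔸) ∂μ)
  have h := hasDerivAt_integral_of_continuousOn (μ := μ) hMc hμ isOpen_univ
    (Ψ := fun t u => τ (flow t u ^ (k + 1)))
    (Ψ' := fun t u => ((k + 1 : ℕ) : ℝ) * (τ (flow t u ^ k) - τ (flow t u ^ (k + 2))))
    (fun s _ => hcr s _) ?_ ?_ (mem_univ t)
  · refine h.congr_deriv ?_
    rw [integral_const_mul, integral_sub (integrable_of_continuousOn hMc hμ (hcr t _))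
      (integrable_of_continuousOn hMc hμ (hcr t _))]
    rfl
  · exact continuousOn_const.mul ((hcp k).sub (hcp (k + 2)))
  · intro s _ u hu
    have h1 := HasDerivAt.pow_of_flow (hτ.hasDerivAt_flow (hM u hu) s) (k + 1)
    have h2 := (LinearMap.toContinuousLinearMap τ).hasFDerivAt.comp_hasDerivAt s h1
    refine h2.congr_deriv ?_
    simp only [LinearMap.coe_toContinuousLinearMap', map_smul, smul_eq_mul, Nat.add_sub_cancel]
    rw [mul_sub, mul_one, map_sub, ← mul_assoc, ← pow_succ, ← pow_succ]

/-- The derivative of a moment is a combination of moments, so the order of smoothness rises by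
induction for all k simultaneously. -/
theorem contDiff_moment (hτ : IsTrace τ) (hMc : IsCompact M) (hM : ∀ u ∈ M, star u * u = 1)
    [IsFiniteMeasure μ] (hμ : ∀ᵐ u ∂μ, u ∈ M) (k : ℕ) : ContDiff ℝ ∞ (moment τ μ k) := by
  have hd := hasDerivAt_moment hτ hMc hM hμ
  refine contDiff_infty.2 fun m => ?_
  induction m generalizing k with
  | zero =>
    exact contDiff_zero.2 (continuous_iff_continuousAt.2 fun t => (hd k t).continuousAt)
  | succ m ih =>
    have hdk : deriv (moment τ μ k)
        = fun t => (k : ℝ) * (moment τ μ (k - 1) t - moment τ μ (k + 1) t) := by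
      funext t; exact (hd k t).deriv
    rw [Nat.cast_succ, contDiff_succ_iff_deriv]
    refine ⟨fun t => (hd k t).differentiableAt, by simp, ?_⟩
    rw [hdk]
    exact contDiff_const.mul ((ih _).sub (ih _))

theorem IsTrace.norm_one_sub_flow_sq (hτ : IsTrace τ) {u : 𝔸} (hu : star u * u = 1) (t : ℝ) :
    ‖1 - flow t u * flow t u‖ ^ 2 = 2 * (τ 1 - τ (flow t u ^ 2)) := by
  rw [← pow_two]
  exact hτ.norm_one_sub_sq (star_pow_mul_pow (hτ.star_flow_mul hu t) 2)

theorem speedSq_eq (hτ : IsTrace τ) (hMc : IsCompact M) (hM : ∀ u ∈ M, star u * u = 1)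
    [IsFiniteMeasure μ] (hμ : ∀ᵐ u ∂μ, u ∈ M) :
    speedSq μ = fun t => 2 * (μ.real univ * τ 1 - moment τ μ 2 t) := by
  funext t
  have hc : ContinuousOn (fun u : 𝔸 => τ (flow t u ^ 2)) M :=
    (LinearMap.continuous_of_finiteDimensional τ).comp_continuousOn ((hτ.continuousOn_flow_right hM t).pow 2)
  have h1 : speedSq μ t = ∫ u, 2 * (τ 1 - τ (flow t u ^ 2)) ∂μ := by
    refine integral_congr_ae ?_
    filter_upwards [hμ] with u hu using hτ.norm_one_sub_flow_sq (hM u hu) t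
  rw [h1, integral_const_mul, integral_sub (integrable_const _)
    (integrable_of_continuousOn hMc hμ hc), integral_const]
  rfl

theorem contDiff_speedSq (hτ : IsTrace τ) (hMc : IsCompact M) (hM : ∀ u ∈ M, star u * u = 1)
    [IsFiniteMeasure μ] (hμ : ∀ᵐ u ∂μ, u ∈ M) : ContDiff ℝ ∞ (speedSq μ) := by
  rw [speedSq_eq hτ hMc hM hμ]
  exact contDiff_const.mul (contDiff_const.sub (contDiff_moment hτ hMc hM hμ 2))

theorem IsInvariantOn.integral_pos (hMc : IsCompact M) (hμ : IsInvariantOn M μ)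
    {f : 𝔸 → ℝ} (hf : ContinuousOn f M) (h0 : ∀ u ∈ M, 0 ≤ f u) {u : 𝔸} (hu : u ∈ M)
    (hpos : 0 < f u) : 0 < ∫ u, f u ∂μ := by
  have hfin := hμ.finite
  have hae : 0 ≤ᵐ[μ] f := by filter_upwards [hμ.ae_mem] with v hv using h0 v hv
  rw [integral_pos_iff_support_of_nonneg_ae hae (integrable_of_continuousOn hMc hμ.ae_mem hf)]
  have h1 : {v | 0 < f v} ∈ 𝓝[M] u := (hf u hu).eventually (lt_mem_nhds hpos)
  obtain ⟨O, hO, huO, hOM⟩ := mem_nhdsWithin.1 h1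
  refine (hμ.pos u hu O hO huO).trans_le ?_
  refine measure_mono_ae ?_
  filter_upwards [hμ.ae_mem] with v hv hvO
  exact (hOM ⟨hvO, hv⟩ : 0 < f v).ne'

/-- If V² = 1 then V is self-adjoint. The flow commutes with the adjoint and is injective, so u is
self-adjoint and u² = 1; any u with u² ≠ 1 thus contributes positively at every time. -/
theorem speedSq_pos (hτ : IsTrace τ) (hMc : IsCompact M) (hM : ∀ u ∈ M, star u * u = 1)
    (hμ : IsInvariantOn M μ) (hne : ∃ u ∈ M, u * u ≠ 1) (t : ℝ) : 0 < speedSq μ t := by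
  obtain ⟨u, hu, hne⟩ := hne
  have hc := hτ.continuousOn_flow_right hM t
  refine hμ.integral_pos hMc (by fun_prop) (fun v _ => by positivity) hu ?_
  have : 1 - flow t u * flow t u ≠ 0 := by
    intro h0
    apply hne
    have hV := hτ.star_flow_mul (hM u hu) t
    have hVs : star (flow t u) = flow t u := by
      rw [← mul_one (star _), sub_eq_zero.1 h0, ← mul_assoc, hV, one_mul]
    have h1 := hτ.flow_star (hM u hu) t
    have hu' : star (star u) * star u = 1 := by
      rw [star_star, mul_star_of_star_mul (hM u hu)]
    have h2 := hτ.mob_injective (isSplit_flow t) hu' (hM u hu) (h1.trans hVs)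
    nth_rewrite 1 [← h2]
    exact hM u hu
  positivity

end Flow
-- Exponential decay of the speed.
section Decay

variable {𝔸 : Type*} [NormedRing 𝔸] [NormedAlgebra ℝ 𝔸] [CompleteSpace 𝔸]
  [StarRing 𝔸] [StarModule ℝ 𝔸] [FiniteDimensional ℝ 𝔸] {τ : 𝔸 →ₗ[ℝ] ℝ} {M : Set 𝔸}

/-- The adjugate of left multiplication by x recovers N(x) y from x and xy continuously, even for
singular x. -/
theorem exists_norm_smul_eq :
    ∃ Ψ : 𝔸 × 𝔸 → 𝔸, Continuous Ψ ∧ ∀ x y, Algebra.norm ℝ x • y = Ψ (x, x * y) := by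
  classical
  let b := Module.finBasis ℝ 𝔸
  let L := Algebra.leftMulMatrix b
  have hL : Continuous L := LinearMap.continuous_of_finiteDimensional L.toLinearMap
  have hb : Continuous b.equivFun := LinearMap.continuous_of_finiteDimensional b.equivFun.toLinearMap
  have hb' : Continuous b.equivFun.symm :=
    LinearMap.continuous_of_finiteDimensional b.equivFun.symm.toLinearMap
  refine ⟨fun p => b.equivFun.symm ((L p.1).adjugate *ᵥ b.equivFun p.2), ?_, fun x y => ?_⟩
  · refine hb'.comp (Continuous.matrix_mulVec ?_ (hb.comp continuous_snd))
    exact (hL.comp continuous_fst).matrix_adjugate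
  · have h1 : b.equivFun (x * y) = L x *ᵥ b.equivFun y :=
      (Algebra.leftMulMatrix_mulVec_repr b x y).symm
    have h2 : (L x).adjugate *ᵥ b.equivFun (x * y) = Algebra.norm ℝ x • b.equivFun y := by
      rw [h1, Matrix.mulVec_mulVec, Matrix.adjugate_mul, Matrix.smul_mulVec, Matrix.one_mulVec,
        Algebra.norm_eq_matrix_det b]
    change _ = b.equivFun.symm ((L x).adjugate *ᵥ b.equivFun (x * y))
    rw [h2, map_smul, LinearEquiv.symm_apply_apply]

theorem continuous_norm_one_add : Continuous fun u : 𝔸 => Algebra.norm ℝ (1 + u) := by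
  classical
  let b := Module.finBasis ℝ 𝔸
  have hL : Continuous (Algebra.leftMulMatrix b) :=
    LinearMap.continuous_of_finiteDimensional (Algebra.leftMulMatrix b).toLinearMap
  simp_rw [Algebra.norm_eq_matrix_det b]
  exact (hL.comp (by fun_prop)).matrix_det

/-- The adjugate applied to (1 + u)(1 - V) = exp(-2t) (1 - u)(1 + V). The right side is bounded
uniformly in u and t because u and V are unitary. -/
theorem exists_norm_one_sub_flow_le (hτ : IsTrace τ) (hM : ∀ u ∈ M, star u * u = 1) :
    ∃ K : ℝ, ∀ u ∈ M, ∀ t, |Algebra.norm ℝ (1 + u)| * ‖1 - flow t u‖ ≤ K * Real.exp (-2 * t) := by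
  have := FiniteDimensional.proper ℝ 𝔸
  obtain ⟨Ψ, hΨ, hN⟩ := exists_norm_smul_eq (𝔸 := 𝔸)
  have hc : Continuous fun p : 𝔸 × 𝔸 => Ψ (1 + p.1, (1 - p.1) * (1 + p.2)) := by fun_prop
  obtain ⟨K, hK⟩ := ((isCompact_closedBall (0 : 𝔸) ‖(1 : 𝔸)‖).prod
    (isCompact_closedBall (0 : 𝔸) ‖(1 : 𝔸)‖)).exists_bound_of_continuousOn hc.continuousOn
  refine ⟨K, fun u hu t => ?_⟩
  have hu1 := hM u hu
  have hV := hτ.star_flow_mul hu1 t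
  have h1 : (1 + u) * (1 - flow t u) = Real.exp (-2 * t) • ((1 - u) * (1 + flow t u)) := by
    rw [← hτ.one_sub_flow_mul hu1 t]
    have hc := hτ.commute_flow hu1 t
    exact (((Commute.one_left _).add_left
      ((Commute.one_right u).sub_right hc))).eq
  have h2 : Algebra.norm ℝ (1 + u) • (1 - flow t u)
      = Real.exp (-2 * t) • Ψ (1 + u, (1 - u) * (1 + flow t u)) := by
    have he : Real.exp (2 * t) * Real.exp (-2 * t) = 1 := by
      rw [← Real.exp_add, show 2 * t + -2 * t = 0 by ring, Real.exp_zero]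
    -- The factor exp(2t) keeps the arguments of Ψ in a fixed compact set, so no linearity of Ψ is
    -- required.
    have h3 := hN (1 + u) (Real.exp (2 * t) • (1 - flow t u))
    rw [mul_smul_comm, h1, smul_smul (Real.exp (2 * t)), he, one_smul] at h3
    rw [← h3, smul_smul, smul_smul, mul_right_comm, mul_comm (Real.exp (-2 * t)), he, one_mul]
  have h3 := congrArg norm h2
  rw [norm_smul, norm_smul, Real.norm_eq_abs, Real.norm_of_nonneg (Real.exp_pos _).le] at h3
  rw [h3, mul_comm]
  refine mul_le_mul_of_nonneg_right (hK (u, flow t u) ⟨?_, ?_⟩) (Real.exp_pos _).le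
  · rw [mem_closedBall_zero_iff, hτ.norm_unitary hu1]
  · rw [mem_closedBall_zero_iff, hτ.norm_unitary hV]

variable [MeasurableSpace 𝔸] [BorelSpace 𝔸] {μ : Measure 𝔸}

/-- The integral is split at |f| = exp(-t). Below, G ≤ L on a set of measure at most C exp(-at);
above, dividing by |f| leaves G ≤ K exp(-t). -/
theorem exists_integral_sq_le_of_sublevel [IsFiniteMeasure μ] (hμ : ∀ᵐ u ∂μ, u ∈ M) {f : 𝔸 → ℝ}
    (hf : Continuous f) {C a : ℝ} (hC : 0 ≤ C) (ha : 0 < a)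
    (hsub : ∀ δ ∈ Ioc (0 : ℝ) 1, μ.real {v | |f v| ≤ δ} ≤ C * δ ^ a) {G : ℝ → 𝔸 → ℝ} {K L : ℝ}
    (hG0 : ∀ t, 0 ≤ t → ∀ u ∈ M, 0 ≤ G t u)
    (hG : ∀ t, 0 ≤ t → ∀ u ∈ M, |f u| * G t u ≤ K * Real.exp (-2 * t))
    (hL : ∀ t, 0 ≤ t → ∀ u ∈ M, G t u ≤ L) :
    ∃ C' a' : ℝ, 0 < a' ∧ ∀ t, 0 ≤ t → ∫ u, G t u ^ 2 ∂μ ≤ C' * Real.exp (-a' * t) := by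
  refine ⟨L ^ 2 * C + K ^ 2 * μ.real univ, min a 2, lt_min ha two_pos, fun t ht => ?_⟩
  set δ := Real.exp (-t) with hδ
  have hδ0 : 0 < δ := Real.exp_pos _
  have hδ1 : δ ≤ 1 := Real.exp_le_one_iff.2 (by linarith)
  set A : Set 𝔸 := {v | |f v| ≤ δ}
  have hA : MeasurableSet A := (isClosed_le (by fun_prop) continuous_const).measurableSet
  have hint : Integrable (fun u => A.indicator (fun _ => L ^ 2) u + K ^ 2 * δ ^ 2) μ :=
    ((integrable_const _).indicator hA).add (integrable_const _)
  have h1 : ∫ u, G t u ^ 2 ∂μ ≤ ∫ u, (A.indicator (fun _ => L ^ 2) u + K ^ 2 * δ ^ 2) ∂μ := by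
    refine integral_mono_of_nonneg (Eventually.of_forall fun u => sq_nonneg _) hint ?_
    filter_upwards [hμ] with u hu
    have h0 := hG0 t ht u hu
    by_cases huA : u ∈ A
    · rw [indicator_of_mem huA]
      have := pow_le_pow_left₀ h0 (hL t ht u hu) 2
      have h3 : 0 ≤ K ^ 2 * δ ^ 2 := by positivity
      linarith
    · rw [indicator_of_notMem huA, zero_add, ← mul_pow]
      have hfu : δ < |f u| := not_le.1 huA
      have h3 : δ * G t u ≤ δ * (K * δ) := by
        calc δ * G t u ≤ |f u| * G t u := by gcongr
          _ ≤ K * Real.exp (-2 * t) := hG t ht u hu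
          _ = δ * (K * δ) := by
            rw [show -2 * t = -t + -t by ring, Real.exp_add, ← hδ]; ring
      exact pow_le_pow_left₀ h0 (le_of_mul_le_mul_left h3 hδ0) 2
  rw [integral_add ((integrable_const _).indicator hA) (integrable_const _),
    integral_indicator_const _ hA, integral_const, smul_eq_mul, smul_eq_mul] at h1
  have h2 := hsub δ ⟨hδ0, hδ1⟩
  have e1 : δ ^ a ≤ Real.exp (-min a 2 * t) := by
    rw [hδ, ← Real.exp_mul]
    apply Real.exp_le_exp.2
    nlinarith [min_le_left a 2]
  have e2 : δ ^ 2 ≤ Real.exp (-min a 2 * t) := by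
    rw [hδ, ← Real.exp_nat_mul]
    apply Real.exp_le_exp.2
    push_cast
    nlinarith [min_le_right a 2]
  have hL2 : 0 ≤ L ^ 2 := sq_nonneg _
  calc ∫ u, G t u ^ 2 ∂μ ≤ μ.real A * L ^ 2 + μ.real univ * (K ^ 2 * δ ^ 2) := h1
    _ ≤ (C * Real.exp (-min a 2 * t)) * L ^ 2
        + μ.real univ * (K ^ 2 * Real.exp (-min a 2 * t)) := by
      gcongr
      exact h2.trans (by gcongr)
    _ = _ := by ring

/-- The speed of the flow decays exponentially, and the flow converges to the
constant map `1` at `+∞`. -/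
structure HasDecay (τ : 𝔸 →ₗ[ℝ] ℝ) (μ : Measure 𝔸) : Prop where
  speed : ∃ C a : ℝ, 0 < a ∧ ∀ t, speedSq μ t ≤ C * Real.exp (-a * |t|)
  limit : Tendsto (moment τ μ 1) atTop (𝓝 (μ.real univ * τ 1))

theorem IsTrace.norm_one_sub_flow_sq_le (hτ : IsTrace τ) {u : 𝔸} (hu : star u * u = 1) (t : ℝ) :
    ‖1 - flow t u * flow t u‖ ≤ (2 * ‖(1 : 𝔸)‖) * ‖1 - flow t u‖ := by
  have hV := hτ.norm_unitary (hτ.star_flow_mul hu t)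
  have e : 1 - flow t u * flow t u = (1 + flow t u) * (1 - flow t u) := by noncomm_ring
  rw [e]
  refine (norm_mul_le _ _).trans (mul_le_mul_of_nonneg_right ?_ (norm_nonneg _))
  refine (norm_add_le _ _).trans ?_
  rw [hV]; linarith

theorem IsTrace.norm_one_sub_flow_le (hτ : IsTrace τ) {u : 𝔸} (hu : star u * u = 1) (t : ℝ) :
    ‖1 - flow t u‖ ≤ 2 * ‖(1 : 𝔸)‖ := by
  have hV := hτ.norm_unitary (hτ.star_flow_mul hu t)
  refine (norm_sub_le _ _).trans ?_
  rw [hV]; linarith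

/-- The exponential decay of the speed at `-∞`. -/
def HasBackwardDecay (μ : Measure 𝔸) : Prop :=
  ∃ C a : ℝ, 0 < a ∧ ∀ t, 0 ≤ t → speedSq μ (-t) ≤ C * Real.exp (-a * t)

theorem exists_integral_norm_one_sub_flow_le (hτ : IsTrace τ) (hMc : IsCompact M)
    (hM : ∀ u ∈ M, star u * u = 1) (hμ : IsInvariantOn M μ)
    (h : ∀ u ∈ M, ∃ κ D d, IsPolyCurve M (fun v => Algebra.norm ℝ (1 + v)) κ D d ∧
      IsUnit (1 + κ 1 * u)) :
    ∃ C a : ℝ, 0 < a ∧ ∀ t, 0 ≤ t → ∫ u, ‖1 - flow t u‖ ^ 2 ∂μ ≤ C * Real.exp (-a * t) := by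
  have hfin := hμ.finite
  obtain ⟨C, a, hC, ha, hsub⟩ := hμ.exists_sublevel_le hτ hMc hM
    (f := fun v => Algebra.norm ℝ (1 + v)) continuous_norm_one_add (fun u hu => by
      obtain ⟨κ, D, d, hκ, hne⟩ := h u hu
      exact ⟨κ, D, d, hκ, (hne.map (Algebra.norm ℝ)).ne_zero⟩)
  obtain ⟨K, hK⟩ := exists_norm_one_sub_flow_le hτ hM
  exact exists_integral_sq_le_of_sublevel hμ.ae_mem continuous_norm_one_add hC ha hsub
    (G := fun t u => ‖1 - flow t u‖) (fun _ _ _ _ => norm_nonneg _) (fun t _ u hu => hK u hu t)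
    (fun t _ u hu => hτ.norm_one_sub_flow_le (hM u hu) t)

theorem speedSq_le (hτ : IsTrace τ) (hMc : IsCompact M)
    (hM : ∀ u ∈ M, star u * u = 1) [IsFiniteMeasure μ] (hμ : ∀ᵐ u ∂μ, u ∈ M) (t : ℝ) :
    speedSq μ t ≤ (2 * ‖(1 : 𝔸)‖) ^ 2 * ∫ u, ‖1 - flow t u‖ ^ 2 ∂μ := by
  have hc := hτ.continuousOn_flow_right hM t
  rw [← integral_const_mul]
  refine integral_mono_of_nonneg (Eventually.of_forall fun u => sq_nonneg _)
    (integrable_of_continuousOn hMc hμ (by fun_prop)) ?_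
  filter_upwards [hμ] with u hu
  rw [← mul_pow]
  exact pow_le_pow_left₀ (norm_nonneg _) (hτ.norm_one_sub_flow_sq_le (hM u hu) t) 2

/-- Forward decay follows from the convergence of V to 1, because 1 - V² = (1 + V)(1 - V). The same
convergence gives the limit of the first moment through ‖1 - V‖² = 2 (τ 1 - τ V). -/
theorem HasBackwardDecay.hasDecay (hb : HasBackwardDecay μ) (hτ : IsTrace τ) (hMc : IsCompact M)
    (hM : ∀ u ∈ M, star u * u = 1) (hμ : IsInvariantOn M μ)
    (h : ∀ u ∈ M, ∃ κ D d, IsPolyCurve M (fun v => Algebra.norm ℝ (1 + v)) κ D d ∧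
      IsUnit (1 + κ 1 * u)) : HasDecay τ μ := by
  have hfin := hμ.finite
  obtain ⟨C, a, ha, hCa⟩ := exists_integral_norm_one_sub_flow_le hτ hMc hM hμ h
  obtain ⟨C', a', ha', hCa'⟩ := hb
  have hC : 0 ≤ C := by
    have h1 := hCa 0 le_rfl
    simp only [mul_zero, Real.exp_zero, mul_one] at h1
    exact (integral_nonneg fun u => sq_nonneg _).trans h1
  have hC' : 0 ≤ C' := by
    have h1 := hCa' 0 le_rfl
    simp only [mul_zero, Real.exp_zero, mul_one] at h1
    exact (integral_nonneg fun u => sq_nonneg _).trans h1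
  constructor
  · refine ⟨(2 * ‖(1 : 𝔸)‖) ^ 2 * C + C', min a a', lt_min ha ha', fun t => ?_⟩
    have key : ∀ b, min a a' ≤ b → Real.exp (-b * |t|) ≤ Real.exp (-min a a' * |t|) := by
      intro b hb
      apply Real.exp_le_exp.2
      nlinarith [abs_nonneg t]
    have hp := Real.exp_pos (-min a a' * |t|)
    rcases le_total 0 t with ht | ht
    · have h1 := speedSq_le hτ hMc hM hμ.ae_mem t
      have h2 := hCa t ht
      rw [abs_of_nonneg ht] at *
      have h3 := key a (min_le_left _ _)
      calc speedSq μ t ≤ (2 * ‖(1 : 𝔸)‖) ^ 2 * (C * Real.exp (-min a a' * t)) := by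
            refine h1.trans ?_
            gcongr
            exact h2.trans (by gcongr)
        _ ≤ _ := by
          have := mul_nonneg hC' hp.le
          linarith
    · have h2 := hCa' (-t) (by linarith)
      rw [neg_neg] at h2
      rw [abs_of_nonpos ht] at *
      have h3 := key a' (min_le_right _ _)
      calc speedSq μ t ≤ C' * Real.exp (-min a a' * -t) := h2.trans (by gcongr)
        _ ≤ _ := by
          have : 0 ≤ (2 * ‖(1 : 𝔸)‖) ^ 2 * C * Real.exp (-min a a' * -t) := by positivity
          linarith
  · have h1 : ∀ t, ∫ u, ‖1 - flow t u‖ ^ 2 ∂μ = 2 * (μ.real univ * τ 1 - moment τ μ 1 t) := by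
      intro t
      have hc : ContinuousOn (fun u : 𝔸 => τ (flow t u ^ 1)) M :=
        (LinearMap.continuous_of_finiteDimensional τ).comp_continuousOn
          ((hτ.continuousOn_flow_right hM t).pow 1)
      have h2 : ∫ u, ‖1 - flow t u‖ ^ 2 ∂μ = ∫ u, 2 * (τ 1 - τ (flow t u ^ 1)) ∂μ := by
        refine integral_congr_ae ?_
        filter_upwards [hμ.ae_mem] with u hu
        rw [pow_one]
        exact hτ.norm_one_sub_sq (hτ.star_flow_mul (hM u hu) t)
      rw [h2, integral_const_mul, integral_sub (integrable_const _)
        (integrable_of_continuousOn hMc hμ.ae_mem hc), integral_const]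
      rfl
    have h2 : Tendsto (fun t => ∫ u, ‖1 - flow t u‖ ^ 2 ∂μ) atTop (𝓝 0) := by
      have h3 : Tendsto (fun t : ℝ => C * Real.exp (-a * t)) atTop (𝓝 (C * 0)) := by
        refine (Real.tendsto_exp_atBot.comp ?_).const_mul C
        exact tendsto_id.const_mul_atTop_of_neg (by linarith)
      rw [mul_zero] at h3
      refine tendsto_of_tendsto_of_tendsto_of_le_of_le' tendsto_const_nhds h3
        (Eventually.of_forall fun t => integral_nonneg fun u => sq_nonneg _) ?_
      filter_upwards [eventually_ge_atTop 0] with t ht using hCa t ht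
    have h4 : moment τ μ 1 = fun t => μ.real univ * τ 1 - (∫ u, ‖1 - flow t u‖ ^ 2 ∂μ) / 2 := by
      funext t; rw [h1]; ring
    rw [h4]
    simpa using (h2.div_const 2).const_sub (μ.real univ * τ 1)

/-- If `-1 ∈ M`, the speed is an even function, so the decay at `-∞` follows from that at `+∞`. -/
theorem hasBackwardDecay_of_neg_one_mem (hτ : IsTrace τ) (hMc : IsCompact M)
    (hM : ∀ u ∈ M, star u * u = 1) (hμ : IsInvariantOn M μ) (hneg : -1 ∈ M)
    (h : ∀ u ∈ M, ∃ κ D d, IsPolyCurve M (fun v => Algebra.norm ℝ (1 + v)) κ D d ∧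
      IsUnit (1 + κ 1 * u)) : HasBackwardDecay μ := by
  have hfin := hμ.finite
  obtain ⟨C, a, ha, hCa⟩ := exists_integral_norm_one_sub_flow_le hτ hMc hM hμ h
  refine ⟨(2 * ‖(1 : 𝔸)‖) ^ 2 * C, a, ha, fun t ht => ?_⟩
  have heven : speedSq μ (-t) = speedSq μ t := by
    have hc := hτ.continuousOn_flow_right hM t
    have hmp := hμ.left _ hneg
    have h1 : ∫ u, ‖1 - flow t (-1 * u) * flow t (-1 * u)‖ ^ 2 ∂μ
        = ∫ u, ‖1 - flow t u * flow t u‖ ^ 2 ∂μ := by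
      refine hmp.integral_comp ?_ (fun u => ‖1 - flow t u * flow t u‖ ^ 2)
      have e : (fun u : 𝔸 => -1 * u) = Homeomorph.neg 𝔸 := by funext u; simp
      rw [e]
      exact (Homeomorph.neg 𝔸).measurableEmbedding
    unfold speedSq
    rw [← h1]
    refine integral_congr_ae ?_
    filter_upwards [hμ.ae_mem] with u hu
    rw [neg_one_mul, hτ.flow_neg (hM u hu) t, neg_mul_neg]
  rw [heven]
  calc speedSq μ t ≤ (2 * ‖(1 : 𝔸)‖) ^ 2 * ∫ u, ‖1 - flow t u‖ ^ 2 ∂μ :=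
        speedSq_le hτ hMc hM hμ.ae_mem t
    _ ≤ (2 * ‖(1 : 𝔸)‖) ^ 2 * (C * Real.exp (-a * t)) := by gcongr; exact hCa t ht
    _ = _ := by ring

end Decay
-- Arc length and its inverse.
section ArcLength

/-- Comparison with a primitive of √C exp(-at/2), whose integral over the half-line is √C · 2 / a.
-/
theorem le_of_hasDerivAt_sqrt_le {σ h : ℝ → ℝ} {C a : ℝ} (ha : 0 < a) (hC : 0 ≤ C)
    (hσ : ∀ t, HasDerivAt σ (√(h t)) t) (hσ0 : σ 0 = 0)
    (hb : ∀ t, 0 ≤ t → h t ≤ C * Real.exp (-a * t)) {t : ℝ} (ht : 0 ≤ t) :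
    σ t ≤ √C * (2 / a) := by
  set g : ℝ → ℝ := fun t => √C * (2 / a) * (1 - Real.exp (-a / 2 * t)) - σ t
  have hg : ∀ t, HasDerivAt g (√C * Real.exp (-a / 2 * t) - √(h t)) t := by
    intro t
    have h1 : HasDerivAt (fun t => Real.exp (-a / 2 * t)) (Real.exp (-a / 2 * t) * (-a / 2)) t := by
      simpa using ((hasDerivAt_id t).const_mul (-a / 2)).exp
    refine (((h1.const_sub 1).const_mul (√C * (2 / a))).sub (hσ t)).congr_deriv ?_
    field_simp
  have hmono : MonotoneOn g (Ici 0) := by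
    refine monotoneOn_of_deriv_nonneg (convex_Ici 0)
      (fun t _ => (hg t).continuousAt.continuousWithinAt)
      (fun t _ => (hg t).differentiableAt.differentiableWithinAt) fun t ht => ?_
    rw [interior_Ici] at ht
    rw [(hg t).deriv, sub_nonneg]
    calc √(h t) ≤ √(C * Real.exp (-a * t)) := Real.sqrt_le_sqrt (hb t (le_of_lt ht))
      _ = √C * Real.exp (-a / 2 * t) := by
        rw [Real.sqrt_mul hC, show -a * t = -a / 2 * t + -a / 2 * t by ring, Real.exp_add,
          Real.sqrt_mul_self (Real.exp_pos _).le]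
  have h1 := hmono (mem_Ici.2 le_rfl) (mem_Ici.2 ht) ht
  simp only [g, mul_zero, Real.exp_zero, sub_self, hσ0] at h1
  have h2 : √C * (2 / a) * (1 - Real.exp (-a / 2 * t)) ≤ √C * (2 / a) * 1 := by
    gcongr
    linarith [Real.exp_pos (-a / 2 * t)]
  linarith

/-- The arc length `σ` of a curve with squared speed `h`, and its inverse `φ`. -/
structure IsArcLength (h σ φ : ℝ → ℝ) (L₁ L₂ : ℝ) : Prop where
  hasDerivAt : ∀ t, HasDerivAt σ (√(h t)) t
  strictMono : StrictMono σ
  range : range σ = Ioo L₁ L₂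
  left_inv : ∀ t, φ (σ t) = t
  tendsto_top : Tendsto σ atTop (𝓝 L₂)
  tendsto_bot : Tendsto σ atBot (𝓝 L₁)
  smooth : ContDiffOn ℝ ∞ φ (Ioo L₁ L₂)
  hasDerivAt_inv : ∀ s ∈ Ioo L₁ L₂, HasDerivAt φ (√(h (φ s)))⁻¹ s

/-- The decay of h makes √h integrable at both ends, so the primitive σ is bounded. It increases
strictly onto the open interval between its two limits, and its inverse is smooth because σ' never
vanishes. -/
theorem exists_isArcLength {h : ℝ → ℝ} (hs : ContDiff ℝ ∞ h) (hpos : ∀ t, 0 < h t)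
    (hb : ∃ C a : ℝ, 0 < a ∧ ∀ t, h t ≤ C * Real.exp (-a * |t|)) :
    ∃ σ φ L₁ L₂, IsArcLength h σ φ L₁ L₂ := by
  obtain ⟨C, a, ha, hb⟩ := hb
  have hC : 0 ≤ C := by
    have := hb 0
    simp only [abs_zero, mul_zero, Real.exp_zero, mul_one] at this
    exact (hpos 0).le.trans this
  have hsq : ContDiff ℝ ∞ fun t => √(h t) := hs.sqrt fun t => (hpos t).ne'
  have hsqpos : ∀ t, 0 < √(h t) := fun t => Real.sqrt_pos.2 (hpos t)
  set σ : ℝ → ℝ := fun t => ∫ x in (0 : ℝ)..t, √(h x)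
  have hσ : ∀ t, HasDerivAt σ (√(h t)) t := fun t =>
    intervalIntegral.integral_hasDerivAt_right (hsq.continuous.intervalIntegrable _ _)
      (hsq.continuous.stronglyMeasurableAtFilter _ _) hsq.continuous.continuousAt
  have hσ0 : σ 0 = 0 := intervalIntegral.integral_same
  have hσs : ContDiff ℝ ∞ σ := by
    rw [show ((⊤ : ℕ∞) : ℕ∞ω) = ((⊤ : ℕ∞) : ℕ∞ω) + 1 by rfl, contDiff_succ_iff_deriv]
    refine ⟨fun t => (hσ t).differentiableAt, by simp, ?_⟩
    rwa [show deriv σ = fun t => √(h t) from funext fun t => (hσ t).deriv]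
  have hmono : StrictMono σ := strictMono_of_hasDerivAt_pos hσ hsqpos
  have hup : ∀ t, σ t ≤ √C * (2 / a) := fun t =>
    (hmono.monotone (le_max_left t 0)).trans (le_of_hasDerivAt_sqrt_le ha hC hσ hσ0
      (fun t ht => by simpa [abs_of_nonneg ht] using hb t) (le_max_right t 0))
  have hlo : ∀ t, -(√C * (2 / a)) ≤ σ t := fun t => by
    -- Reflecting time reduces the lower bound to the upper one.
    have h1 : ∀ t, HasDerivAt (fun t => -σ (-t)) (√(h (-t))) t := fun t => by
      have := ((hσ (-t)).comp t (hasDerivAt_neg t)).neg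
      refine this.congr_deriv (by simp)
    have h2 : -σ (- max (-t) 0) ≤ √C * (2 / a) :=
      le_of_hasDerivAt_sqrt_le (σ := fun t => -σ (-t)) (h := fun t => h (-t)) ha hC h1
      (by simp [hσ0]) (fun t ht => by simpa [abs_of_nonneg ht] using hb (-t)) (le_max_right (-t) 0)
    have h3 := hmono.monotone (show - max (-t) 0 ≤ t by linarith [le_max_left (-t) 0])
    linarith
  have htop := tendsto_atTop_ciSup hmono.monotone ⟨_, forall_mem_range.2 hup⟩
  have hbot := tendsto_atBot_ciInf hmono.monotone ⟨_, forall_mem_range.2 hlo⟩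
  set L₂ := ⨆ t, σ t
  set L₁ := ⨅ t, σ t
  have hcont : Continuous σ := hσs.continuous
  have hrange : range σ = Ioo L₁ L₂ := by
    ext s
    constructor
    · rintro ⟨t, rfl⟩
      exact ⟨lt_of_le_of_lt (hmono.monotone.le_of_tendsto hbot (t - 1)) (hmono (by linarith)),
        lt_of_lt_of_le (hmono (by linarith)) (hmono.monotone.ge_of_tendsto htop (t + 1))⟩
    · rintro ⟨h1, h2⟩
      obtain ⟨t₁, ht₁⟩ := (hbot.eventually (gt_mem_nhds h1)).exists
      obtain ⟨t₂, ht₂⟩ := (htop.eventually (lt_mem_nhds h2)).exists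
      exact mem_range_of_exists_le_of_exists_ge hcont ⟨t₁, ht₁.le⟩ ⟨t₂, ht₂.le⟩
  set φ := Function.invFun σ
  have hφ : ∀ t, φ (σ t) = t := Function.leftInverse_invFun hmono.injective
  have hloc : ∀ t, ContDiffAt ℝ ∞ φ (σ t) := by
    intro t
    have hf' : HasFDerivAt σ (ContinuousLinearEquiv.unitsEquivAut ℝ
        (Units.mk0 (√(h t)) (hsqpos t).ne') : ℝ →L[ℝ] ℝ) t := (hσ t).hasFDerivAt_equiv (hsqpos t).ne'
    have hc := hσs.contDiffAt (x := t)
    have hinv := hc.to_localInverse hf' (by simp)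
    have hev := (hc.hasStrictFDerivAt' hf' (by simp)).eventually_right_inverse
    refine hinv.congr_of_eventuallyEq ?_
    filter_upwards [hev] with s hs
    change φ s = (hc.hasStrictFDerivAt' hf' (by simp)).localInverse σ _ t s
    -- The smooth local inverse agrees with φ near σ t, since φ is a global left inverse of σ.
    rw [← hφ ((hc.hasStrictFDerivAt' hf' (by simp)).localInverse σ _ t s), hs]
  refine ⟨σ, φ, L₁, L₂, hσ, hmono, hrange, hφ, htop, hbot, fun s hs => ?_, fun s hs => ?_⟩
  · rw [← hrange] at hs
    obtain ⟨t, rfl⟩ := hs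
    exact (hloc t).contDiffWithinAt
  · rw [← hrange] at hs
    obtain ⟨t, rfl⟩ := hs
    rw [hφ]
    refine HasDerivAt.of_local_left_inverse (f := σ) (hloc t).continuousAt ?_ (hsqpos t).ne' ?_
    · rw [hφ]; exact hσ t
    · have : range σ ∈ 𝓝 (σ t) := by
        rw [hrange]
        exact isOpen_Ioo.mem_nhds (hrange ▸ mem_range_self t)
      filter_upwards [this] with s hs
      obtain ⟨t', rfl⟩ := hs
      rw [hφ]

theorem IsArcLength.inv_mem {h σ φ : ℝ → ℝ} {L₁ L₂ : ℝ} (H : IsArcLength h σ φ L₁ L₂) (t : ℝ) :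
    σ t ∈ Ioo L₁ L₂ := H.range ▸ mem_range_self t

theorem IsArcLength.right_inv {h σ φ : ℝ → ℝ} {L₁ L₂ : ℝ} (H : IsArcLength h σ φ L₁ L₂) {s : ℝ}
    (hs : s ∈ Ioo L₁ L₂) : σ (φ s) = s := by
  rw [← H.range] at hs
  obtain ⟨t, rfl⟩ := hs
  rw [H.left_inv]

theorem isOpenInterval_Ioo {a b : ℝ} (h : a < b) : IsOpenInterval (Ioo a b) :=
  ⟨isOpen_Ioo, ordConnected_Ioo, nonempty_Ioo.2 h⟩

theorem IsArcLength.lt {h σ φ : ℝ → ℝ} {L₁ L₂ : ℝ} (H : IsArcLength h σ φ L₁ L₂) : L₁ < L₂ :=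
  (H.inv_mem 0).1.trans (H.inv_mem 0).2

theorem IsArcLength.isReparametrization {h σ φ : ℝ → ℝ} {L₁ L₂ : ℝ}
    (H : IsArcLength h σ φ L₁ L₂) (hpos : ∀ t, 0 < h t) : IsReparametrization φ (Ioo L₁ L₂) where
  interval := isOpenInterval_Ioo H.lt
  smooth := H.smooth
  bij := by
    refine ⟨mapsTo_univ _ _, fun s hs s' hs' he => ?_, fun t _ => ⟨σ t, H.inv_mem t, H.left_inv t⟩⟩
    rw [← H.right_inv hs, he, H.right_inv hs']
  deriv_ne s hs := by
    rw [(H.hasDerivAt_inv s hs).deriv]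
    exact inv_ne_zero (Real.sqrt_pos.2 (hpos _)).ne'

end ArcLength
-- The first variation of the energy.
section FirstVariation

variable {𝔸 : Type*} [NormedRing 𝔸] [NormedAlgebra ℝ 𝔸]
  [StarRing 𝔸] [StarModule ℝ 𝔸] [FiniteDimensional ℝ 𝔸] {τ : 𝔸 →ₗ[ℝ] ℝ}

variable (τ) in
/-- The bilinear form `τ (x⋆ y)`. -/
noncomputable def traceForm : 𝔸 →L[ℝ] 𝔸 →L[ℝ] ℝ :=
  LinearMap.toContinuousLinearMap
    { toFun := fun x => LinearMap.toContinuousLinearMap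
        { toFun := fun y => τ (star x * y)
          map_add' := fun y z => by rw [mul_add, map_add]
          map_smul' := fun r y => by simp }
      map_add' := fun x y => by ext z; simp [add_mul]
      map_smul' := fun r x => by ext z; simp }

theorem traceForm_apply (x y : 𝔸) : traceForm τ x y = τ (star x * y) := rfl

theorem HasDerivAt.traceForm {f g : ℝ → 𝔸} {f' g' : 𝔸} {t : ℝ} (hf : HasDerivAt f f' t)
    (hg : HasDerivAt g g' t) :
    HasDerivAt (fun t => traceForm τ (f t) (g t)) (traceForm τ f' (g t) + traceForm τ (f t) g') t := by
  have := (MobiusKinetic.traceForm τ).hasFDerivAt_of_bilinear hf.hasFDerivAt hg.hasFDerivAt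
  refine this.hasDerivAt.congr_deriv ?_
  simp [add_comm]

theorem two_le_contDiff_top : (2 : WithTop ℕ∞) ≤ ((⊤ : ℕ∞) : WithTop ℕ∞) :=
  WithTop.coe_le_coe.2 (le_top : (2 : ℕ∞) ≤ ⊤)

theorem ContDiffAt.eq_fderiv_fderiv_comm {Z 𝔹 : Type*} [NormedAddCommGroup Z] [NormedSpace ℝ Z]
    [NormedAddCommGroup 𝔹] [NormedSpace ℝ 𝔹]
    {W : Z → 𝔹} {z : Z} (hW : ContDiffAt ℝ ∞ W z) (v w : Z) :
    fderiv ℝ (fun z => fderiv ℝ W z v) z w = fderiv ℝ (fun z => fderiv ℝ W z w) z v := by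
  have h1 : DifferentiableAt ℝ (fderiv ℝ W) z :=
    (hW.fderiv_right (m := 1) (by rw [one_add_one_eq_two]; exact two_le_contDiff_top)).differentiableAt one_ne_zero
  have h2 : ∀ v w, fderiv ℝ (fun z => fderiv ℝ W z v) z w = fderiv ℝ (fderiv ℝ W) z w v := by
    intro v w
    rw [fderiv_clm_apply h1 (differentiableAt_const v)]
    simp
  rw [h2, h2]
  exact (hW.isSymmSndFDerivAt (by simpa using two_le_contDiff_top)).eq w v

theorem contDiffAt_fderiv_apply {Z 𝔹 : Type*} [NormedAddCommGroup Z] [NormedSpace ℝ Z]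
    [NormedAddCommGroup 𝔹] [NormedSpace ℝ 𝔹]
    {W : Z → 𝔹} {z : Z} (hW : ContDiffAt ℝ ∞ W z) (v : Z) :
    ContDiffAt ℝ ∞ (fun z => fderiv ℝ W z v) z :=
  (hW.fderiv_right (m := ∞) (by rfl)).clm_apply contDiffAt_const

theorem hasDerivAt_comp_fst {𝔹 : Type*} [NormedAddCommGroup 𝔹] [NormedSpace ℝ 𝔹]
    {W : (ℝ × ℝ) × 𝔸 → 𝔹} {s t : ℝ} {q : 𝔸}
    (hW : DifferentiableAt ℝ W ((s, t), q)) :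
    HasDerivAt (fun s => W ((s, t), q)) (fderiv ℝ W ((s, t), q) ((1, 0), 0)) s := by
  have h1 : HasDerivAt (fun s : ℝ => ((s, t), q)) ((1, 0), 0) s :=
    ((hasDerivAt_id s).prodMk (hasDerivAt_const s t)).prodMk (hasDerivAt_const s q)
  exact hW.hasFDerivAt.comp_hasDerivAt s h1

theorem hasDerivAt_comp_snd {𝔹 : Type*} [NormedAddCommGroup 𝔹] [NormedSpace ℝ 𝔹]
    {W : (ℝ × ℝ) × 𝔸 → 𝔹} {s t : ℝ} {q : 𝔸}
    (hW : DifferentiableAt ℝ W ((s, t), q)) :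
    HasDerivAt (fun t => W ((s, t), q)) (fderiv ℝ W ((s, t), q) ((0, 1), 0)) t := by
  have h1 : HasDerivAt (fun t : ℝ => ((s, t), q)) ((0, 1), 0) t :=
    ((hasDerivAt_const t s).prodMk (hasDerivAt_id t)).prodMk (hasDerivAt_const t q)
  exact hW.hasFDerivAt.comp_hasDerivAt t h1

variable [MeasurableSpace 𝔸] [BorelSpace 𝔸] {μ : Measure 𝔸} {M : Set 𝔸}

/-- The first variation of the energy of a family of motions `t ↦ W ((s, t), q)` of `M`. -/
theorem hasDerivAt_energy_zero (hτ : IsTrace τ) (hMc : IsCompact M)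
    [IsFiniteMeasure μ] (hμ : ∀ᵐ u ∂μ, u ∈ M) {W : (ℝ × ℝ) × 𝔸 → 𝔸} {ε a b : ℝ} {I : Set ℝ}
    (hε : 0 < ε) (hI : IsOpen I) (hab : a ≤ b) (habI : Icc a b ⊆ I)
    (hW : ∀ z ∈ (Ioo (-ε) ε ×ˢ I) ×ˢ M, ContDiffAt ℝ ∞ W z)
    (ha : ∀ q ∈ M, fderiv ℝ W ((0, a), q) ((1, 0), 0) = 0)
    (hb : ∀ q ∈ M, fderiv ℝ W ((0, b), q) ((1, 0), 0) = 0)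
    (hcrit : ∀ t ∈ Icc a b, ∫ q, traceForm τ
      (fderiv ℝ (fun z => fderiv ℝ W z ((0, 1), 0)) ((0, t), q) ((0, 1), 0))
      (fderiv ℝ W ((0, t), q) ((1, 0), 0)) ∂μ = 0) :
    HasDerivAt (fun s => (1 / 2) * ∫ t in a..b, ∫ q, traceForm τ
      (fderiv ℝ W ((s, t), q) ((0, 1), 0)) (fderiv ℝ W ((s, t), q) ((0, 1), 0)) ∂μ) 0 0 := by
  set es : (ℝ × ℝ) × 𝔸 := ((1, 0), 0)
  set et : (ℝ × ℝ) × 𝔸 := ((0, 1), 0)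
  set Ws : (ℝ × ℝ) × 𝔸 → 𝔸 := fun z => fderiv ℝ W z es
  set Wt : (ℝ × ℝ) × 𝔸 → 𝔸 := fun z => fderiv ℝ W z et
  set Wts : (ℝ × ℝ) × 𝔸 → 𝔸 := fun z => fderiv ℝ Wt z es
  set Wtt : (ℝ × ℝ) × 𝔸 → 𝔸 := fun z => fderiv ℝ Wt z et
  have hWs : ∀ z ∈ (Ioo (-ε) ε ×ˢ I) ×ˢ M, ContDiffAt ℝ ∞ Ws z := fun z hz =>
    contDiffAt_fderiv_apply (hW z hz) es
  have hWt : ∀ z ∈ (Ioo (-ε) ε ×ˢ I) ×ˢ M, ContDiffAt ℝ ∞ Wt z := fun z hz =>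
    contDiffAt_fderiv_apply (hW z hz) et
  have cWs : ContinuousOn Ws ((Ioo (-ε) ε ×ˢ I) ×ˢ M) := fun z hz =>
    (hWs z hz).continuousAt.continuousWithinAt
  have cWt : ContinuousOn Wt ((Ioo (-ε) ε ×ˢ I) ×ˢ M) := fun z hz =>
    (hWt z hz).continuousAt.continuousWithinAt
  have cWts : ContinuousOn Wts ((Ioo (-ε) ε ×ˢ I) ×ˢ M) := fun z hz =>
    (contDiffAt_fderiv_apply (hWt z hz) es).continuousAt.continuousWithinAt
  have cWtt : ContinuousOn Wtt ((Ioo (-ε) ε ×ˢ I) ×ˢ M) := fun z hz =>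
    (contDiffAt_fderiv_apply (hWt z hz) et).continuousAt.continuousWithinAt
  have cform : ∀ {f g : (ℝ × ℝ) × 𝔸 → 𝔸}, ContinuousOn f ((Ioo (-ε) ε ×ˢ I) ×ˢ M) →
      ContinuousOn g ((Ioo (-ε) ε ×ˢ I) ×ˢ M) →
      ContinuousOn (fun z => traceForm τ (f z) (g z)) ((Ioo (-ε) ε ×ˢ I) ×ˢ M) := fun hf hg =>
    ((traceForm τ).continuous.comp_continuousOn hf).clm_apply hg
  have cform2 : ContinuousOn (fun z => 2 * traceForm τ (Wt z) (Wts z))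
      ((Ioo (-ε) ε ×ˢ I) ×ˢ M) := continuousOn_const.mul (cform cWt cWts)
  have hU : IsOpen (Ioo (-ε) ε ×ˢ I) := isOpen_Ioo.prod hI
  have h0 : (0 : ℝ) ∈ Ioo (-ε) ε := ⟨by linarith, hε⟩
  -- the density of the energy and its derivative in the parameter
  have hdens : ∀ t ∈ I, ∀ s ∈ Ioo (-ε) ε,
      HasDerivAt (fun s => ∫ q, traceForm τ (Wt ((s, t), q)) (Wt ((s, t), q)) ∂μ)
        (∫ q, 2 * traceForm τ (Wt ((s, t), q)) (Wts ((s, t), q)) ∂μ) s := by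
    intro t ht s hs
    refine hasDerivAt_integral_of_continuousOn hMc hμ isOpen_Ioo
      (Ψ := fun s q => traceForm τ (Wt ((s, t), q)) (Wt ((s, t), q)))
      (Ψ' := fun s q => 2 * traceForm τ (Wt ((s, t), q)) (Wts ((s, t), q))) ?_ ?_ ?_ hs
    · intro s hs
      exact (cform cWt cWt).comp (f := fun q => ((s, t), q)) (by fun_prop)
        fun q hq => ⟨⟨hs, ht⟩, hq⟩
    · exact cform2.comp
        (f := fun p : ℝ × 𝔸 => ((p.1, t), p.2)) (by fun_prop) fun p hp => ⟨⟨hp.1, ht⟩, hp.2⟩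
    · intro s hs q hq
      have h1 := hasDerivAt_comp_fst (W := Wt)
        ((hWt ((s, t), q) ⟨⟨hs, ht⟩, hq⟩).differentiableAt (by simp))
      refine (HasDerivAt.traceForm (τ := τ) h1 h1).congr_deriv ?_
      rw [traceForm_apply, traceForm_apply, hτ.symm, two_mul]
  have cdens : ContinuousOn (fun p : ℝ × ℝ =>
      ∫ q, traceForm τ (Wt (p, q)) (Wt (p, q)) ∂μ) (Ioo (-ε) ε ×ˢ I) := fun p hp =>
    (continuousAt_integral_of_continuousOn hMc hμ hU
      (Ψ := fun p q => traceForm τ (Wt (p, q)) (Wt (p, q)))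
      (cform cWt cWt) hp).continuousWithinAt
  have cdens' : ContinuousOn (fun p : ℝ × ℝ =>
      ∫ q, 2 * traceForm τ (Wt (p, q)) (Wts (p, q)) ∂μ) (Ioo (-ε) ε ×ˢ I) := fun p hp =>
    (continuousAt_integral_of_continuousOn hMc hμ hU
      (Ψ := fun p q => 2 * traceForm τ (Wt (p, q)) (Wts (p, q)))
      cform2 hp).continuousWithinAt
  have hE : HasDerivAt (fun s => ∫ t in a..b, ∫ q, traceForm τ (Wt ((s, t), q)) (Wt ((s, t), q)) ∂μ)
      (∫ t in a..b, ∫ q, 2 * traceForm τ (Wt ((0, t), q)) (Wts ((0, t), q)) ∂μ) 0 := by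
    simp only [intervalIntegral.integral_of_le hab]
    refine hasDerivAt_integral_of_continuousOn (μ := volume.restrict (Ioc a b))
      (M := Icc a b) isCompact_Icc ?_ isOpen_Ioo
      (Ψ := fun s t => ∫ q, traceForm τ (Wt ((s, t), q)) (Wt ((s, t), q)) ∂μ)
      (Ψ' := fun s t => ∫ q, 2 * traceForm τ (Wt ((s, t), q)) (Wts ((s, t), q)) ∂μ) ?_ ?_ ?_ h0
    · filter_upwards [ae_restrict_mem measurableSet_Ioc] with t ht using Ioc_subset_Icc_self ht
    · intro s hs
      exact cdens.comp (f := fun t => (s, t)) (by fun_prop) fun t ht => ⟨hs, habI ht⟩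
    · exact cdens'.mono (prod_mono Subset.rfl habI)
    · intro s hs t ht
      exact hdens t (habI ht) s hs
  -- integration by parts
  have hP : ∀ t ∈ I, HasDerivAt (fun t => ∫ q, traceForm τ (Wt ((0, t), q)) (Ws ((0, t), q)) ∂μ)
      (∫ q, (traceForm τ (Wtt ((0, t), q)) (Ws ((0, t), q))
        + traceForm τ (Wt ((0, t), q)) (Wts ((0, t), q))) ∂μ) t := by
    intro t ht
    refine hasDerivAt_integral_of_continuousOn hMc hμ hI
      (Ψ := fun t q => traceForm τ (Wt ((0, t), q)) (Ws ((0, t), q)))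
      (Ψ' := fun t q => traceForm τ (Wtt ((0, t), q)) (Ws ((0, t), q))
        + traceForm τ (Wt ((0, t), q)) (Wts ((0, t), q))) ?_ ?_ ?_ ht
    · intro t ht
      exact (cform cWt cWs).comp (f := fun q => ((0, t), q)) (by fun_prop)
        fun q hq => ⟨⟨h0, ht⟩, hq⟩
    · exact ((cform cWtt cWs).add (cform cWt cWts)).comp
        (f := fun p : ℝ × 𝔸 => ((0, p.1), p.2)) (by fun_prop) fun p hp => ⟨⟨h0, hp.1⟩, hp.2⟩
    · intro t ht q hq
      have hz : ((0, t), q) ∈ (Ioo (-ε) ε ×ˢ I) ×ˢ M := ⟨⟨h0, ht⟩, hq⟩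
      have h1 := hasDerivAt_comp_snd (W := Wt) ((hWt _ hz).differentiableAt (by simp))
      have h2 := hasDerivAt_comp_snd (W := Ws) ((hWs _ hz).differentiableAt (by simp))
      refine (HasDerivAt.traceForm (τ := τ) h1 h2).congr_deriv ?_
      have h3 := (hW _ hz).eq_fderiv_fderiv_comm es et
      simp only [Wts, Wtt, Ws, Wt] at h3 ⊢
      rw [h3]
  -- By `hcrit` the acceleration term drops out, so the integrand of the first variation is a total
  -- derivative in t. Its primitive vanishes at a and b, where the variation field is zero.
  have hP' : ∀ t ∈ Icc a b,
      HasDerivAt (fun t => ∫ q, traceForm τ (Wt ((0, t), q)) (Ws ((0, t), q)) ∂μ)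
      (∫ q, traceForm τ (Wt ((0, t), q)) (Wts ((0, t), q)) ∂μ) t := by
    intro t ht
    refine (hP t (habI ht)).congr_deriv ?_
    have hi : ∀ {f g : (ℝ × ℝ) × 𝔸 → 𝔸}, ContinuousOn f ((Ioo (-ε) ε ×ˢ I) ×ˢ M) →
        ContinuousOn g ((Ioo (-ε) ε ×ˢ I) ×ˢ M) →
        Integrable (fun q => traceForm τ (f ((0, t), q)) (g ((0, t), q))) μ := fun hf hg =>
      integrable_of_continuousOn hMc hμ ((cform hf hg).comp (f := fun q => ((0, t), q))
        (by fun_prop) fun q hq => ⟨⟨h0, habI ht⟩, hq⟩)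
    rw [integral_add (hi cWtt cWs) (hi cWt cWts), hcrit t ht, zero_add]
  have cint : ContinuousOn (fun t => ∫ q, traceForm τ (Wt ((0, t), q)) (Wts ((0, t), q)) ∂μ)
      (uIcc a b) := by
    rw [uIcc_of_le hab]
    have h1 : ContinuousOn (fun p : ℝ × ℝ =>
        ∫ q, traceForm τ (Wt (p, q)) (Wts (p, q)) ∂μ) (Ioo (-ε) ε ×ˢ I) := fun p hp =>
      (continuousAt_integral_of_continuousOn hMc hμ hU
        (Ψ := fun p q => traceForm τ (Wt (p, q)) (Wts (p, q)))
        (cform cWt cWts) hp).continuousWithinAt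
    exact h1.comp (f := fun t => (0, t)) (by fun_prop) fun t ht => ⟨h0, habI ht⟩
  have hFTC := intervalIntegral.integral_eq_sub_of_hasDerivAt
    (fun t ht => hP' t (by rwa [uIcc_of_le hab] at ht)) cint.intervalIntegrable
  have hend : ∀ t, (∀ q ∈ M, Ws ((0, t), q) = 0) →
      ∫ q, traceForm τ (Wt ((0, t), q)) (Ws ((0, t), q)) ∂μ = 0 := by
    intro t ht
    refine integral_eq_zero_of_ae ?_
    filter_upwards [hμ] with q hq
    rw [ht q hq, map_zero, Pi.zero_apply]
  rw [hend a ha, hend b hb, sub_zero] at hFTC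
  refine (hE.const_mul (1 / 2)).congr_deriv ?_
  simp only [integral_const_mul, intervalIntegral.integral_const_mul]
  rw [hFTC]; simp

end FirstVariation
-- Averages over M are real scalars.
section Average

variable {𝔸 : Type*} [NormedRing 𝔸] [NormedAlgebra ℝ 𝔸] [CompleteSpace 𝔸]
  [StarRing 𝔸] [StarModule ℝ 𝔸] [FiniteDimensional ℝ 𝔸] {τ : 𝔸 →ₗ[ℝ] ℝ} {M : Set 𝔸}

/-- The self-adjoint elements that commute with `M` are the real scalars. -/
def HasRealCommutant (M : Set 𝔸) : Prop :=
  ∀ A : 𝔸, star A = A → (∀ k ∈ M, k * A = A * k) → ∃ r : ℝ, A = r • 1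

variable [MeasurableSpace 𝔸] [BorelSpace 𝔸] {μ : Measure 𝔸}

theorem integrable_of_continuousOn' [IsFiniteMeasure μ] (hMc : IsCompact M)
    (hμ : ∀ᵐ y ∂μ, y ∈ M) {f : 𝔸 → 𝔸} (hf : ContinuousOn f M) : Integrable f μ := by
  obtain ⟨C, hC⟩ := hMc.exists_bound_of_continuousOn hf
  refine Integrable.of_bound ?_ C ?_
  · rw [← Measure.restrict_eq_self_of_ae_mem hμ]
    exact hf.aestronglyMeasurable hMc.measurableSet
  · filter_upwards [hμ] with y hy using hC y hy

/-- The mean over `M` of an equivariant map is a real scalar. -/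
theorem IsInvariantOn.exists_integral_eq_smul (hτ : IsTrace τ) (hM : IsUnitaryModel M)
    (hμ : IsInvariantOn M μ) (hcom : HasRealCommutant M) {Φ : 𝔸 → 𝔸} (hΦ : ContinuousOn Φ M)
    (hconj : ∀ k ∈ M, ∀ q ∈ M, Φ (k * q * star k) = k * Φ q * star k)
    (hstar : ∀ q ∈ M, Φ (star q) = star (Φ q)) : ∃ r : ℝ, ∫ q, Φ q ∂μ = r • (1 : 𝔸) := by
  have hfin := hμ.finite
  have hMc := hM.isCompact hτ
  have hi : Integrable Φ μ := integrable_of_continuousOn' hMc hμ.ae_mem hΦ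
  have hinv : ∀ f : 𝔸 → 𝔸, MeasurePreserving f μ μ → ∫ q, Φ (f q) ∂μ = ∫ q, Φ q ∂μ := by
    intro f hf
    have h1 : AEStronglyMeasurable Φ (Measure.map f μ) := by
      rw [hf.map_eq]; exact hi.aestronglyMeasurable
    rw [← integral_map hf.measurable.aemeasurable h1, hf.map_eq]
  refine hcom _ ?_ fun k hk => ?_
  · let st : 𝔸 →L[ℝ] 𝔸 := LinearMap.toContinuousLinearMap
      { toFun := star, map_add' := star_add, map_smul' := fun r x => by simp }
    calc star (∫ q, Φ q ∂μ) = ∫ q, st (Φ q) ∂μ := (st.integral_comp_comm hi).symm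
      _ = ∫ q, Φ (star q) ∂μ := integral_congr_ae (by
          filter_upwards [hμ.ae_mem] with q hq using (hstar q hq).symm)
      _ = _ := hinv _ hμ.adjoint
  · have hku := hM.unitary k hk
    let cj : 𝔸 →L[ℝ] 𝔸 :=
      (ContinuousLinearMap.mul ℝ 𝔸 k).comp ((ContinuousLinearMap.mul ℝ 𝔸).flip (star k))
    have h1 : k * (∫ q, Φ q ∂μ) * star k = ∫ q, Φ q ∂μ := by
      calc k * (∫ q, Φ q ∂μ) * star k = cj (∫ q, Φ q ∂μ) := by simp [cj, mul_assoc]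
        _ = ∫ q, cj (Φ q) ∂μ := (cj.integral_comp_comm hi).symm
        _ = ∫ q, Φ (k * q * star k) ∂μ := integral_congr_ae (by
            filter_upwards [hμ.ae_mem] with q hq
            rw [hconj k hk q hq]; simp [cj, mul_assoc])
        _ = _ := hinv _ ((hμ.right _ (hM.star_mem k hk)).comp (hμ.left k hk))
    nth_rewrite 2 [← h1]
    rw [mul_assoc, hku, mul_one]

theorem conj_pow {k v : 𝔸} (hk : star k * k = 1) (j : ℕ) :
    (k * v * star k) ^ j = k * v ^ j * star k := by
  induction j with
  | zero => simp [mul_star_of_star_mul hk]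
  | succ j ih =>
    rw [pow_succ, ih, pow_succ]
    calc k * v ^ j * star k * (k * v * star k) = k * v ^ j * (star k * k) * v * star k := by
          noncomm_ring
      _ = _ := by rw [hk]; noncomm_ring

/-- The mean of V^k is a real scalar r, so a coefficient x survives only through its trace. The case
x = 1 identifies r τ 1 with the moment, and multiplying by τ 1 avoids a division. -/
theorem integral_mul_flow_pow (hτ : IsTrace τ) (hM : IsUnitaryModel M)
    (hμ : IsInvariantOn M μ) (hcom : HasRealCommutant M) (t : ℝ) (k : ℕ) (x : 𝔸) :
    (∫ q, τ (x * flow t q ^ k) ∂μ) * τ 1 = moment τ μ k t * τ x := by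
  have hfin := hμ.finite
  have hMc := hM.isCompact hτ
  have hc : ContinuousOn (fun q : 𝔸 => flow t q ^ k) M :=
    (hτ.continuousOn_flow_right hM.unitary t).pow k
  obtain ⟨r, hr⟩ := hμ.exists_integral_eq_smul hτ hM hcom hc
    (fun k hk q hq => by
      rw [hτ.flow_conj (hM.unitary q hq) (hM.unitary k hk), conj_pow (hM.unitary k hk)])
    (fun q hq => by rw [hτ.flow_star (hM.unitary q hq), star_pow])
  have key : ∀ y, ∫ q, τ (y * flow t q ^ k) ∂μ = r * τ y := by
    intro y
    let L : 𝔸 →L[ℝ] ℝ := (LinearMap.toContinuousLinearMap τ).comp (ContinuousLinearMap.mul ℝ 𝔸 y)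
    calc ∫ q, τ (y * flow t q ^ k) ∂μ = L (∫ q, flow t q ^ k ∂μ) :=
          L.integral_comp_comm (integrable_of_continuousOn' hMc hμ.ae_mem hc)
      _ = r * τ y := by rw [hr]; simp [L]
  have h1 : moment τ μ k t = r * τ 1 := by rw [← key 1]; simp [moment]
  rw [key, h1]; ring

end Average

/-! ### Velocity fields of the action, and their pairing with the acceleration. -/

section Velocity

variable {𝔸 : Type*} [NormedRing 𝔸] [NormedAlgebra ℝ 𝔸] [CompleteSpace 𝔸]
  [StarRing 𝔸] [StarModule ℝ 𝔸] [FiniteDimensional ℝ 𝔸] {τ : 𝔸 →ₗ[ℝ] ℝ} {M : Set 𝔸}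
  {E : Type*} [NormedAddCommGroup E] [NormedSpace ℝ E]

/-- A splitting of the elements of `E` into blocks in `𝔸`. -/
structure Blocks (E 𝔸 : Type*) [NormedAddCommGroup E] [NormedSpace ℝ E] [NormedRing 𝔸]
    [NormedAlgebra ℝ 𝔸] where
  (a b c d : E →L[ℝ] 𝔸)

/-- The Möbius action of `g : E` through its blocks. -/
noncomputable def mobE (β : Blocks E 𝔸) (g : E) (q : 𝔸) : 𝔸 :=
  mob (β.a g) (β.b g) (β.c g) (β.d g) q

/-- The velocity at `q` of the motion with velocity `X` at `g`. -/
noncomputable def velE (β : Blocks E 𝔸) (g X : E) (q : 𝔸) : 𝔸 :=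
  fderiv ℝ (fun h => mobE β h q) g X

/-- The kinetic energy metric. -/
noncomputable def kinE [MeasurableSpace 𝔸] (τ : 𝔸 →ₗ[ℝ] ℝ) (β : Blocks E 𝔸) (μ : Measure 𝔸)
    (g X Y : E) : ℝ :=
  ∫ q, traceForm τ (velE β g X q) (velE β g Y q) ∂μ

variable {β : Blocks E 𝔸}

theorem contDiffAt_mobE {Z : Type*} [NormedAddCommGroup Z] [NormedSpace ℝ Z] {g : Z → E}
    {q : Z → 𝔸} {z : Z} {n : ℕ∞ω} (hg : ContDiffAt ℝ n g z) (hq : ContDiffAt ℝ n q z)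
    (hu : IsUnit (β.c (g z) * q z + β.d (g z))) :
    ContDiffAt ℝ n (fun z => mobE β (g z) (q z)) z :=
  contDiffAt_mob (hg.continuousLinearMap_comp β.a) (hg.continuousLinearMap_comp β.b)
    (hg.continuousLinearMap_comp β.c) (hg.continuousLinearMap_comp β.d) hq hu

theorem differentiableAt_mobE {g : E} {q : 𝔸} (hu : IsUnit (β.c g * q + β.d g)) :
    DifferentiableAt ℝ (fun h => mobE β h q) g :=
  (contDiffAt_mobE (n := 1) contDiffAt_id contDiffAt_const hu).differentiableAt one_ne_zero

theorem hasDerivAt_mobE {c : ℝ → E} {c' : E} {t : ℝ} {q : 𝔸} (hc : HasDerivAt c c' t)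
    (hu : IsUnit (β.c (c t) * q + β.d (c t))) :
    HasDerivAt (fun t => mobE β (c t) q) (velE β (c t) c' q) t :=
  (differentiableAt_mobE hu).hasFDerivAt.comp_hasDerivAt t hc

/-- Differentiation of (g * q)(cq + d) = aq + b in the direction X. -/
theorem velE_mul_den {g X : E} {q : 𝔸} (hu : IsUnit (β.c g * q + β.d g)) :
    velE β g X q * (β.c g * q + β.d g)
      = β.a X * q + β.b X - mobE β g q * (β.c X * q + β.d X) := by
  have hline : HasDerivAt (fun s : ℝ => g + s • X) X 0 := by
    simpa using ((hasDerivAt_id (0 : ℝ)).smul_const X).const_add g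
  have hu0 : IsUnit (β.c (g + (0 : ℝ) • X) * q + β.d (g + (0 : ℝ) • X)) := by simpa using hu
  have h1 := hasDerivAt_mobE hline hu0
  have hl : ∀ L : E →L[ℝ] 𝔸, HasDerivAt (fun s : ℝ => L (g + s • X)) (L X) 0 := fun L =>
    L.hasFDerivAt.comp_hasDerivAt 0 hline
  have hden : HasDerivAt (fun s : ℝ => β.c (g + s • X) * q + β.d (g + s • X))
      (β.c X * q + β.d X) 0 := ((hl β.c).mul_const q).add (hl β.d)
  have hnum : HasDerivAt (fun s : ℝ => β.a (g + s • X) * q + β.b (g + s • X))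
      (β.a X * q + β.b X) 0 := ((hl β.a).mul_const q).add (hl β.b)
  have h2 := h1.mul hden
  have heq : (fun s : ℝ => mobE β (g + s • X) q * (β.c (g + s • X) * q + β.d (g + s • X)))
      =ᶠ[𝓝 0] fun s : ℝ => β.a (g + s • X) * q + β.b (g + s • X) := by
    filter_upwards [hden.continuousAt.preimage_mem_nhds (Units.isOpen.mem_nhds hu0)] with s hs
    rw [mobE, mob, mul_assoc, Ring.inverse_mul_cancel _ hs, mul_one]
  have h3 := h2.unique (hnum.congr_of_eventuallyEq heq)
  simp only [zero_smul, add_zero] at h3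
  rw [← h3]; abel

/-- The coefficients are the blocks of X γ(-t), that is, of X moved to the identity by a right
translation; the velocity at q becomes that of a Lie algebra element at V = γ(t) * q. -/
theorem velE_eq_of_cosh {g X : E} {q : 𝔸} {t : ℝ} (ha : β.a g = Real.cosh t • 1)
    (hb : β.b g = Real.sinh t • 1) (hc : β.c g = Real.sinh t • 1) (hd : β.d g = Real.cosh t • 1)
    (hu : IsUnit (β.c g * q + β.d g)) :
    velE β g X q = (Real.cosh t • β.a X - Real.sinh t • β.b X) * flow t q
      + (Real.cosh t • β.b X - Real.sinh t • β.a X)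
      - flow t q * (Real.cosh t • β.c X - Real.sinh t • β.d X) * flow t q
      - flow t q * (Real.cosh t • β.d X - Real.sinh t • β.c X) := by
  have h1 := velE_mul_den (X := X) hu
  have hV : mobE β g q = flow t q := by rw [mobE, flow, ha, hb, hc, hd]
  have hden : β.c g * q + β.d g = Real.sinh t • q + Real.cosh t • 1 := by rw [hc, hd]; simp
  have hnum : flow t q * (Real.sinh t • q + Real.cosh t • 1)
      = Real.cosh t • q + Real.sinh t • 1 := by
    rw [← hden, ← hV, mobE, mob, mul_assoc, Ring.inverse_mul_cancel _ hu, mul_one, ha, hb]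
    simp
  rw [hV, hden] at h1
  rw [hden] at hu
  refine hu.mul_right_cancel ?_
  rw [h1]
  set Q := Real.sinh t • q + Real.cosh t • (1 : 𝔸) with hQ
  have hcs : Real.cosh t * Real.cosh t = 1 + Real.sinh t * Real.sinh t := by
    linarith [Real.cosh_sq t]
  have e1 : Real.cosh t • (flow t q * Q) - Real.sinh t • Q = q := by
    rw [hnum, hQ]
    simp only [smul_add, smul_smul]
    rw [hcs, add_smul, one_smul, mul_comm (Real.sinh t) (Real.cosh t)]; abel
  have e2 : Real.cosh t • Q - Real.sinh t • (flow t q * Q) = 1 := by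
    rw [hnum, hQ]
    simp only [smul_add, smul_smul]
    rw [hcs, add_smul, one_smul, mul_comm (Real.sinh t) (Real.cosh t)]; abel
  have e3 : ∀ x y : 𝔸, x * q + y = (Real.cosh t • x - Real.sinh t • y) * (flow t q * Q)
      + (Real.cosh t • y - Real.sinh t • x) * Q := by
    intro x y
    calc x * q + y = x * q + y * 1 := by rw [mul_one]
      _ = x * (Real.cosh t • (flow t q * Q) - Real.sinh t • Q)
          + y * (Real.cosh t • Q - Real.sinh t • (flow t q * Q)) := by rw [e1, e2]
      _ = _ := by
        simp only [mul_sub, sub_mul, mul_smul_comm, smul_mul_assoc]; abel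
  rw [e3 (β.a X), e3 (β.c X)]
  noncomm_ring

/-- The linearization along a curve of the relations of the split unitary group. -/
theorem trace_eq_of_hasDerivAt (hτ : IsTrace τ) {c : ℝ → E} {X : E} {t : ℝ} (hc : HasDerivAt c X 0)
    (hs : ∀ᶠ s in 𝓝 0, IsSplit (β.a (c s)) (β.b (c s)) (β.c (c s)) (β.d (c s)))
    (ha : β.a (c 0) = Real.cosh t • 1) (hb : β.b (c 0) = Real.sinh t • 1)
    (hcc : β.c (c 0) = Real.sinh t • 1) (hd : β.d (c 0) = Real.cosh t • 1) :
    τ (Real.cosh t • β.a X - Real.sinh t • β.b X) = 0 ∧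
    τ (Real.cosh t • β.d X - Real.sinh t • β.c X) = 0 ∧
    τ (Real.cosh t • β.c X - Real.sinh t • β.d X)
      = τ (Real.cosh t • β.b X - Real.sinh t • β.a X) := by
  have : ContinuousStar 𝔸 := ⟨LinearMap.continuous_of_finiteDimensional
    ({ toFun := star, map_add' := star_add, map_smul' := fun r x => by simp } : 𝔸 →ₗ[ℝ] 𝔸)⟩
  have hl : ∀ L : E →L[ℝ] 𝔸, HasDerivAt (fun s : ℝ => L (c s)) (L X) 0 := fun L =>
    L.hasFDerivAt.comp_hasDerivAt 0 hc
  -- Each relation of `IsSplit` is constant along the curve. Only the trace of its derivative is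
  -- kept, as averaging over M retains nothing else.
  have key : ∀ L₁ L₂ L₃ L₄ : E →L[ℝ] 𝔸,
      (∃ y, ∀ᶠ s in 𝓝 0, star (L₁ (c s)) * L₂ (c s) - star (L₃ (c s)) * L₄ (c s) = y) →
      τ (star (L₁ X) * L₂ (c 0) + star (L₁ (c 0)) * L₂ X)
        = τ (star (L₃ X) * L₄ (c 0) + star (L₃ (c 0)) * L₄ X) := by
    rintro L₁ L₂ L₃ L₄ ⟨y, hy⟩
    have h1 := ((hl L₁).star.mul (hl L₂)).sub ((hl L₃).star.mul (hl L₄))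
    have h2 := h1.unique ((hasDerivAt_const (0 : ℝ) y).congr_of_eventuallyEq hy)
    rw [sub_eq_zero.1 h2]
  have h1 := key β.a β.a β.c β.c ⟨1, hs.mono fun s h => h.aa⟩
  have h2 := key β.a β.b β.c β.d ⟨0, hs.mono fun s h => sub_eq_zero.2 h.ab⟩
  have h3 := key β.d β.d β.b β.b ⟨1, hs.mono fun s h => h.bb⟩
  rw [ha, hcc] at h1
  rw [ha, hb, hcc, hd] at h2
  rw [hd, hb] at h3
  simp only [star_smul, star_trivial, star_one, mul_smul_comm, smul_mul_assoc, mul_one, one_mul,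
    map_add, map_smul, smul_eq_mul, hτ.map_star, map_sub] at h1 h2 h3 ⊢
  have hcs : Real.cosh t * Real.cosh t = 1 + Real.sinh t * Real.sinh t := by
    linarith [Real.cosh_sq t]
  have hpos := Real.cosh_pos t
  set C := Real.cosh t
  set s := Real.sinh t
  have hA : C * τ (β.a X) = s * τ (β.c X) := by linarith
  have hD : C * τ (β.d X) = s * τ (β.b X) := by linarith
  have hB : τ (β.b X) = τ (β.c X) := by
    linear_combination C * h2 - s * hA + s * hD - (τ (β.b X) - τ (β.c X)) * hcs
  have hAD : τ (β.a X) = τ (β.d X) := by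
    refine mul_left_cancel₀ hpos.ne' ?_
    rw [hA, hD, hB]
  refine ⟨by rw [hA, hB]; ring, by rw [hD, hB]; ring, by rw [hB, hAD]⟩

/-- Cyclicity of the trace and V⋆ = V⁻¹ bring every word to the form of a constant times a power of
V, with exponent at most 3; these are the expressions that `integral_mul_flow_pow` averages. -/
theorem traceForm_flow_acceleration (hτ : IsTrace τ) {V : 𝔸} (hV : star V * V = 1) (x y : ℝ)
    (a b c d : 𝔸) :
    traceForm τ (x • (1 - V * V) + y • (V * (1 - V * V))) (a * V + b - V * c * V - V * d)
      = τ (y • (a - d) + x • b + x • c)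
        + τ ((x • (a - d) - x • star (a - d) + y • star b - y • c + y • star c) * V)
        + τ ((-(y • star (a - d)) - x • star b - x • c) * V ^ 2)
        + τ (-(y • star b) * V ^ 3) := by
  have hV' := mul_star_of_star_mul hV
  set W := star V with hW
  -- Negative powers of V are traded for positive ones at the cost of an adjoint on the coefficient.
  have st : ∀ z (k : ℕ), τ (z * W ^ k) = τ (star z * V ^ k) := by
    intro z k
    rw [← hτ.map_star, star_mul, star_pow, hW, star_star, hτ.comm]
  have st1 : ∀ z, τ (z * W) = τ (star z * V) := fun z => by simpa using st z 1
  have cy : ∀ u v w : 𝔸, τ (u * v * w) = τ (v * (w * u)) := fun u v w => by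
    rw [mul_assoc, hτ.comm, mul_assoc]
  set S := star (x • (1 - V * V) + y • (V * (1 - V * V))) with hS
  have eS : S = x • (1 - W ^ 2) + y • (W ^ 1 - W ^ 3) := by
    rw [hS]
    simp only [star_add, star_smul, star_trivial, star_sub, star_one, star_mul]
    rw [← hW]; simp only [sub_mul, one_mul, pow_succ, pow_zero, mul_assoc]
  have eVS : V * S = x • (V ^ 1 - W ^ 1) + y • (1 - W ^ 2) := by
    rw [eS]
    simp only [mul_add, mul_smul_comm, mul_sub, mul_one, pow_succ, pow_zero, one_mul,
      ← mul_assoc, hV']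
  have eSV : S * V = x • (V ^ 1 - W ^ 1) + y • (1 - W ^ 2) := by
    rw [eS]
    simp only [add_mul, smul_mul_assoc, sub_mul, one_mul, pow_succ, pow_zero, mul_assoc, hV,
      mul_one]
  have eVSV : V * (S * V) = x • (V ^ 2 - 1) + y • (V ^ 1 - W ^ 1) := by
    rw [eSV]
    simp only [mul_add, mul_smul_comm, mul_sub, mul_one, pow_succ, pow_zero, one_mul,
      ← mul_assoc, hV']
  have e1 : τ (S * (a * V + b - V * c * V - V * d))
      = τ (a * (V * S)) + τ (b * S) - τ (c * (V * (S * V))) - τ (d * (S * V)) := by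
    rw [mul_sub, mul_sub, mul_add, map_sub, map_sub, map_add, ← mul_assoc S a V, cy S a V,
      hτ.comm S b, ← mul_assoc S V d, hτ.comm (S * V) d]
    congr 2
    rw [← mul_assoc, ← mul_assoc, cy (S * V) c V]
  rw [traceForm_apply, e1, eVSV, eVS, eSV, eS]
  simp only [mul_add, mul_sub, mul_smul_comm, map_add, map_sub, map_smul, smul_eq_mul, st, st1, mul_one,
    add_mul, sub_mul, smul_mul_assoc, star_sub, neg_mul, map_neg, pow_one]
  ring

end Velocity
-- The reparametrized one-parameter group is a geodesic.
section Geodesic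

variable {𝔸 : Type*} [NormedRing 𝔸] [NormedAlgebra ℝ 𝔸] [CompleteSpace 𝔸]
  [StarRing 𝔸] [StarModule ℝ 𝔸] [FiniteDimensional ℝ 𝔸] {τ : 𝔸 →ₗ[ℝ] ℝ} {M : Set 𝔸}
  [MeasurableSpace 𝔸] [BorelSpace 𝔸] {μ : Measure 𝔸}
  {E : Type*} [NormedAddCommGroup E] [NormedSpace ℝ E] {β : Blocks E 𝔸} {S : Set E} {Γ : ℝ → E}

/-- After averaging only τ a = τ d = 0 and τ c = τ b enter, and the pairing collapses to τ b times
the left side of `hxy`. -/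
theorem integral_acceleration_eq_zero (hτ : IsTrace τ) (hM : IsUnitaryModel M)
    (hμ : IsInvariantOn M μ) (hcom : HasRealCommutant M) (h1 : τ 1 ≠ 0) {t x y : ℝ}
    (hxy : 2 * x * (moment τ μ 0 t - moment τ μ 2 t)
      + y * (moment τ μ 1 t - moment τ μ 3 t) = 0) {a b c d : 𝔸}
    (ha : τ a = 0) (hd : τ d = 0) (hbc : τ c = τ b) :
    ∫ q, traceForm τ
      (x • (1 - flow t q * flow t q) + y • (flow t q * (1 - flow t q * flow t q)))
      (a * flow t q + b - flow t q * c * flow t q - flow t q * d) ∂μ = 0 := by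
  have hfin := hμ.finite
  have hMc := hM.isCompact hτ
  have hi : ∀ (k : ℕ) (z : 𝔸), Integrable (fun q => τ (z * flow t q ^ k)) μ := fun k z =>
    integrable_of_continuousOn hMc hμ.ae_mem
      ((LinearMap.continuous_of_finiteDimensional τ).comp_continuousOn
        (continuousOn_const.mul ((hτ.continuousOn_flow_right hM.unitary t).pow k)))
  have hk := integral_mul_flow_pow hτ hM hμ hcom t
  set z₀ := y • (a - d) + x • b + x • c with hz₀
  set z₁ := x • (a - d) - x • star (a - d) + y • star b - y • c + y • star c with hz₁
  set z₂ := -(y • star (a - d)) - x • star b - x • c with hz₂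
  set z₃ := -(y • star b) with hz₃
  have h2 : ∫ q, traceForm τ
      (x • (1 - flow t q * flow t q) + y • (flow t q * (1 - flow t q * flow t q)))
      (a * flow t q + b - flow t q * c * flow t q - flow t q * d) ∂μ
      = ∫ q, (τ (z₀ * flow t q ^ 0) + τ (z₁ * flow t q ^ 1) + τ (z₂ * flow t q ^ 2)
        + τ (z₃ * flow t q ^ 3)) ∂μ := by
    refine integral_congr_ae ?_
    filter_upwards [hμ.ae_mem] with q hq
    rw [traceForm_flow_acceleration hτ (hτ.star_flow_mul (hM.unitary q hq) t), pow_zero, mul_one,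
      pow_one]
  refine (mul_eq_zero.1 ?_).resolve_right h1
  have i1 : Integrable (fun q => τ (z₀ * flow t q ^ 0) + τ (z₁ * flow t q ^ 1)) μ :=
    (hi 0 z₀).add (hi 1 z₁)
  have i2 : Integrable (fun q => τ (z₀ * flow t q ^ 0) + τ (z₁ * flow t q ^ 1)
    + τ (z₂ * flow t q ^ 2)) μ := i1.add (hi 2 z₂)
  rw [h2, integral_add i2 (hi 3 z₃), integral_add i1 (hi 2 z₂), integral_add (hi 0 z₀) (hi 1 z₁),
    add_mul, add_mul, add_mul, hk, hk, hk, hk]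
  simp only [hz₀, hz₁, hz₂, hz₃, map_add, map_sub, map_neg, map_smul, smul_eq_mul, hτ.map_star,
    ha, hd, hbc]
  linear_combination τ b * hxy

/-- The set `S` acts by Möbius transformations through the blocks `β`, and contains the
hyperbolic one-parameter group `Γ`. -/
structure IsMobiusModel (β : Blocks E 𝔸) (S : Set E) (Γ : ℝ → E) : Prop where
  split : ∀ g ∈ S, IsSplit (β.a g) (β.b g) (β.c g) (β.d g)
  smooth : ContDiff ℝ ∞ Γ
  mem : ∀ t, Γ t ∈ S
  a_eq : ∀ t, β.a (Γ t) = Real.cosh t • 1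
  b_eq : ∀ t, β.b (Γ t) = Real.sinh t • 1
  c_eq : ∀ t, β.c (Γ t) = Real.sinh t • 1
  d_eq : ∀ t, β.d (Γ t) = Real.cosh t • 1

theorem IsMobiusModel.mobE_eq (hS : IsMobiusModel β S Γ) (t : ℝ) (q : 𝔸) :
    mobE β (Γ t) q = flow t q := by
  rw [mobE, flow, hS.a_eq, hS.b_eq, hS.c_eq, hS.d_eq]

theorem IsMobiusModel.isUnit_den (hS : IsMobiusModel β S Γ) (hτ : IsTrace τ) {g : E} (hg : g ∈ S)
    {q : 𝔸} (hq : star q * q = 1) : IsUnit (β.c g * q + β.d g) :=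
  hτ.isUnit_den (hS.split g hg) hq

theorem IsMobiusModel.velE_deriv (hS : IsMobiusModel β S Γ) (hτ : IsTrace τ) (t : ℝ) {q : 𝔸}
    (hq : star q * q = 1) : velE β (Γ t) (deriv Γ t) q = 1 - flow t q * flow t q := by
  have h1 := hasDerivAt_mobE (β := β) ((hS.smooth.differentiable (by simp)) t).hasDerivAt
    (hS.isUnit_den hτ (hS.mem t) hq)
  have h2 : (fun t => mobE β (Γ t) q) = fun t => flow t q := funext fun t => hS.mobE_eq t q
  rw [h2] at h1
  exact h1.unique (hτ.hasDerivAt_flow hq t)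

theorem kinE_smul (τ : 𝔸 →ₗ[ℝ] ℝ) (β : Blocks E 𝔸) (μ : Measure 𝔸) (g X Y : E) (r s : ℝ) :
    kinE τ β μ g (r • X) (s • Y) = r * s * kinE τ β μ g X Y := by
  rw [kinE, kinE, ← integral_const_mul]
  refine integral_congr_ae (Eventually.of_forall fun q => ?_)
  simp only [velE, map_smul, smul_apply, smul_eq_mul]; ring

theorem IsMobiusModel.kinE_deriv (hS : IsMobiusModel β S Γ) (hτ : IsTrace τ)
    (hM : IsUnitaryModel M) (hμ : IsInvariantOn M μ) (t : ℝ) :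
    kinE τ β μ (Γ t) (deriv Γ t) (deriv Γ t) = speedSq μ t := by
  refine integral_congr_ae ?_
  filter_upwards [hμ.ae_mem] with q hq
  rw [hS.velE_deriv hτ t (hM.unitary q hq), traceForm_apply, hτ.sq]

/-- The acceleration is orthogonal to every variation field: by averaging only the direction of γ'
matters, and there orthogonality is the constancy of the speed. -/
theorem IsMobiusModel.isGeodesic (hS : IsMobiusModel β S Γ) (hτ : IsTrace τ)
    (hM : IsUnitaryModel M) (hμ : IsInvariantOn M μ) (hcom : HasRealCommutant M)
    (hpos : ∀ t, 0 < speedSq μ t) (h1 : τ 1 ≠ 0) {σ φ : ℝ → ℝ} {L₁ L₂ : ℝ}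
    (H : IsArcLength (speedSq μ) σ φ L₁ L₂) :
    IsGeodesic (kinE τ β μ) S (fun s => Γ (φ s)) (Ioo L₁ L₂) where
  interval := isOpenInterval_Ioo H.lt
  smooth := hS.smooth.comp_contDiffOn H.smooth
  mem t _ := hS.mem _
  critical a ha b hb hab ε hε K hK := by
    have hfin := hμ.finite
    have hMc := hM.isCompact hτ
    set I := Ioo L₁ L₂
    have hI : IsOpen I := isOpen_Ioo
    have habI : Icc a b ⊆ I := Icc_subset_Ioo ha.1 hb.2
    have h0 : (0 : ℝ) ∈ Ioo (-ε) ε := ⟨by linarith, hε⟩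
    have hKs : ∀ p ∈ Ioo (-ε) ε ×ˢ I, ContDiffAt ℝ ∞ (fun p : ℝ × ℝ => K p.1 p.2) p := fun p hp =>
      hK.smooth.contDiffAt ((isOpen_Ioo.prod hI).mem_nhds hp)
    set W : (ℝ × ℝ) × 𝔸 → 𝔸 := fun z => mobE β (K z.1.1 z.1.2) z.2 with hWdef
    have hden : ∀ s ∈ Ioo (-ε) ε, ∀ t ∈ I, ∀ q ∈ M, IsUnit (β.c (K s t) * q + β.d (K s t)) :=
      fun s hs t ht q hq => hS.isUnit_den hτ (hK.mem s hs t ht) (hM.unitary q hq)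
    have hW : ∀ z ∈ (Ioo (-ε) ε ×ˢ I) ×ˢ M, ContDiffAt ℝ ∞ W z := fun z hz =>
      contDiffAt_mobE ((hKs z.1 hz.1).comp z contDiff_fst.contDiffAt) contDiff_snd.contDiffAt
        (hden _ hz.1.1 _ hz.1.2 _ hz.2)
    have hKd1 : ∀ s ∈ Ioo (-ε) ε, ∀ t ∈ I, DifferentiableAt ℝ (fun s => K s t) s :=
      fun s hs t ht => ((hKs (s, t) ⟨hs, ht⟩).comp (f := fun s : ℝ => (s, t)) s
        (contDiffAt_id.prodMk contDiffAt_const)).differentiableAt (by simp)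
    have hKd2 : ∀ s ∈ Ioo (-ε) ε, ∀ t ∈ I, DifferentiableAt ℝ (K s) t :=
      fun s hs t ht => ((hKs (s, t) ⟨hs, ht⟩).comp (f := fun t : ℝ => (s, t)) t
        (contDiffAt_const.prodMk contDiffAt_id)).differentiableAt (by simp)
    have hWs : ∀ s ∈ Ioo (-ε) ε, ∀ t ∈ I, ∀ q ∈ M, fderiv ℝ W ((s, t), q) ((1, 0), 0)
        = velE β (K s t) (deriv (fun s => K s t) s) q := fun s hs t ht q hq =>
      (hasDerivAt_comp_fst ((hW ((s, t), q) ⟨⟨hs, ht⟩, hq⟩).differentiableAt (by simp))).unique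
        (hasDerivAt_mobE (hKd1 s hs t ht).hasDerivAt (hden s hs t ht q hq))
    have hWt : ∀ s ∈ Ioo (-ε) ε, ∀ t ∈ I, ∀ q ∈ M, fderiv ℝ W ((s, t), q) ((0, 1), 0)
        = velE β (K s t) (deriv (K s) t) q := fun s hs t ht q hq =>
      (hasDerivAt_comp_snd ((hW ((s, t), q) ⟨⟨hs, ht⟩, hq⟩).differentiableAt (by simp))).unique
        (hasDerivAt_mobE (hKd2 s hs t ht).hasDerivAt (hden s hs t ht q hq))
    have hfix : ∀ t ∈ I, (∀ s ∈ Ioo (-ε) ε, K s t = Γ (φ t)) → ∀ q ∈ M,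
        fderiv ℝ W ((0, t), q) ((1, 0), 0) = 0 := by
      intro t ht hKt q hq
      have h2 : deriv (fun s => K s t) 0 = 0 := by
        have h3 : (fun s => K s t) =ᶠ[𝓝 0] fun _ => Γ (φ t) := by
          filter_upwards [isOpen_Ioo.mem_nhds h0] with s hs using hKt s hs
        rw [h3.deriv_eq]; simp
      rw [hWs 0 h0 t ht q hq, h2, velE, map_zero]
    have hcrit : ∀ t ∈ Icc a b, ∫ q, traceForm τ
        (fderiv ℝ (fun z => fderiv ℝ W z ((0, 1), 0)) ((0, t), q) ((0, 1), 0))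
        (fderiv ℝ W ((0, t), q) ((1, 0), 0)) ∂μ = 0 := by
      intro t htab
      have ht := habI htab
      have hφd : ∀ s ∈ I, HasDerivAt φ (deriv φ s) s := fun s hs =>
        (H.hasDerivAt_inv s hs).differentiableAt.hasDerivAt
      have hφd2 : HasDerivAt (deriv φ) (deriv (deriv φ) t) t :=
        ((contDiffAt_fderiv_apply (H.smooth.contDiffAt (hI.mem_nhds ht)) 1).differentiableAt
          (by simp)).hasDerivAt
      set x := deriv (deriv φ) t
      set p := deriv φ t
      have hK0 : K 0 t = Γ (φ t) := hK.zero t ht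
      set X := deriv (fun s => K s t) 0
      have htr := trace_eq_of_hasDerivAt (β := β) hτ (c := fun s => K s t) (t := φ t)
        (hKd1 0 h0 t ht).hasDerivAt
        (by filter_upwards [isOpen_Ioo.mem_nhds h0] with s hs using hS.split _ (hK.mem s hs t ht))
        (by simp only [hK0, hS.a_eq]) (by simp only [hK0, hS.b_eq])
        (by simp only [hK0, hS.c_eq]) (by simp only [hK0, hS.d_eq])
      -- the equation of unit speed, differentiated
      have hunit : 2 * x * (moment τ μ 0 (φ t) - moment τ μ 2 (φ t))
          + (-2 * p ^ 2) * (moment τ μ 1 (φ t) - moment τ μ 3 (φ t)) = 0 := by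
        have e1 : ∀ s ∈ I, deriv φ s * deriv φ s * speedSq μ (φ s) = 1 := by
          intro s hs
          rw [(H.hasDerivAt_inv s hs).deriv]
          have := hpos (φ s)
          have h3 := Real.mul_self_sqrt this.le
          rw [← mul_inv, h3, inv_mul_cancel₀ this.ne']
        have e2 : (fun s => deriv φ s * deriv φ s * speedSq μ (φ s)) =ᶠ[𝓝 t] fun _ => 1 := by
          filter_upwards [hI.mem_nhds ht] with s hs using e1 s hs
        have e3 : HasDerivAt (speedSq μ)
            (-(4 * (moment τ μ 1 (φ t) - moment τ μ 3 (φ t)))) (φ t) := by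
          rw [speedSq_eq hτ hMc hM.unitary hμ.ae_mem]
          refine (((hasDerivAt_moment hτ hMc hM.unitary hμ.ae_mem 2 (φ t)).const_sub _).const_mul
            2).congr_deriv ?_
          norm_num; ring
        have e4 := ((hφd2.mul hφd2).mul (e3.comp t (hφd t ht))).unique
          ((hasDerivAt_const t (1 : ℝ)).congr_of_eventuallyEq e2)
        have e5 : speedSq μ (φ t) = 2 * (moment τ μ 0 (φ t) - moment τ μ 2 (φ t)) := by
          rw [speedSq_eq hτ hMc hM.unitary hμ.ae_mem]
          simp [moment]
        have hp : p ≠ 0 := fun h => by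
          have := e1 t ht
          rw [show deriv φ t = 0 from h] at this; simp at this
        -- The derivative of φ'² · speed² = 1 is the desired equation multiplied by 2p.
        refine (mul_eq_zero.1 ?_).resolve_left (mul_ne_zero two_ne_zero hp)
        simp only [Function.comp, Pi.mul_apply, e5, show deriv φ t = p from rfl] at e4
        linear_combination e4
      have hint := integral_acceleration_eq_zero hτ hM hμ hcom h1 hunit htr.1 htr.2.1 htr.2.2
      refine Eq.trans (integral_congr_ae ?_) hint
      filter_upwards [hμ.ae_mem] with q hq
      have hz : ((0, t), q) ∈ (Ioo (-ε) ε ×ˢ I) ×ˢ M := ⟨⟨h0, ht⟩, hq⟩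
      have hqu := hM.unitary q hq
      congr 1
      · congr 1
        have hd1 := hasDerivAt_comp_snd (W := fun z => fderiv ℝ W z ((0, 1), 0))
          ((contDiffAt_fderiv_apply (hW _ hz) _).differentiableAt (by simp))
        have hWt0 : (fun s => fderiv ℝ W ((0, s), q) ((0, 1), 0)) =ᶠ[𝓝 t]
            fun s => deriv φ s • (1 - flow (φ s) q * flow (φ s) q) := by
          filter_upwards [hI.mem_nhds ht] with s hs
          have d1 := hasDerivAt_comp_snd (W := W)
            ((hW ((0, s), q) ⟨⟨h0, hs⟩, hq⟩).differentiableAt (by simp))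
          have d2 : (fun r => W ((0, r), q)) =ᶠ[𝓝 s] fun r => flow (φ r) q := by
            filter_upwards [hI.mem_nhds hs] with r hr
            simp only [hWdef, hK.zero r hr, hS.mobE_eq]
          exact d1.unique (((hτ.hasDerivAt_flow hqu (φ s)).scomp s
            (hφd s hs)).congr_of_eventuallyEq d2)
        -- The derivative of φ'(1 - V²) is φ''(1 - V²) - 2φ'² V(1 - V²), whence the coefficients x
        -- and -2p².
        have hV := (hτ.hasDerivAt_flow hqu (φ t)).scomp t (hφd t ht)
        have d3 := hφd2.smul ((hV.mul hV).const_sub 1)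
        rw [hd1.unique (d3.congr_of_eventuallyEq hWt0)]
        simp only [Function.comp, Pi.mul_apply, smul_mul_assoc, mul_smul_comm, smul_neg, smul_add, mul_sub,
          sub_mul, smul_sub, mul_one, one_mul, ← mul_assoc]
        module
      · rw [hWs 0 h0 t ht q hq, velE_eq_of_cosh (t := φ t) (by rw [hK0, hS.a_eq])
          (by rw [hK0, hS.b_eq]) (by rw [hK0, hS.c_eq]) (by rw [hK0, hS.d_eq])
          (hden 0 h0 t ht q hq)]
    have hmain := hasDerivAt_energy_zero hτ hMc hμ.ae_mem hε hI hab.le habI hW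
      (hfix a ha fun s hs => hK.left s hs) (hfix b hb fun s hs => hK.right s hs) hcrit
    refine hmain.congr_of_eventuallyEq ?_
    filter_upwards [isOpen_Ioo.mem_nhds h0] with s hs
    rw [energy]
    congr 1
    refine intervalIntegral.integral_congr fun t ht => ?_
    rw [uIcc_of_le hab.le] at ht
    refine integral_congr_ae ?_
    filter_upwards [hμ.ae_mem] with q hq
    rw [hWt s hs t (habI ht) q hq]

end Geodesic
-- Inextendibility, finite length and incompleteness.
theorem abs_le_cosh (t : ℝ) : |t| ≤ Real.cosh t := by
  have h1 : |t| ≤ Real.sinh |t| := Real.self_le_sinh_iff.2 (abs_nonneg t)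
  have h2 := Real.sinh_lt_cosh |t|
  rw [Real.cosh_abs] at h2
  linarith

/-- Cauchy–Schwarz against the constant 1, from the nonnegativity of the variance. -/
theorem sq_integral_le {X : Type*} [MeasurableSpace X] {μ : Measure X} [IsFiniteMeasure μ]
    {f : X → ℝ} (hf : Integrable f μ) (hf2 : Integrable (fun x => f x ^ 2) μ) :
    (∫ x, f x ∂μ) ^ 2 ≤ μ.real univ * ∫ x, f x ^ 2 ∂μ := by
  rcases eq_or_ne (μ.real univ) 0 with h0 | h0
  · have : μ = 0 := by
      rw [measureReal_eq_zero_iff] at h0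
      exact Measure.measure_univ_eq_zero.1 h0
    simp [this]
  have hpos : 0 < μ.real univ := lt_of_le_of_ne measureReal_nonneg h0.symm
  set m := (∫ x, f x ∂μ) / μ.real univ with hm
  have h1 : 0 ≤ ∫ x, (f x - m) ^ 2 ∂μ := integral_nonneg fun x => sq_nonneg _
  have h2 : ∫ x, (f x - m) ^ 2 ∂μ
      = ∫ x, f x ^ 2 ∂μ - 2 * m * ∫ x, f x ∂μ + m ^ 2 * μ.real univ := by
    have e : ∀ x, (f x - m) ^ 2 = f x ^ 2 - 2 * m * f x + m ^ 2 := fun x => by ring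
    simp only [e]
    have i1 : Integrable (fun x => f x ^ 2 - 2 * m * f x) μ := hf2.sub (hf.const_mul _)
    rw [integral_add i1 (integrable_const _), integral_sub hf2 (hf.const_mul _),
      integral_const_mul, integral_const, smul_eq_mul, mul_comm (μ.real univ)]
  have h3 : ∫ x, f x ∂μ = m * μ.real univ := by rw [hm]; field_simp
  rw [h2, h3] at h1
  rw [h3]
  nlinarith

section Completeness

variable {𝔸 : Type*} [NormedRing 𝔸] [NormedAlgebra ℝ 𝔸] [CompleteSpace 𝔸]
  [StarRing 𝔸] [StarModule ℝ 𝔸] [FiniteDimensional ℝ 𝔸] {τ : 𝔸 →ₗ[ℝ] ℝ} {M : Set 𝔸}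
  [MeasurableSpace 𝔸] [BorelSpace 𝔸] {μ : Measure 𝔸}
  {E : Type*} [NormedAddCommGroup E] [NormedSpace ℝ E] {β : Blocks E 𝔸} {S : Set E} {Γ : ℝ → E}

theorem IsMobiusModel.not_tendsto (hS : IsMobiusModel β S Γ) (h1 : (1 : 𝔸) ≠ 0) {l : Filter ℝ}
    [l.NeBot] (hl : Tendsto (fun t : ℝ => |t|) l atTop) (g : E) : ¬ Tendsto Γ l (𝓝 g) := by
  intro h
  have h2 : Tendsto (fun t => ‖β.a (Γ t)‖) l (𝓝 ‖β.a g‖) :=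
    ((β.a.continuous.tendsto g).comp h).norm
  have h3 : Tendsto (fun t => ‖β.a (Γ t)‖) l atTop := by
    have e : ∀ t, ‖β.a (Γ t)‖ = Real.cosh t * ‖(1 : 𝔸)‖ := fun t => by
      rw [hS.a_eq, norm_smul, Real.norm_of_nonneg (Real.cosh_pos t).le]
    simp only [e]
    exact (tendsto_atTop_mono abs_le_cosh hl).atTop_mul_const (norm_pos_iff.2 h1)
  exact not_tendsto_nhds_of_tendsto_atTop h3 _ h2

/-- An extension containing an endpoint would be continuous there and would give Γ a limit as t →
±∞, while the norm of its first block is cosh t · ‖1‖. -/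
theorem IsMobiusModel.isInextendible (hS : IsMobiusModel β S Γ) (h1 : (1 : 𝔸) ≠ 0)
    {h σ φ : ℝ → ℝ} {L₁ L₂ : ℝ} (H : IsArcLength h σ φ L₁ L₂) {B : E → E → E → ℝ}
    (hg : IsGeodesic B S (fun s => Γ (φ s)) (Ioo L₁ L₂)) :
    IsInextendibleGeodesic B S (fun s => Γ (φ s)) (Ioo L₁ L₂) := by
  refine ⟨hg, fun I' c' hc' hI' heq => ?_⟩
  have hmid := hI' (H.inv_mem 0)
  have hlim : ∀ (l : Filter ℝ) [l.NeBot] (L : ℝ), Tendsto (fun t : ℝ => |t|) l atTop →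
      Tendsto σ l (𝓝 L) → L ∉ I' := by
    intro l _ L hl hσ hL
    have hcont : ContinuousAt c' L :=
      (hc'.smooth.continuousOn).continuousAt (hc'.interval.1.mem_nhds hL)
    refine hS.not_tendsto h1 hl (c' L) ?_
    refine (hcont.tendsto.comp hσ).congr fun t => ?_
    refine (heq (H.inv_mem t)).trans ?_
    simp only [H.left_inv]
  have hL1 := hlim atBot L₁ tendsto_abs_atBot_atTop H.tendsto_bot
  have hL2 := hlim atTop L₂ tendsto_abs_atTop_atTop H.tendsto_top
  refine Subset.antisymm (fun x hx => ⟨?_, ?_⟩) hI'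
  · by_contra hlt
    exact hL1 (hc'.interval.2.1.out hx hmid ⟨not_lt.1 hlt, (H.inv_mem 0).1.le⟩)
  · by_contra hlt
    exact hL2 (hc'.interval.2.1.out hmid hx ⟨(H.inv_mem 0).2.le, not_lt.1 hlt⟩)

theorem IsMobiusModel.curveLength_lt_top (hS : IsMobiusModel β S Γ) (hτ : IsTrace τ)
    (hM : IsUnitaryModel M) (hμ : IsInvariantOn M μ) (hpos : ∀ t, 0 < speedSq μ t) {σ φ : ℝ → ℝ}
    {L₁ L₂ : ℝ} (H : IsArcLength (speedSq μ) σ φ L₁ L₂) :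
    curveLength (kinE τ β μ) (fun s => Γ (φ s)) (Ioo L₁ L₂) < ⊤ := by
  have h1 : curveLength (kinE τ β μ) (fun s => Γ (φ s)) (Ioo L₁ L₂)
      = ∫⁻ _ in Ioo L₁ L₂, 1 := by
    refine setLIntegral_congr_fun measurableSet_Ioo fun s hs => ?_
    have hd : HasDerivAt (fun s => Γ (φ s)) ((√(speedSq μ (φ s)))⁻¹ • deriv Γ (φ s)) s :=
      ((hS.smooth.differentiable (by simp)) (φ s)).hasDerivAt.scomp s (H.hasDerivAt_inv s hs)
    simp only []
    rw [derivWithin_of_isOpen isOpen_Ioo hs, hd.deriv, kinE_smul, hS.kinE_deriv hτ hM hμ,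
      ← mul_inv, Real.mul_self_sqrt (hpos _).le, inv_mul_cancel₀ (hpos _).ne']
    simp
  rw [h1]
  simp

/-- The arc of Γ from k to l, parametrized affinely by [0, 1], has length |σ l - σ k|. In the proof
e is the sign of l - k. -/
theorem IsMobiusModel.riemDist_le (hS : IsMobiusModel β S Γ) (hτ : IsTrace τ)
    (hM : IsUnitaryModel M) (hμ : IsInvariantOn M μ) {σ φ : ℝ → ℝ}
    {L₁ L₂ : ℝ} (H : IsArcLength (speedSq μ) σ φ L₁ L₂) (k l : ℝ) :
    riemDist (kinE τ β μ) S (Γ k) (Γ l) ≤ ENNReal.ofReal |σ l - σ k| := by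
  have hfin := hμ.finite
  have hsc : Continuous (speedSq μ) :=
    (contDiff_speedSq hτ (hM.isCompact hτ) hM.unitary hμ.ae_mem).continuous
  set p : ℝ → ℝ := fun s => k + s * (l - k) with hp
  have hpd : ∀ s, HasDerivAt p (l - k) s := fun s =>
    (((hasDerivAt_id s).mul_const (l - k)).const_add k).congr_deriv (one_mul _)
  have hpc : ContDiff ℝ ∞ p := by fun_prop
  have hc : ContDiff ℝ ∞ (fun s => Γ (p s)) := hS.smooth.comp hpc
  refine (iInf₂_le (fun s => Γ (p s)) ⟨(hc.of_le (by exact_mod_cast le_top)).contDiffOn,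
    fun s _ => hS.mem _, by simp [hp], by simp [hp]⟩).trans ?_
  obtain ⟨e, he, hle⟩ : ∃ e : ℝ, |e| = 1 ∧ |l - k| = e * (l - k) := by
    rcases le_total 0 (l - k) with h | h
    · exact ⟨1, by simp, by rw [abs_of_nonneg h]; ring⟩
    · exact ⟨-1, by simp, by rw [abs_of_nonpos h]; ring⟩
  have h1 : curveLength (kinE τ β μ) (fun s => Γ (p s)) (Icc 0 1)
      = ∫⁻ s in Icc (0 : ℝ) 1, ENNReal.ofReal (e * ((l - k) * √(speedSq μ (p s)))) := by
    refine setLIntegral_congr_fun measurableSet_Icc fun s hs => ?_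
    have hd : HasDerivAt (fun s => Γ (p s)) ((l - k) • deriv Γ (p s)) s :=
      ((hS.smooth.differentiable (by simp)) (p s)).hasDerivAt.scomp s (hpd s)
    simp only []
    rw [hd.hasDerivWithinAt.derivWithin (uniqueDiffOn_Icc zero_lt_one s hs), kinE_smul,
      hS.kinE_deriv hτ hM hμ, Real.sqrt_mul (mul_self_nonneg _), Real.sqrt_mul_self_eq_abs, hle,
      mul_assoc]
  have hcont : Continuous fun s => e * ((l - k) * √(speedSq μ (p s))) := by fun_prop
  have h2 : ∫ s in (0 : ℝ)..1, e * ((l - k) * √(speedSq μ (p s))) = e * (σ l - σ k) := by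
    have h3 : ∀ s, HasDerivAt (fun s => e * σ (p s)) (e * ((l - k) * √(speedSq μ (p s)))) s := by
      intro s
      refine (((H.hasDerivAt (p s)).comp s (hpd s)).const_mul e).congr_deriv ?_
      ring
    rw [intervalIntegral.integral_eq_sub_of_hasDerivAt (fun s _ => h3 s)
      (hcont.intervalIntegrable _ _)]
    simp only [hp]
    rw [zero_mul, one_mul, add_zero, add_sub_cancel, mul_sub]
  rw [h1, ← ofReal_integral_eq_lintegral_ofReal
    (hcont.continuousOn.integrableOn_compact isCompact_Icc)
    (Eventually.of_forall fun s => by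
      simp only [Pi.zero_apply]
      rw [← mul_assoc, ← hle]; positivity), integral_Icc_eq_integral_Ioc,
    ← intervalIntegral.integral_of_le zero_le_one, h2]
  refine ENNReal.ofReal_le_ofReal ((le_abs_self _).trans ?_)
  rw [abs_mul, he, one_mul]

/-- The mean displacement of the motion `g`. -/
noncomputable def meanTrace (τ : 𝔸 →ₗ[ℝ] ℝ) (β : Blocks E 𝔸) (μ : Measure 𝔸) (g : E) : ℝ :=
  ∫ q, τ (mobE β g q) ∂μ

/-- The explicit formula for the velocity needs only continuity of position and direction, as is
available along C¹ curves. -/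
theorem continuousOn_mobE_velE (hden : ∀ g ∈ S, ∀ q ∈ M, IsUnit (β.c g * q + β.d g)) {Z : Type*}
    [TopologicalSpace Z] {c : Z → E} {c' : Z → E} (hc : Continuous c) (hc' : Continuous c')
    (hcS : ∀ z, c z ∈ S) :
    ContinuousOn (fun p : Z × 𝔸 => mobE β (c p.1) p.2) (univ ×ˢ M) ∧
    ContinuousOn (fun p : Z × 𝔸 => velE β (c p.1) (c' p.1) p.2) (univ ×ˢ M) := by
  have hinv : ContinuousOn
      (fun p : Z × 𝔸 => Ring.inverse (β.c (c p.1) * p.2 + β.d (c p.1))) (univ ×ˢ M) := by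
    intro p hp
    obtain ⟨v, hv⟩ := hden (c p.1) (hcS _) p.2 hp.2
    have h1 : ContinuousAt (Ring.inverse : 𝔸 → 𝔸) (β.c (c p.1) * p.2 + β.d (c p.1)) := by
      rw [← hv]; exact NormedRing.inverse_continuousAt v
    have h2 : Continuous (fun p : Z × 𝔸 => β.c (c p.1) * p.2 + β.d (c p.1)) := by fun_prop
    exact (h1.comp (f := fun p : Z × 𝔸 => β.c (c p.1) * p.2 + β.d (c p.1))
      h2.continuousAt).continuousWithinAt
  have hmob : ContinuousOn (fun p : Z × 𝔸 => mobE β (c p.1) p.2) (univ ×ˢ M) := by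
    have h2 : Continuous (fun p : Z × 𝔸 => β.a (c p.1) * p.2 + β.b (c p.1)) := by fun_prop
    exact h2.continuousOn.mul hinv
  refine ⟨hmob, ?_⟩
  have h3 : Continuous (fun p : Z × 𝔸 => β.a (c' p.1) * p.2 + β.b (c' p.1)) := by fun_prop
  have h4 : Continuous (fun p : Z × 𝔸 => β.c (c' p.1) * p.2 + β.d (c' p.1)) := by fun_prop
  refine ((h3.continuousOn.sub (hmob.mul h4.continuousOn)).mul hinv).congr fun p hp => ?_
  have hu := hden (c p.1) (hcS _) p.2 hp.2
  change _ = (β.a (c' p.1) * p.2 + β.b (c' p.1) - mobE β (c p.1) p.2 *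
    (β.c (c' p.1) * p.2 + β.d (c' p.1))) * Ring.inverse (β.c (c p.1) * p.2 + β.d (c p.1))
  rw [← velE_mul_den (X := c' p.1) hu, mul_assoc, Ring.mul_inverse_cancel _ hu, mul_one]

/-- The mean displacement is Lipschitz for the Riemannian distance. -/
theorem IsMobiusModel.exists_abs_meanTrace_sub_le (hS : IsMobiusModel β S Γ) (hτ : IsTrace τ)
    (hM : IsUnitaryModel M) (hμ : IsInvariantOn M μ) :
    ∃ K : ℝ, 0 ≤ K ∧ ∀ g h ε, 0 ≤ ε → riemDist (kinE τ β μ) S g h < ENNReal.ofReal ε →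
      |meanTrace τ β μ h - meanTrace τ β μ g| ≤ K * ε := by
  have hfin := hμ.finite
  have hMc := hM.isCompact hτ
  have hden : ∀ g ∈ S, ∀ q ∈ M, IsUnit (β.c g * q + β.d g) := fun g hg q hq =>
    hS.isUnit_den hτ hg (hM.unitary q hq)
  let τc : 𝔸 →L[ℝ] ℝ := LinearMap.toContinuousLinearMap τ
  refine ⟨‖(1 : 𝔸)‖ * √(μ.real univ), by positivity, fun g h ε hε hlt => ?_⟩
  simp only [riemDist, iInf_lt_iff] at hlt
  obtain ⟨c, ⟨hc, hcS, rfl, rfl⟩, hlen⟩ := hlt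
  -- Clamping the time to [0, 1] extends the curve and its one-sided derivative continuously to ℝ.
  set r : ℝ → ℝ := fun t => projIcc (0 : ℝ) 1 zero_le_one t with hr
  have hrc : Continuous r := continuous_subtype_val.comp continuous_projIcc
  have hrI : ∀ t, r t ∈ Icc (0 : ℝ) 1 := fun t => (projIcc (0 : ℝ) 1 zero_le_one t).2
  have hrid : ∀ t ∈ Icc (0 : ℝ) 1, r t = t := fun t ht => by
    simp only [hr]; rw [projIcc_of_mem zero_le_one ht]
  set c' : ℝ → E := derivWithin c (Icc 0 1) with hc'
  have hcr : Continuous fun t => c (r t) := hc.continuousOn.comp_continuous hrc hrI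
  have hcr' : Continuous fun t => c' (r t) :=
    (hc.continuousOn_derivWithin (uniqueDiffOn_Icc zero_lt_one) le_rfl).comp_continuous hrc hrI
  obtain ⟨hmob, hvel⟩ := continuousOn_mobE_velE (β := β) hden hcr hcr' fun t => hcS _ (hrI t)
  have slice : ∀ {f : ℝ × 𝔸 → 𝔸}, ContinuousOn f (univ ×ˢ M) → ∀ t,
      ContinuousOn (fun q => f (t, q)) M := fun hf t =>
    hf.comp (f := fun q => (t, q)) (by fun_prop) fun q hq => ⟨mem_univ _, hq⟩
  -- the derivative of the mean displacement along the curve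
  set G : ℝ → ℝ := fun t => ∫ q, τ (velE β (c (r t)) (c' (r t)) q) ∂μ with hG
  have hGc : Continuous G := continuous_iff_continuousAt.2 fun t =>
    continuousAt_integral_of_continuousOn hMc hμ.ae_mem isOpen_univ
      (Ψ := fun t q => τ (velE β (c (r t)) (c' (r t)) q))
      (τc.continuous.comp_continuousOn hvel) (mem_univ t)
  have hFc : Continuous fun t => meanTrace τ β μ (c (r t)) := continuous_iff_continuousAt.2 fun t =>
    continuousAt_integral_of_continuousOn hMc hμ.ae_mem isOpen_univ
      (Ψ := fun t q => τ (mobE β (c (r t)) q))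
      (τc.continuous.comp_continuousOn hmob) (mem_univ t)
  have hF : ∀ t ∈ Ioo (0 : ℝ) 1, HasDerivAt (fun t => meanTrace τ β μ (c (r t))) (G t) t := by
    intro t ht
    refine hasDerivAt_integral_of_continuousOn hMc hμ.ae_mem isOpen_Ioo
      (Ψ := fun t q => τ (mobE β (c (r t)) q))
      (Ψ' := fun t q => τ (velE β (c (r t)) (c' (r t)) q))
      (fun s _ => τc.continuous.comp_continuousOn (slice hmob s))
      (τc.continuous.comp_continuousOn (hvel.mono (prod_mono (subset_univ _) Subset.rfl)))
      (fun s hs q hq => ?_) ht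
    have hnhds : Icc (0 : ℝ) 1 ∈ 𝓝 s := Icc_mem_nhds hs.1 hs.2
    have hsI := Ioo_subset_Icc_self hs
    have h1 : HasDerivAt c (c' s) s :=
      ((hc.differentiableOn one_ne_zero s hsI).hasDerivWithinAt).hasDerivAt hnhds
    have h2 : HasDerivAt (fun t => c (r t)) (c' (r s)) s := by
      rw [hrid s hsI]
      refine h1.congr_of_eventuallyEq ?_
      filter_upwards [hnhds] with t ht
      rw [hrid t ht]
    exact τc.hasFDerivAt.comp_hasDerivAt s
      (hasDerivAt_mobE h2 (hden _ (hcS _ (hrI s)) q hq))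
  have hFTC := intervalIntegral.integral_eq_sub_of_hasDerivAt_of_le zero_le_one hFc.continuousOn hF
    (hGc.intervalIntegrable _ _)
  rw [hrid 0 (by simp), hrid 1 (by simp)] at hFTC
  -- Cauchy–Schwarz twice: over M, giving √μ(M), and for the trace pairing with 1, giving ‖1‖.
  have hGle : ∀ t ∈ Icc (0 : ℝ) 1, ‖G t‖ₑ ≤ ENNReal.ofReal (‖(1 : 𝔸)‖ * √(μ.real univ)) *
      ENNReal.ofReal (√(kinE τ β μ (c t) (c' t) (c' t))) := by
    intro t ht
    rw [← ENNReal.ofReal_mul (by positivity), Real.enorm_eq_ofReal_abs]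
    refine ENNReal.ofReal_le_ofReal ?_
    have hv := slice hvel t
    simp only [hrid t ht] at hv
    have hτv : ContinuousOn (fun q => τ (velE β (c t) (c' t) q)) M :=
      τc.continuous.comp_continuousOn hv
    have h1 : G t ^ 2 ≤ μ.real univ * ∫ q, τ (velE β (c t) (c' t) q) ^ 2 ∂μ := by
      simp only [hG, hrid t ht]
      exact sq_integral_le (integrable_of_continuousOn hMc hμ.ae_mem hτv)
        (integrable_of_continuousOn hMc hμ.ae_mem (hτv.pow 2))
    have h2 : ∫ q, τ (velE β (c t) (c' t) q) ^ 2 ∂μ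
        ≤ ‖(1 : 𝔸)‖ ^ 2 * kinE τ β μ (c t) (c' t) (c' t) := by
      rw [kinE, ← integral_const_mul]
      refine integral_mono (integrable_of_continuousOn hMc hμ.ae_mem (hτv.pow 2))
        (integrable_of_continuousOn hMc hμ.ae_mem ?_) fun q => ?_
      · exact continuousOn_const.mul (((traceForm τ).continuous.comp_continuousOn hv).clm_apply hv)
      · simp only []
        rw [traceForm_apply, hτ.sq, ← mul_pow, ← sq_abs]
        refine pow_le_pow_left₀ (abs_nonneg _) ?_ 2
        simpa using hτ.abs_inner_le 1 (velE β (c t) (c' t) q)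
    refine Real.abs_le_sqrt (h1.trans (mul_le_mul_of_nonneg_left h2 measureReal_nonneg)) |>.trans ?_
    rw [Real.sqrt_mul measureReal_nonneg, Real.sqrt_mul (sq_nonneg _),
      Real.sqrt_sq (norm_nonneg _)]
    exact le_of_eq (by ring)
  have hfinal : ENNReal.ofReal |meanTrace τ β μ (c 1) - meanTrace τ β μ (c 0)|
      ≤ ENNReal.ofReal (‖(1 : 𝔸)‖ * √(μ.real univ) * ε) := by
    rw [← hFTC, intervalIntegral.integral_of_le zero_le_one, ← Real.enorm_eq_ofReal_abs]
    calc ‖∫ t in Ioc (0 : ℝ) 1, G t‖ₑ ≤ ∫⁻ t in Ioc (0 : ℝ) 1, ‖G t‖ₑ :=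
          enorm_integral_le_lintegral_enorm _
      _ ≤ ∫⁻ t in Icc (0 : ℝ) 1, ‖G t‖ₑ := lintegral_mono_set Ioc_subset_Icc_self
      _ ≤ ∫⁻ t in Icc (0 : ℝ) 1, ENNReal.ofReal (‖(1 : 𝔸)‖ * √(μ.real univ)) *
          ENNReal.ofReal (√(kinE τ β μ (c t) (c' t) (c' t))) :=
          setLIntegral_mono' measurableSet_Icc hGle
      _ = ENNReal.ofReal (‖(1 : 𝔸)‖ * √(μ.real univ)) * curveLength (kinE τ β μ) c (Icc 0 1) :=
          lintegral_const_mul' _ _ ENNReal.ofReal_ne_top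
      _ ≤ _ := by
        rw [ENNReal.ofReal_mul (p := ‖(1 : 𝔸)‖ * √(μ.real univ)) (by positivity)]
        exact mul_le_mul_right hlen.le _
  exact (ENNReal.ofReal_le_ofReal_iff (by positivity)).1 hfinal

/-- The points Γ(k) are Cauchy because σ converges, and their mean traces tend to the maximal value
μ(M) τ 1. A limit g would attain it and collapse M to the point 1. -/
theorem IsMobiusModel.not_metricallyComplete (hS : IsMobiusModel β S Γ) (hτ : IsTrace τ)
    (hM : IsUnitaryModel M) (hμ : IsInvariantOn M μ) (hne : ∃ u ∈ M, u ≠ 1)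
    (hlim : Tendsto (moment τ μ 1) atTop (𝓝 (μ.real univ * τ 1))) {σ φ : ℝ → ℝ}
    {L₁ L₂ : ℝ} (H : IsArcLength (speedSq μ) σ φ L₁ L₂) :
    ¬ MetricallyComplete (kinE τ β μ) S := by
  have hfin := hμ.finite
  have hMc := hM.isCompact hτ
  intro hcomp
  have hσ : Tendsto (fun k : ℕ => σ k) atTop (𝓝 L₂) :=
    H.tendsto_top.comp tendsto_natCast_atTop_atTop
  obtain ⟨g, hg, hgl⟩ := hcomp (fun k => Γ k) (fun k => hS.mem _) (by
    intro ε hε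
    obtain ⟨δ, hδ, hδε⟩ := ENNReal.lt_iff_exists_nnreal_btwn.1 hε
    have hδ' : (0 : ℝ) < δ := by exact_mod_cast hδ
    obtain ⟨N, hN⟩ := Metric.cauchySeq_iff.1 hσ.cauchySeq δ hδ'
    refine ⟨N, fun k hk l hl => (hS.riemDist_le hτ hM hμ H k l).trans_lt (lt_trans ?_ hδε)⟩
    rw [← ENNReal.ofReal_coe_nnreal, ENNReal.ofReal_lt_ofReal_iff hδ', ← Real.dist_eq]
    exact hN l hl k hk)
  obtain ⟨K, hK, hKle⟩ := hS.exists_abs_meanTrace_sub_le hτ hM hμ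
  have hmean : ∀ t, meanTrace τ β μ (Γ t) = moment τ μ 1 t := fun t => by
    simp [meanTrace, moment, hS.mobE_eq]
  have h1 : Tendsto (fun k : ℕ => meanTrace τ β μ (Γ k)) atTop (𝓝 (μ.real univ * τ 1)) := by
    simp only [hmean]
    exact hlim.comp tendsto_natCast_atTop_atTop
  have h2 : Tendsto (fun k : ℕ => meanTrace τ β μ (Γ k)) atTop (𝓝 (meanTrace τ β μ g)) := by
    rw [Metric.tendsto_atTop]
    intro ε hε
    set δ := ε / (2 * (K + 1)) with hδ
    have hδpos : 0 < δ := by positivity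
    obtain ⟨N, hN⟩ := eventually_atTop.1
      (hgl.eventually (gt_mem_nhds (ENNReal.ofReal_pos.2 hδpos)))
    refine ⟨N, fun k hk => ?_⟩
    rw [dist_comm, Real.dist_eq]
    refine (hKle _ _ _ hδpos.le (hN k hk)).trans_lt ?_
    calc K * δ ≤ (K + 1) * δ := by gcongr; linarith
      _ = ε / 2 := by rw [hδ]; field_simp
      _ < ε := by linarith
  have h3 := tendsto_nhds_unique h2 h1
  have hsplit := hS.split g hg
  have hmobc : ContinuousOn (fun q => mobE β g q) M := fun q hq =>
    ((contDiffAt_mobE (n := 0) contDiffAt_const contDiffAt_id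
      (hS.isUnit_den hτ hg (hM.unitary q hq))).continuousAt).continuousWithinAt
  -- The integral of ‖1 - g * q‖² = 2 (τ 1 - τ(g * q)) is zero, so the continuous integrand vanishes
  -- on M by the full support of μ.
  have hone : ∀ q ∈ M, mobE β g q = 1 := by
    intro q hq
    by_contra hq1
    have hpos := hμ.integral_pos hMc (f := fun q => ‖1 - mobE β g q‖ ^ 2)
      ((continuousOn_const.sub hmobc).norm.pow 2) (fun _ _ => sq_nonneg _) hq (by
        have : 1 - mobE β g q ≠ 0 := sub_ne_zero.2 (Ne.symm hq1)
        positivity)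
    have h4 : ∫ q, ‖1 - mobE β g q‖ ^ 2 ∂μ = ∫ q, 2 * (τ 1 - τ (mobE β g q)) ∂μ := by
      refine integral_congr_ae ?_
      filter_upwards [hμ.ae_mem] with q hq
      exact hτ.norm_one_sub_sq (hτ.star_mob_mul hsplit (hM.unitary q hq))
    have h5 : ContinuousOn (fun q => τ (mobE β g q)) M :=
      (LinearMap.continuous_of_finiteDimensional τ).comp_continuousOn hmobc
    rw [h4, integral_const_mul, integral_sub (integrable_const _)
      (integrable_of_continuousOn hMc hμ.ae_mem h5),
      integral_const, smul_eq_mul, show ∫ q, τ (mobE β g q) ∂μ = _ from h3, sub_self,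
      mul_zero] at hpos
    exact lt_irrefl _ hpos
  obtain ⟨u, hu, hu1⟩ := hne
  exact hu1 (hτ.mob_injective hsplit (hM.unitary u hu) (hM.unitary 1 hM.one_mem)
    ((hone u hu).trans (hone 1 hM.one_mem).symm))

/-- The abstract form of the theorem. -/
theorem IsMobiusModel.main (hS : IsMobiusModel β S Γ) (hτ : IsTrace τ)
    (hM : IsUnitaryModel M) (hμ : IsInvariantOn M μ) (hcom : HasRealCommutant M)
    (hdec : HasDecay τ μ) (hne : ∃ u ∈ M, u * u ≠ 1) :
    (∃ (I : Set ℝ) (φ : ℝ → ℝ), IsReparametrization φ I ∧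
      IsInextendibleGeodesic (kinE τ β μ) S (fun s => Γ (φ s)) I ∧
      curveLength (kinE τ β μ) (fun s => Γ (φ s)) I < ⊤) ∧
    ¬ GeodesicallyComplete (kinE τ β μ) S ∧ ¬ MetricallyComplete (kinE τ β μ) S ∧
    ∃ t, kinE τ β μ (Γ t) (deriv Γ t) (deriv Γ t) ≠ kinE τ β μ (Γ 0) (deriv Γ 0) (deriv Γ 0) := by
  have hfin := hμ.finite
  have hMc := hM.isCompact hτ
  have hpos := speedSq_pos hτ hMc hM.unitary hμ hne
  have hne1 : ∃ u ∈ M, u ≠ 1 := by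
    obtain ⟨u, hu, h⟩ := hne
    exact ⟨u, hu, fun h1 => h (by rw [h1, one_mul])⟩
  have h10 : (1 : 𝔸) ≠ 0 := by
    obtain ⟨u, -, h⟩ := hne1
    intro h0
    exact h (by rw [← mul_one u, h0, mul_zero])
  have hτ1 : τ 1 ≠ 0 := by
    rw [hτ.norm_one_sq]
    exact pow_ne_zero 2 (norm_ne_zero_iff.2 h10)
  obtain ⟨σ, φ, L₁, L₂, H⟩ := exists_isArcLength
    (contDiff_speedSq hτ hMc hM.unitary hμ.ae_mem) hpos hdec.speed
  have hgeo := hS.isGeodesic hτ hM hμ hcom hpos hτ1 H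
  have hinext := hS.isInextendible h10 H hgeo
  refine ⟨⟨Ioo L₁ L₂, φ, H.isReparametrization hpos, hinext,
    hS.curveLength_lt_top hτ hM hμ hpos H⟩, fun hcomp => ?_,
    hS.not_metricallyComplete hτ hM hμ hne1 hdec.limit H, ?_⟩
  · obtain ⟨c', hc', heq⟩ := hcomp _ _ hgeo
    have h1 := hinext.2 univ c' hc' (subset_univ _) heq
    have h2 : L₁ ∈ Ioo L₁ L₂ := h1 ▸ mem_univ L₁
    exact lt_irrefl _ h2.1
  -- A constant speed would have to be zero by the decay, but the speed is positive.
  · by_contra hconst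
    push Not at hconst
    simp only [hS.kinE_deriv hτ hM hμ] at hconst
    obtain ⟨C, a, ha, hC⟩ := hdec.speed
    have h1 : Tendsto (fun t : ℝ => C * Real.exp (-a * |t|)) atTop (𝓝 (C * 0)) := by
      refine (Real.tendsto_exp_atBot.comp ?_).const_mul C
      exact tendsto_abs_atTop_atTop.const_mul_atTop_of_neg (by linarith)
    have h2 : speedSq μ 0 ≤ C * 0 := by
      refine ge_of_tendsto h1 (Eventually.of_forall fun t => ?_)
      rw [← hconst t]; exact hC t
    rw [mul_zero] at h2
    exact absurd (hpos 0) (not_lt.2 h2)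

end Completeness
-- Rational curves in M, and determinants along them.
section RationalCurve

theorem isPolyFun_const (D : ℕ) (c : ℝ) : IsPolyFun D fun _ => c :=
  ⟨Polynomial.C c, by simp, by simp⟩

theorem IsPolyFun.add {D : ℕ} {f g : ℝ → ℝ} (hf : IsPolyFun D f) (hg : IsPolyFun D g) :
    IsPolyFun D fun s => f s + g s := by
  obtain ⟨p, hp, hfp⟩ := hf
  obtain ⟨q, hq, hgq⟩ := hg
  exact ⟨p + q, Polynomial.natDegree_add_le_of_degree_le hp hq, fun s => by
    simp only [hfp, hgq, Polynomial.eval_add]⟩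

theorem IsPolyFun.mul {D D' : ℕ} {f g : ℝ → ℝ} (hf : IsPolyFun D f) (hg : IsPolyFun D' g) :
    IsPolyFun (D + D') fun s => f s * g s := by
  obtain ⟨p, hp, hfp⟩ := hf
  obtain ⟨q, hq, hgq⟩ := hg
  exact ⟨p * q, Polynomial.natDegree_mul_le_of_le hp hq, fun s => by
    simp only [hfp, hgq, Polynomial.eval_mul]⟩

theorem IsPolyFun.mul_const {D : ℕ} {f : ℝ → ℝ} (hf : IsPolyFun D f) (c : ℝ) :
    IsPolyFun D fun s => f s * c := by
  simpa using hf.mul (isPolyFun_const 0 c)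

theorem IsPolyFun.sum {ι : Type*} (S : Finset ι) {D : ℕ} {f : ι → ℝ → ℝ}
    (h : ∀ i ∈ S, IsPolyFun D (f i)) : IsPolyFun D fun s => ∑ i ∈ S, f i s := by
  classical
  induction S using Finset.induction_on with
  | empty => simpa using isPolyFun_const D 0
  | insert i S hi ih =>
    simp only [Finset.sum_insert hi]
    exact (h i (Finset.mem_insert_self i S)).add
      (ih fun j hj => h j (Finset.mem_insert_of_mem hj))

theorem IsPolyFun.prod {ι : Type*} (S : Finset ι) {D : ℕ} {f : ι → ℝ → ℝ}
    (h : ∀ i ∈ S, IsPolyFun D (f i)) : IsPolyFun (S.card * D) fun s => ∏ i ∈ S, f i s := by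
  classical
  induction S using Finset.induction_on with
  | empty => simpa using isPolyFun_const 0 1
  | insert i S hi ih =>
    simp only [Finset.prod_insert hi]
    rw [Finset.card_insert_of_notMem hi, Nat.succ_mul, Nat.add_comm]
    exact (h i (Finset.mem_insert_self i S)).mul
      (ih fun j hj => h j (Finset.mem_insert_of_mem hj))

theorem IsPolyFun.det {m : Type*} [Fintype m] [DecidableEq m] {D : ℕ} {A : ℝ → Matrix m m ℝ}
    (h : ∀ i j, IsPolyFun D fun s => A s i j) : IsPolyFun (Fintype.card m * D) fun s => (A s).det := by
  simp only [Matrix.det_apply']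
  exact IsPolyFun.sum _ fun σ _ => by
    simpa [mul_comm] using (IsPolyFun.prod Finset.univ fun i _ => h (σ i) i).mul_const
      ((Equiv.Perm.sign σ : ℤ) : ℝ)

variable {𝔸 : Type*} [NormedRing 𝔸] [NormedAlgebra ℝ 𝔸] [FiniteDimensional ℝ 𝔸] {M : Set 𝔸}

/-- `κ` is a curve in `M` with `κ 0 = 1`, rational with denominator `d`. -/
structure IsRationalCurve (M : Set 𝔸) (κ : ℝ → 𝔸) (D : ℕ) (d : ℝ → ℝ) : Prop where
  cont : Continuous κ
  zero : κ 0 = 1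
  mem : ∀ s, κ s ∈ M
  cont_factor : Continuous d
  pos : ∀ s, 0 < d s
  factor : IsPolyFun D d
  poly : ∀ ℓ : 𝔸 →ₗ[ℝ] ℝ, IsPolyFun D fun s => d s * ℓ (κ s)

theorem isRationalCurve_one (h : (1 : 𝔸) ∈ M) : IsRationalCurve M (fun _ => 1) 0 fun _ => 1 where
  cont := continuous_const
  zero := rfl
  mem _ := h
  cont_factor := continuous_const
  pos _ := one_pos
  factor := isPolyFun_const 0 1
  poly _ := isPolyFun_const 0 _

theorem IsRationalCurve.mul (hM : ∀ u ∈ M, ∀ v ∈ M, u * v ∈ M) {κ κ' : ℝ → 𝔸} {D D' : ℕ}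
    {d d' : ℝ → ℝ} (h : IsRationalCurve M κ D d) (h' : IsRationalCurve M κ' D' d') :
    IsRationalCurve M (fun s => κ s * κ' s) (D + D') fun s => d s * d' s where
  cont := h.cont.mul h'.cont
  zero := by rw [h.zero, h'.zero, one_mul]
  mem s := hM _ (h.mem s) _ (h'.mem s)
  cont_factor := h.cont_factor.mul h'.cont_factor
  pos s := mul_pos (h.pos s) (h'.pos s)
  factor := h.factor.mul h'.factor
  poly ℓ := by
    let b := Module.finBasis ℝ 𝔸
    have e : ∀ s, d s * d' s * ℓ (κ s * κ' s) = ∑ i, ∑ j,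
        (d s * b.coord i (κ s)) * (d' s * b.coord j (κ' s)) * ℓ (b i * b j) := by
      intro s
      conv_lhs => rw [← b.sum_repr (κ s), ← b.sum_repr (κ' s)]
      simp only [Finset.sum_mul, Finset.mul_sum, map_sum, smul_mul_assoc, mul_smul_comm, map_smul,
        smul_eq_mul, Module.Basis.coord_apply]
      rw [Finset.sum_comm]
      exact Finset.sum_congr rfl fun i _ => Finset.sum_congr rfl fun j _ => by ring
    simp only [e]
    exact IsPolyFun.sum _ fun i _ => IsPolyFun.sum _ fun j _ =>
      ((h.poly (b.coord i)).mul (h'.poly (b.coord j))).mul_const _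

/-- Multiplying each row by the denominator d makes the entries polynomial, hence also the
determinant, which acquires the factor d to the size of the matrix. -/
theorem IsRationalCurve.isPolyCurve {κ : ℝ → 𝔸} {D : ℕ} {d : ℝ → ℝ} (h : IsRationalCurve M κ D d)
    {m : Type*} [Fintype m] [DecidableEq m] (A : Matrix m m ℝ) (Λ : 𝔸 →ₗ[ℝ] Matrix m m ℝ) :
    IsPolyCurve M (fun v => (A + Λ v).det) κ (Fintype.card m * D)
      fun s => d s ^ Fintype.card m where
  cont := h.cont
  zero := h.zero
  mem := h.mem
  cont_factor := h.cont_factor.pow _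
  pos s := pow_pos (h.pos s) _
  poly v := by
    simp only [← Matrix.det_smul]
    refine IsPolyFun.det fun i j => ?_
    have h1 := h.poly ((Matrix.entryLinearMap ℝ ℝ i j).comp (Λ.comp (LinearMap.mulRight ℝ v)))
    have h2 := (h.factor.mul_const (A i j)).add h1
    simpa [mul_add] using h2

theorem IsRationalCurve.isPolyCurve_norm {κ : ℝ → 𝔸} {D : ℕ} {d : ℝ → ℝ}
    (h : IsRationalCurve M κ D d) :
    ∃ D' d', IsPolyCurve M (fun v => Algebra.norm ℝ (1 + v)) κ D' d' := by
  classical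
  let b := Module.finBasis ℝ 𝔸
  have h1 := h.isPolyCurve 1 (Algebra.leftMulMatrix b).toLinearMap
  have e : (fun v => Algebra.norm ℝ (1 + v))
      = fun v => (1 + (Algebra.leftMulMatrix b).toLinearMap v).det := by
    funext v
    rw [Algebra.norm_eq_matrix_det b, map_add, map_one]
    rfl
  rw [e]
  exact ⟨_, _, h1⟩

variable [StarRing 𝔸] [StarModule ℝ 𝔸]

/-- `P` is an orthogonal projection, and `J` is a complex structure on its range. -/
structure IsRotationPair (P J : 𝔸) : Prop where
  star_P : star P = P
  star_J : star J = -J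
  PP : P * P = P
  PJ : P * J = J
  JP : J * P = J
  JJ : J * J = -P

theorem IsRotationPair.star_mul {P J : 𝔸} (h : IsRotationPair P J) (c s : ℝ) (hcs : c ^ 2 + s ^ 2 = 1) :
    star (1 - P + c • P + s • J) * (1 - P + c • P + s • J) = 1 := by
  have e : star (1 - P + c • P + s • J) = 1 - P + c • P - s • J := by
    simp [h.star_P, h.star_J, sub_eq_add_neg]
  rw [e]
  simp only [mul_add, add_mul, mul_sub, sub_mul, smul_mul_assoc, mul_smul_comm, h.PP, h.PJ, h.JP,
    h.JJ, one_mul, mul_one]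
  have e2 : (1 : 𝔸) = 1 - P + (c ^ 2 + s ^ 2) • P := by rw [hcs]; simp
  conv_rhs => rw [e2]
  module

theorem IsRotationPair.sq {P J : 𝔸} (h : IsRotationPair P J) (c s : ℝ) :
    (1 - P + c • P + s • J) * (1 - P + c • P + s • J)
      = 1 - P + (c ^ 2 - s ^ 2) • P + (2 * c * s) • J := by
  simp only [mul_add, add_mul, mul_sub, sub_mul, smul_mul_assoc, mul_smul_comm, h.PP, h.PJ, h.JP,
    h.JJ, one_mul, mul_one]
  module

/-- The rotation by `π` in the range of `P` is joined to `1` by a rational curve. -/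
theorem IsRotationPair.exists_isRationalCurve {P J : 𝔸} (h : IsRotationPair P J)
    (hM : ∀ u : 𝔸, star u * u = 1 → u * u ∈ M) :
    ∃ κ D d, IsRationalCurve M κ D d ∧ κ 1 = 1 - (2 : ℝ) • P := by
  -- Half-angle parametrization: the direction (1 - s, s) turns from angle 0 to π/2, and its double
  -- angle, from 0 to π, has cosine and sine rational in s with denominator d.
  set d : ℝ → ℝ := fun s => (1 - s) ^ 2 + s ^ 2 with hd
  have hpos : ∀ s, 0 < d s := fun s => by
    simp only [hd]; nlinarith [sq_nonneg (2 * s - 1)]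
  have hdc : Continuous d := by fun_prop
  set κ : ℝ → 𝔸 := fun s => 1 - P + (((1 - s) ^ 2 - s ^ 2) / d s) • P
    + ((2 * (1 - s) * s) / d s) • J with hκ
  have hpoly : ∀ a b c : ℝ, IsPolyFun 2 fun s => a + b * s + c * s ^ 2 := fun a b c =>
    ⟨Polynomial.C a + Polynomial.C b * Polynomial.X + Polynomial.C c * Polynomial.X ^ 2,
      by compute_degree, by simp⟩
  refine ⟨κ, 2, d, ⟨?_, ?_, fun s => ?_, hdc, hpos, ?_, fun ℓ => ?_⟩, ?_⟩
  · refine (continuous_const.add ((Continuous.div (by fun_prop) hdc fun s => (hpos s).ne').smul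
      continuous_const)).add ((Continuous.div (by fun_prop) hdc fun s => (hpos s).ne').smul
      continuous_const)
  · simp [hκ, hd]
  -- The rotation is the square of the rotation by the half angle. Squares of unitary elements lie
  -- in M by `hM`, so no determinant has to be computed.
  · set r := √(d s)
    have hr : r * r = d s := Real.mul_self_sqrt (hpos s).le
    have hr0 : r ≠ 0 := (Real.sqrt_pos.2 (hpos s)).ne'
    have e : κ s = (1 - P + ((1 - s) / r) • P + (s / r) • J)
        * (1 - P + ((1 - s) / r) • P + (s / r) • J) := by
      rw [h.sq, hκ]
      simp only []
      rw [← hr]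
      congr 3
      · field_simp
      · field_simp
    rw [e]
    refine hM _ (h.star_mul _ _ ?_)
    rw [div_pow, div_pow, ← add_div, pow_two r, hr]
    exact div_self (hpos s).ne'
  · have e : d = fun s => 1 + (-2) * s + 2 * s ^ 2 := by funext s; simp only [hd]; ring
    rw [e]; exact hpoly _ _ _
  · have e : (fun s => d s * ℓ (κ s)) = fun s => ℓ 1 + (-2 * ℓ 1 + 2 * ℓ J) * s
        + (2 * ℓ 1 - 2 * ℓ P - 2 * ℓ J) * s ^ 2 := by
      funext s
      have h1 := (hpos s).ne'
      have h2 : d s * ℓ (κ s) = d s * (ℓ 1 - ℓ P) + ((1 - s) ^ 2 - s ^ 2) * ℓ P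
          + (2 * (1 - s) * s) * ℓ J := by
        simp only [hκ, map_add, map_sub, map_smul, smul_eq_mul]
        field_simp
      rw [h2]; simp only [hd]; ring
    rw [e]; exact hpoly _ _ _
  · simp only [hκ, hd]
    norm_num
    module

end RationalCurve
-- The scalars ℝ, ℂ, ℍ and their matrix algebras.
/-- The properties of the scalars `ℝ`, `ℂ`, `ℍ` that are used. -/
class MobiusScalars (F : Type*) [NormedDivisionRing F] [StarRing F] [InnerProductSpace ℝ F] :
    Prop where
  smul_mul (r : ℝ) (x y : F) : r • x * y = r • (x * y)
  mul_smul (r : ℝ) (x y : F) : x * r • y = r • (x * y)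
  finite : FiniteDimensional ℝ F
  star_smul (r : ℝ) (x : F) : star (r • x) = r • star x
  inner_eq (x y : F) : inner ℝ x y = rePart (star x * y)
  rePart_mul_comm (x y : F) : rePart (x * y) = rePart (y * x)
  rePart_star (x : F) : rePart (star x) = rePart x
  selfAdjoint (x : F) : star x = x → ∃ r : ℝ, x = r • 1

instance : MobiusScalars ℝ where
  smul_mul r x y := by simp [mul_assoc]
  mul_smul r x y := by simp; ring
  finite := inferInstance
  star_smul r x := by simp
  inner_eq x y := by rw [rePart_real]; simp [mul_comm]
  rePart_mul_comm x y := by rw [mul_comm]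
  rePart_star x := by simp
  selfAdjoint x _ := ⟨x, by simp⟩

instance : MobiusScalars ℂ where
  smul_mul r x y := by simp [mul_assoc]
  mul_smul r x y := by simp; ring
  finite := inferInstance
  star_smul r x := by simp
  inner_eq x y := by rw [rePart_complex]; simp [Complex.inner]; ring
  rePart_mul_comm x y := by rw [mul_comm]
  rePart_star x := by simp [rePart_complex]
  selfAdjoint x h := ⟨x.re, by
    have := Complex.conj_eq_iff_re.1 h
    simp [this]⟩

instance : MobiusScalars ℍ[ℝ] where
  smul_mul r x y := by simp
  mul_smul r x y := by simp
  finite := inferInstance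
  star_smul r x := by simp
  inner_eq x y := by
    rw [rePart_quaternion, Quaternion.inner_def]
    simp [Quaternion.re_mul]
  rePart_mul_comm x y := by
    rw [rePart_quaternion, rePart_quaternion]
    simp only [Quaternion.re_mul]; ring
  rePart_star x := by simp [rePart_quaternion]
  selfAdjoint x h := ⟨x.re, by
    have h1 := Quaternion.star_eq_self.1 h
    nth_rewrite 1 [h1]
    ext <;> simp⟩

section MatrixAlgebra

variable {F : Type*} [NormedDivisionRing F] [StarRing F] [InnerProductSpace ℝ F]

theorem frobenius_norm_sq {m n : Type*} [Fintype m] [Fintype n] (A : Matrix m n F) :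
    ‖A‖ ^ 2 = ∑ i, ∑ j, ‖A i j‖ ^ 2 := by
  have h0 : 0 ≤ ∑ i, ∑ j, ‖A i j‖ ^ (2 : ℝ) := by positivity
  rw [Matrix.frobenius_norm_def, ← Real.rpow_natCast, ← Real.rpow_mul h0]
  norm_num

theorem frobenius_norm_mul_le {l m n : Type*} [Fintype l] [Fintype m] [Fintype n]
    (A : Matrix l m F) (B : Matrix m n F) : ‖A * B‖ ≤ ‖A‖ * ‖B‖ := by
  refine le_of_sq_le_sq ?_ (by positivity)
  rw [mul_pow, frobenius_norm_sq, frobenius_norm_sq, frobenius_norm_sq, Finset.sum_mul]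
  refine Finset.sum_le_sum fun i _ => ?_
  rw [Finset.sum_comm (f := fun i j => ‖B i j‖ ^ 2), Finset.mul_sum]
  refine Finset.sum_le_sum fun j _ => ?_
  calc ‖(A * B) i j‖ ^ 2 ≤ (∑ k, ‖A i k‖ * ‖B k j‖) ^ 2 := by
        refine pow_le_pow_left₀ (norm_nonneg _) ?_ 2
        rw [Matrix.mul_apply]
        refine (norm_sum_le _ _).trans (le_of_eq ?_)
        simp
    _ ≤ _ := Finset.sum_mul_sq_le_sq_mul_sq _ _ _

/-- The normed ring of matrices with the Frobenius norm. -/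
@[reducible] noncomputable def matRing (m : Type*) [Fintype m] [DecidableEq m] :
    NormedRing (Matrix m m F) :=
  { Matrix.frobeniusSeminormedAddCommGroup, Matrix.instRing with
    norm_mul_le := frobenius_norm_mul_le
    eq_of_dist_eq_zero := eq_of_dist_eq_zero }

attribute [local instance] matRing

variable [MobiusScalars F] {n : ℕ}

/-- The normed algebra of matrices with the Frobenius norm. -/
@[reducible] noncomputable def matAlgebra (F : Type*) [NormedDivisionRing F] [StarRing F]
    [InnerProductSpace ℝ F] [MobiusScalars F] (m : Type*) [Fintype m] [DecidableEq m] :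
    NormedAlgebra ℝ (Matrix m m F) :=
  { Algebra.ofModule (R := ℝ) (A := Matrix m m F)
      (fun r x y => by
        ext i j
        simp [Matrix.mul_apply, MobiusScalars.smul_mul, Finset.smul_sum])
      (fun r x y => by
        ext i j
        simp [Matrix.mul_apply, MobiusScalars.mul_smul, Finset.smul_sum]) with
    norm_smul_le := fun r x => norm_smul_le r x }

attribute [local instance] matAlgebra

attribute [local instance] MobiusScalars.finite

instance finiteDimensional_mat : FiniteDimensional ℝ (Mat F n) :=
  inferInstanceAs (Module.Finite ℝ (Matrix (Fin n) (Fin n) F))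

instance starModule_mat : StarModule ℝ (Mat F n) where
  star_smul r x := by
    ext i j
    simp [Matrix.star_apply, MobiusScalars.star_smul]

theorem rePart_add (x y : F) : rePart (x + y) = rePart x + rePart y := inner_add_right _ _ _

theorem rePart_smul (r : ℝ) (x : F) : rePart (r • x) = r * rePart x := inner_smul_right _ _ _

theorem rePart_sum {ι : Type*} (S : Finset ι) (f : ι → F) :
    rePart (∑ i ∈ S, f i) = ∑ i ∈ S, rePart (f i) := inner_sum _ _ _

/-- The real part of the trace. -/
noncomputable def reTrace (F : Type*) [NormedDivisionRing F] [StarRing F]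
    [InnerProductSpace ℝ F] [MobiusScalars F] (n : ℕ) : Mat F n →ₗ[ℝ] ℝ where
  toFun A := rePart A.trace
  map_add' A B := by rw [Matrix.trace_add, rePart_add]
  map_smul' r A := by rw [Matrix.trace_smul, rePart_smul]; rfl

theorem reTrace_apply (A : Mat F n) : reTrace F n A = ∑ i, rePart (A i i) := rePart_sum _ _

theorem isTrace_reTrace : IsTrace (reTrace F n) where
  comm x y := by
    simp only [reTrace_apply, Matrix.mul_apply, rePart_sum]
    rw [Finset.sum_comm]
    exact Finset.sum_congr rfl fun i _ => Finset.sum_congr rfl fun j _ =>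
      MobiusScalars.rePart_mul_comm _ _
  map_star x := by
    simp only [reTrace_apply, Matrix.star_apply, MobiusScalars.rePart_star]
  sq x := by
    rw [frobenius_norm_sq, Finset.sum_comm]
    simp only [reTrace_apply, Matrix.mul_apply, rePart_sum, Matrix.star_apply]
    refine Finset.sum_congr rfl fun i _ => Finset.sum_congr rfl fun j _ => ?_
    rw [← MobiusScalars.inner_eq, real_inner_self_eq_norm_sq]

theorem finrank_skew : Module.finrank ℝ (skew (Mat F n)) = unitaryDim F n := by
  have h : ({X : Mat F n | Xᴴ = -X} : Set (Mat F n)) = (skew (Mat F n) : Set (Mat F n)) := rfl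
  rw [unitaryDim, Set.finrank, h, Submodule.span_eq]

theorem isUnit_of_mulVec {A : Mat F n} (h : ∀ x, A *ᵥ x = 0 → x = 0) : IsUnit A := by
  refine isUnit_of_mul_eq_zero fun Y hY => ?_
  ext i j
  have h1 := h (fun k => Y k j) (by
    funext i
    exact congrFun (congrFun hY i) j)
  exact congrFun h1 i

end MatrixAlgebra
-- Sign matrices, plane rotations and the commutant.
section Signs

attribute [local instance] matRing matAlgebra MobiusScalars.finite

variable {F : Type*} [NormedDivisionRing F] [StarRing F] [InnerProductSpace ℝ F] [MobiusScalars F]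
  {n : ℕ}

/-- The entries of `ε` are `±1`. -/
def IsSigns (ε : Fin n → F) : Prop := ∀ i, ε i = 1 ∨ ε i = -1

theorem IsSigns.mul_self {ε : Fin n → F} (h : IsSigns ε) (i : Fin n) : ε i * ε i = 1 := by
  rcases h i with h | h <;> simp [h]

theorem IsSigns.star_eq {ε : Fin n → F} (h : IsSigns ε) (i : Fin n) : star (ε i) = ε i := by
  rcases h i with h | h <;> simp [h]

theorem IsSigns.diagonal_mul_self {ε : Fin n → F} (h : IsSigns ε) :
    Matrix.diagonal ε * Matrix.diagonal ε = 1 := by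
  rw [Matrix.diagonal_mul_diagonal, ← Matrix.diagonal_one]
  congr 1
  funext i
  exact h.mul_self i

theorem IsSigns.star_diagonal {ε : Fin n → F} (h : IsSigns ε) :
    star (Matrix.diagonal ε) = Matrix.diagonal ε := by
  rw [Matrix.star_eq_conjTranspose, Matrix.diagonal_conjTranspose]
  congr 1
  funext i
  exact h.star_eq i

theorem two_ne_zero_scalars : (2 : F) ≠ 0 := by
  intro h
  have h1 : (2 : ℝ) • (1 : F) = 0 := by rw [two_smul, one_add_one_eq_two, h]
  rcases smul_eq_zero.1 h1 with h | h
  · norm_num at h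
  · exact one_ne_zero h

/-- The matrix whose columns with index in `T` are those of `A + diag ε`, and whose other
columns are those of the identity. -/
def signColumns (A : Mat F n) (T : Finset (Fin n)) (ε : Fin n → F) : Mat F n := fun i j =>
  if j ∈ T then A i j + (if i = j then ε j else 0) else if i = j then 1 else 0

/-- Columns are replaced one at a time. If both signs failed at column k, the relations By = -A_k
and Bz = 2e_k - A_k would hold with y_k = z_k = 1. As Be_k = e_k, injectivity of B gives z - y =
2e_k, a contradiction in coordinate k. No determinant is used, so ℍ is included. -/
theorem exists_isUnit_signColumns (A : Mat F n) (T : Finset (Fin n)) :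
    ∃ ε : Fin n → F, IsSigns ε ∧ IsUnit (signColumns A T ε) := by
  classical
  induction T using Finset.induction_on with
  | empty =>
    refine ⟨fun _ => 1, fun _ => Or.inl rfl, ?_⟩
    have : signColumns A ∅ (fun _ => 1) = 1 := by
      ext i j; simp [signColumns, Matrix.one_apply]
    rw [this]; exact isUnit_one
  | insert k T hk ih =>
    obtain ⟨ε, hε, hu⟩ := ih
    set B := signColumns A T ε with hB
    have hinj : ∀ x y, B *ᵥ x = B *ᵥ y → x = y := by
      intro x y hxy
      obtain ⟨C, hC⟩ := hu.exists_left_inv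
      rw [← Matrix.one_mulVec x, ← Matrix.one_mulVec y, ← hC, ← Matrix.mulVec_mulVec, hxy,
        Matrix.mulVec_mulVec]
    have key : ∀ s : F, ¬ IsUnit (signColumns A (insert k T) (Function.update ε k s)) →
        ∃ y, y k = 1 ∧ ∀ i, (B *ᵥ y) i
          = (if i = k then 1 else 0) - (A i k + (if i = k then s else 0)) := by
      intro s hs
      have h1 : ∃ x, signColumns A (insert k T) (Function.update ε k s) *ᵥ x = 0 ∧ x ≠ 0 := by
        by_contra h
        push Not at h
        exact hs (isUnit_of_mulVec h)
      obtain ⟨x, hx, hx0⟩ := h1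
      have h2 : ∀ i, (B *ᵥ x) i
          = ((if i = k then 1 else 0) - (A i k + (if i = k then s else 0))) * x k := by
        intro i
        have h3 := congrFun hx i
        have h4 : ∀ j, signColumns A (insert k T) (Function.update ε k s) i j
            = B i j - (if j = k then
              (if i = k then 1 else 0) - (A i k + (if i = k then s else 0)) else 0) := by
          intro j
          rcases eq_or_ne j k with rfl | hj
          · simp [signColumns, hB, hk]
          · simp [signColumns, hB, hj]
        have h6 : ∑ j, signColumns A (insert k T) (Function.update ε k s) i j * x j = 0 := h3
        simp only [h4, sub_mul, Finset.sum_sub_distrib, ite_mul, zero_mul, Finset.sum_ite_eq',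
          Finset.mem_univ, if_true] at h6
        change ∑ j, B i j * x j = _
        rw [sub_eq_zero.1 h6]
        simp only [sub_mul, ite_mul, zero_mul]
      have hxk : x k ≠ 0 := by
        intro h0
        apply hx0
        apply hinj
        funext i
        rw [h2, h0, mul_zero, Matrix.mulVec_zero, Pi.zero_apply]
      refine ⟨fun j => x j * (x k)⁻¹, mul_inv_cancel₀ hxk, fun i => ?_⟩
      calc (B *ᵥ fun j => x j * (x k)⁻¹) i = (B *ᵥ x) i * (x k)⁻¹ := by
            simp only [Matrix.mulVec, dotProduct, Finset.sum_mul, mul_assoc]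
        _ = _ := by rw [h2, mul_assoc, mul_inv_cancel₀ hxk, mul_one]
    by_contra hcon
    push Not at hcon
    have hsg : ∀ s : F, s = 1 ∨ s = -1 → IsSigns (Function.update ε k s) := by
      intro s hs i
      rcases eq_or_ne i k with rfl | hi
      · simpa using hs
      · simpa [Function.update_of_ne hi] using hε i
    obtain ⟨y, hyk, hy⟩ := key 1 (hcon _ (hsg 1 (Or.inl rfl)))
    obtain ⟨z, hzk, hz⟩ := key (-1) (hcon _ (hsg (-1) (Or.inr rfl)))
    have h5 : B *ᵥ (Pi.single k 2) = fun i => if i = k then 2 else 0 := by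
      funext i
      simp [Matrix.mulVec, dotProduct, hB, signColumns, hk, Pi.single_apply]
    have h6 : B *ᵥ (z - y) = B *ᵥ (Pi.single k 2) := by
      rw [h5]
      funext i
      rw [Matrix.mulVec_sub, Pi.sub_apply, hz, hy]
      split_ifs
      · rw [← one_add_one_eq_two]; abel
      · abel
    have h7 := congrFun (hinj _ _ h6) k
    rw [Pi.sub_apply, hzk, hyk, sub_self, Pi.single_eq_same] at h7
    exact two_ne_zero_scalars h7.symm

theorem exists_isUnit_diagonal_add (A : Mat F n) :
    ∃ ε : Fin n → F, IsSigns ε ∧ IsUnit (Matrix.diagonal ε + A) := by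
  obtain ⟨ε, hε, h⟩ := exists_isUnit_signColumns A Finset.univ
  refine ⟨ε, hε, ?_⟩
  have e : signColumns A Finset.univ ε = Matrix.diagonal ε + A := by
    ext i j
    rw [Matrix.add_apply, Matrix.diagonal_apply, add_comm]
    rcases eq_or_ne i j with rfl | hij
    · simp [signColumns]
    · simp [signColumns, hij]
  rwa [← e]

theorem IsSigns.isUnit_one_add {ε : Fin n → F} (hε : IsSigns ε) {A : Mat F n}
    (h : IsUnit (Matrix.diagonal ε + A)) : IsUnit (1 + Matrix.diagonal ε * A) := by
  have e : 1 + Matrix.diagonal ε * A = Matrix.diagonal ε * (Matrix.diagonal ε + A) := by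
    rw [mul_add, hε.diagonal_mul_self]
  rw [e]
  exact (isUnit_of_mul_eq_one hε.diagonal_mul_self).mul h

/-- The projection onto the coordinate plane of `i` and `j`. -/
def planeProj (F : Type*) [NormedDivisionRing F] (i j : Fin n) : Mat F n :=
  Matrix.single i i 1 + Matrix.single j j 1

/-- The rotation by a right angle in the coordinate plane of `i` and `j`. -/
def planeRot (F : Type*) [NormedDivisionRing F] (i j : Fin n) : Mat F n :=
  Matrix.single i j 1 - Matrix.single j i 1

theorem isRotationPair_plane {i j : Fin n} (hij : i ≠ j) :
    IsRotationPair (planeProj F i j) (planeRot F i j) := by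
  constructor <;>
    simp [planeProj, planeRot, Matrix.star_eq_conjTranspose, Matrix.conjTranspose_single, mul_add,
      add_mul, hij, hij.symm, sub_eq_add_neg, add_comm]

theorem one_sub_two_planeProj_mul {i j : Fin n} (hij : i ≠ j) (ε : Fin n → F) :
    (1 - (2 : ℝ) • planeProj F i j) * Matrix.diagonal ε
      = Matrix.diagonal fun k => if k = i ∨ k = j then -ε k else ε k := by
  have e : 1 - (2 : ℝ) • planeProj F i j
      = Matrix.diagonal fun k => if k = i ∨ k = j then -1 else 1 := by
    ext a b
    rw [Matrix.sub_apply, Matrix.smul_apply, planeProj, Matrix.add_apply, Matrix.single_apply,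
      Matrix.single_apply, Matrix.one_apply, Matrix.diagonal_apply, two_smul]
    rcases eq_or_ne a b with rfl | hab
    · rcases eq_or_ne a i with rfl | hai
      · simp [hij, hij.symm]
      · rcases eq_or_ne a j with rfl | haj
        · simp [hij, hij.symm]
        · simp [hai, haj, hai.symm, haj.symm]
    · have h1 : ∀ c, ¬ (c = a ∧ c = b) := fun c h => hab (h.1.symm.trans h.2)
      simp [hab, h1]
  rw [e, Matrix.diagonal_mul_diagonal]
  congr 1
  funext k
  split_ifs <;> simp

/-- A quarter turn is the square of an eighth turn, which places it in SO_n. -/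
theorem IsRotationPair.quarter_sq {P J : Mat F n} (h : IsRotationPair P J) :
    ∃ u : Mat F n, star u * u = 1 ∧ u * u = 1 - P + J := by
  have h2 : (√2 / 2 : ℝ) ^ 2 = 1 / 2 := by
    rw [div_pow, Real.sq_sqrt (by norm_num)]; norm_num
  refine ⟨1 - P + (√2 / 2 : ℝ) • P + (√2 / 2 : ℝ) • J, h.star_mul _ _ (by rw [h2]; norm_num), ?_⟩
  rw [h.sq, h2, mul_assoc, ← pow_two, h2]
  norm_num

/-- A sign matrix with different signs at i and j forces the entry at (i, j) to vanish; quarter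
turns equate the diagonal entries; a self-adjoint scalar is real. -/
theorem hasRealCommutant_of_signs {M : Set (Mat F n)}
    (hs : ∀ i j : Fin n, i ≠ j → ∃ ε : Fin n → F, Matrix.diagonal ε ∈ M ∧ ε i = -1 ∧ ε j = 1)
    (hr : ∀ i j : Fin n, i ≠ j → 1 - planeProj F i j + planeRot F i j ∈ M) :
    HasRealCommutant M := by
  intro A hA hcom
  have hoff : ∀ i j, i ≠ j → A i j = 0 := by
    intro i j hij
    obtain ⟨ε, hε, h1, h2⟩ := hs i j hij
    have h3 := congrFun (congrFun (hcom _ hε) i) j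
    rw [Matrix.diagonal_mul, Matrix.mul_diagonal, h1, h2, mul_one, neg_one_mul] at h3
    have h4 : (2 : F) * A i j = 0 := by
      rw [two_mul]; nth_rewrite 1 [← h3]; simp
    exact (mul_eq_zero.1 h4).resolve_left two_ne_zero_scalars
  have hdiag : ∀ i j, i ≠ j → A i i = A j j := by
    intro i j hij
    have h3 := congrFun (congrFun (hcom _ (hr i j hij)) i) j
    simp only [planeProj, planeRot, add_mul, sub_mul, mul_add, mul_sub, one_mul, mul_one,
      Matrix.add_apply, Matrix.sub_apply, Matrix.single_mul_apply_same, hoff i j hij] at h3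
    simp [hij, hij.symm, hoff, Matrix.single_mul_apply_of_ne, Matrix.mul_single_apply_of_ne] at h3
    exact h3.symm
  rcases Nat.eq_zero_or_pos n with rfl | hn
  · exact ⟨0, by ext i; exact i.elim0⟩
  · obtain ⟨r, hr'⟩ := MobiusScalars.selfAdjoint (A ⟨0, hn⟩ ⟨0, hn⟩) (by
      have := congrFun (congrFun hA ⟨0, hn⟩) ⟨0, hn⟩
      rwa [Matrix.star_apply] at this)
    refine ⟨r, ?_⟩
    ext i j
    rw [Matrix.smul_apply, Matrix.one_apply]
    rcases eq_or_ne i j with rfl | hij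
    · rw [if_pos rfl, ← hr']
      rcases eq_or_ne i ⟨0, hn⟩ with rfl | hi
      · rfl
      · exact hdiag _ _ hi
    · rw [if_neg hij, smul_zero, hoff i j hij]

end Signs
-- The groups U_n and Sp_n.
section UnitaryGroup

attribute [local instance] matRing matAlgebra MobiusScalars.finite

variable {F : Type*} [NormedDivisionRing F] [StarRing F] [InnerProductSpace ℝ F] [MobiusScalars F]
  {n : ℕ}

theorem IsSigns.diagonal_mem_unitarySet {ε : Fin n → F} (hε : IsSigns ε) :
    Matrix.diagonal ε ∈ unitarySet F n := by
  change star (Matrix.diagonal ε) * Matrix.diagonal ε = 1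
  rw [hε.star_diagonal, hε.diagonal_mul_self]

theorem isClosed_unitarySet : IsClosed (unitarySet F n) :=
  isClosed_eq ((isTrace_reTrace (F := F) (n := n)).continuous_star.mul continuous_id)
    continuous_const

theorem exists_mul_isUnit_one_add (u : Mat F n) :
    ∃ k : Mat F n, star k * k = 1 ∧ IsUnit (1 + k * u) := by
  obtain ⟨ε, hε, h⟩ := exists_isUnit_diagonal_add u
  exact ⟨_, hε.diagonal_mem_unitarySet, hε.isUnit_one_add h⟩

theorem isUnitaryModel_unitarySet : IsUnitaryModel (unitarySet F n) where
  unitary _ hu := hu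
  closed := isClosed_unitarySet
  mul_mem u hu v hv := by
    change star (u * v) * (u * v) = 1
    rw [star_mul, mul_assoc, ← mul_assoc (star u), show star u * u = 1 from hu, one_mul]
    exact hv
  star_mem u hu := by
    change star (star u) * star u = 1
    rw [star_star]
    exact mul_star_of_star_mul hu
  cay_mem x hx := star_cay_mul (isTrace_reTrace.isUnit_one_add_skew hx) hx
  cover u _ := exists_mul_isUnit_one_add u

theorem planeRot_mem_unitarySet {i j : Fin n} (hij : i ≠ j) :
    1 - planeProj F i j + planeRot F i j ∈ unitarySet F n := by
  have := (isRotationPair_plane (F := F) hij).star_mul 0 1 (by norm_num)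
  rwa [zero_smul, add_zero, one_smul] at this

theorem hasRealCommutant_unitarySet : HasRealCommutant (unitarySet F n) :=
  hasRealCommutant_of_signs (fun i j hij => by
    refine ⟨fun k => if k = i then -1 else 1, IsSigns.diagonal_mem_unitarySet fun k => ?_, by simp,
      by simp [hij.symm]⟩
    by_cases h : k = i <;> simp [h]) fun _ _ hij => planeRot_mem_unitarySet hij

theorem neg_one_mem_unitarySet : (-1 : Mat F n) ∈ unitarySet F n := by
  change star (-1 : Mat F n) * -1 = 1
  simp

/-- The imaginary unit ι is a complex structure on the coordinates with sign -1, so the sign matrix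
is a half turn, joined to 1 by a rational curve. -/
theorem exists_polyCurve_unitarySet {ι : F} (h1 : star ι = -ι) (h2 : ι * ι = -1) (u : Mat F n) :
    ∃ κ D d, IsPolyCurve (unitarySet F n) (fun v => Algebra.norm ℝ (1 + v)) κ D d ∧
      IsUnit (1 + κ 1 * u) := by
  classical
  obtain ⟨ε, hε, hu⟩ := exists_isUnit_diagonal_add u
  have hpair : IsRotationPair (Matrix.diagonal fun i => if ε i = -1 then (1 : F) else 0)
      (Matrix.diagonal fun i => if ε i = -1 then ι else 0) := by
    constructor
    · rw [Matrix.star_eq_conjTranspose, Matrix.diagonal_conjTranspose]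
      congr 1; funext i; by_cases h : ε i = -1 <;> simp [h]
    · rw [Matrix.star_eq_conjTranspose, Matrix.diagonal_conjTranspose, Matrix.diagonal_neg]
      congr 1; funext i; by_cases h : ε i = -1 <;> simp [h, h1]
    · rw [Matrix.diagonal_mul_diagonal]
      congr 1; funext i; by_cases h : ε i = -1 <;> simp [h]
    · rw [Matrix.diagonal_mul_diagonal]
      congr 1; funext i; by_cases h : ε i = -1 <;> simp [h]
    · rw [Matrix.diagonal_mul_diagonal]
      congr 1; funext i; by_cases h : ε i = -1 <;> simp [h]
    · rw [Matrix.diagonal_mul_diagonal, Matrix.diagonal_neg]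
      congr 1; funext i; by_cases h : ε i = -1 <;> simp [h, h2]
  obtain ⟨κ, D, d, hκ, hκ1⟩ := hpair.exists_isRationalCurve (M := unitarySet F n)
    fun v hv => isUnitaryModel_unitarySet.mul_mem v hv v hv
  obtain ⟨D', d', h⟩ := hκ.isPolyCurve_norm
  refine ⟨κ, D', d', h, ?_⟩
  have e : κ 1 = Matrix.diagonal ε := by
    rw [hκ1]
    ext i j
    rw [Matrix.sub_apply, Matrix.smul_apply, Matrix.one_apply, Matrix.diagonal_apply,
      Matrix.diagonal_apply, two_smul]
    have hne : (1 : F) ≠ -1 := fun h => two_ne_zero_scalars (F := F) (by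
      rw [← one_add_one_eq_two]; nth_rewrite 1 [h]; simp)
    rcases eq_or_ne i j with rfl | hij
    · rcases hε i with h | h <;> simp [h, hne]
    · simp [hij]
  rw [e]
  exact hε.isUnit_one_add hu

theorem hasDecay_unitarySet {ι : F} (h1 : star ι = -ι) (h2 : ι * ι = -1) :
    HasDecay (reTrace F n)
      ((μHE[Module.finrank ℝ (skew (Mat F n))] : Measure (Mat F n)).restrict (unitarySet F n)) := by
  have hτ := isTrace_reTrace (F := F) (n := n)
  have hM := isUnitaryModel_unitarySet (F := F) (n := n)
  have hreach : ∀ u ∈ unitarySet F n, _ := fun u _ => exists_polyCurve_unitarySet h1 h2 u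
  exact (hasBackwardDecay_of_neg_one_mem hτ (hM.isCompact hτ) hM.unitary (hM.isInvariantOn hτ)
    neg_one_mem_unitarySet hreach).hasDecay hτ (hM.isCompact hτ) hM.unitary (hM.isInvariantOn hτ)
    hreach

end UnitaryGroup

/-! ### The group SO_n. -/

section OrthogonalGroup

attribute [local instance] matRing matAlgebra

variable {n : ℕ}

theorem det_sq_of_mem {u : Mat ℝ n} (hu : star u * u = 1) : u.det * u.det = 1 := by
  have := congrArg Matrix.det hu
  rwa [Matrix.det_mul, Matrix.star_eq_conjTranspose, Matrix.conjTranspose_eq_transpose_of_trivial,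
    Matrix.det_transpose, Matrix.det_one] at this

theorem mul_self_mem_specialOrthogonal {u : Mat ℝ n} (hu : star u * u = 1) :
    u * u ∈ specialOrthogonal n :=
  ⟨isUnitaryModel_unitarySet.mul_mem u hu u hu, by rw [Matrix.det_mul, det_sq_of_mem hu]⟩

theorem det_star_real (u : Mat ℝ n) : (star u).det = u.det := by
  rw [Matrix.star_eq_conjTranspose, Matrix.conjTranspose_eq_transpose_of_trivial,
    Matrix.det_transpose]

/-- From 1 + w = w (1 + w)⋆ the determinant of 1 + w equals itself times det w. -/
theorem det_eq_one_of_isUnit {w : Mat ℝ n} (hw : star w * w = 1) (h : IsUnit (1 + w)) :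
    w.det = 1 := by
  have h1 : (1 + w).det = (1 + w).det * w.det := by
    have e : 1 + w = w * star (1 + w) := by
      rw [star_add, star_one, mul_add, mul_one, mul_star_of_star_mul hw, add_comm]
    conv_lhs => rw [e, Matrix.det_mul, det_star_real, mul_comm]
  have h2 : (1 + w).det ≠ 0 := ((Matrix.isUnit_iff_isUnit_det _).1 h).ne_zero
  exact (mul_left_cancel₀ h2 (by rw [mul_one]; exact h1)).symm

theorem isUnitaryModel_specialOrthogonal : IsUnitaryModel (specialOrthogonal n) where
  unitary u hu := hu.1
  closed := isClosed_unitarySet.inter (isClosed_eq (by fun_prop) continuous_const)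
  mul_mem u hu v hv := ⟨isUnitaryModel_unitarySet.mul_mem u hu.1 v hv.1, by
    rw [Matrix.det_mul, hu.2, hv.2, one_mul]⟩
  star_mem u hu := ⟨isUnitaryModel_unitarySet.star_mem u hu.1, by rw [det_star_real, hu.2]⟩
  cay_mem x hx := by
    have hu := isTrace_reTrace.isUnit_one_add_skew hx
    refine ⟨isUnitaryModel_unitarySet.cay_mem x hx, ?_⟩
    have h1 : (1 - x).det = (1 + x).det := by
      rw [← det_star_real, star_sub, star_one, hx, sub_neg_eq_add]
    rw [cay, Matrix.det_mul, h1, ← Matrix.det_mul, Ring.mul_inverse_cancel _ hu, Matrix.det_one]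
  cover u _ := exists_mul_isUnit_one_add u

/-- The number of signs -1 is even; they are removed in pairs by half turns in coordinate planes. -/
theorem exists_isRationalCurve_diagonal (ε : Fin n → ℝ) (hε : IsSigns ε) (hprod : ∏ i, ε i = 1) :
    ∃ κ D d, IsRationalCurve (specialOrthogonal n) κ D d ∧ κ 1 = Matrix.diagonal ε := by
  classical
  induction hc : (Finset.univ.filter fun i => ε i = -1).card using Nat.strong_induction_on
    generalizing ε with
  | _ c ih =>
    by_cases hall : ∀ i, ε i = 1
    · refine ⟨_, _, _, isRationalCurve_one isUnitaryModel_specialOrthogonal.one_mem, ?_⟩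
      rw [← Matrix.diagonal_one]
      congr 1
      funext i
      exact (hall i).symm
    push Not at hall
    obtain ⟨i, hi⟩ := hall
    have hi1 := (hε i).resolve_left hi
    obtain ⟨j, hji, hj⟩ : ∃ j, j ≠ i ∧ ε j = -1 := by
      by_contra hcon
      push Not at hcon
      rw [Finset.prod_eq_single i (fun j _ hj => (hε j).resolve_right (hcon j hj))
        (by simp), hi1] at hprod
      norm_num at hprod
    set ε' : Fin n → ℝ := fun k => if k = i ∨ k = j then -ε k else ε k with hε'
    have hs' : IsSigns ε' := by
      intro k
      simp only [hε']
      split_ifs with h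
      · rcases hε k with h | h <;> simp [h]
      · exact hε k
    have hp' : ∏ k, ε' k = 1 := by
      have e : ∀ k, ε' k = (if k = i then -1 else 1) * (if k = j then -1 else 1) * ε k := by
        intro k
        simp only [hε']
        rcases eq_or_ne k i with rfl | hki
        · simp [hji.symm]
        · simp only [hki, false_or, if_false, one_mul]
          split_ifs <;> simp
      simp only [e, Finset.prod_mul_distrib, hprod, Finset.prod_ite_eq', Finset.mem_univ, if_true]
      norm_num
    have hcard : (Finset.univ.filter fun k => ε' k = -1).card < c := by
      rw [← hc]
      refine Finset.card_lt_card (Finset.ssubset_iff_of_subset ?_ |>.2 ⟨i, by simp [hi1], ?_⟩)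
      · intro k hk
        simp only [Finset.mem_filter, Finset.mem_univ, true_and, hε'] at hk ⊢
        split_ifs at hk with h
        · rcases h with rfl | rfl
          · exact hi1
          · exact hj
        · exact hk
      · simp [hε', hi1]; norm_num
    obtain ⟨κ, D, d, hκ, hκ1⟩ := ih _ hcard ε' hs' hp' rfl
    obtain ⟨κ', D', d', hκ', hκ1'⟩ := (isRotationPair_plane (F := ℝ) hji.symm).exists_isRationalCurve
      (M := specialOrthogonal n) fun v hv => mul_self_mem_specialOrthogonal hv
    refine ⟨_, _, _, hκ'.mul isUnitaryModel_specialOrthogonal.mul_mem hκ, ?_⟩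
    rw [hκ1, hκ1', one_sub_two_planeProj_mul hji.symm]
    congr 1
    funext k
    simp only [hε']
    split_ifs <;> simp

/-- A sign matrix ε with 1 + εu invertible has determinant 1 automatically, so it can be reached
inside SO_n. -/
theorem exists_polyCurve_specialOrthogonal (u : Mat ℝ n) (hu : u ∈ specialOrthogonal n) :
    ∃ κ D d, IsPolyCurve (specialOrthogonal n) (fun v => Algebra.norm ℝ (1 + v)) κ D d ∧
      IsUnit (1 + κ 1 * u) := by
  obtain ⟨ε, hε, h⟩ := exists_isUnit_diagonal_add u
  have h1 := hε.isUnit_one_add h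
  have h2 := det_eq_one_of_isUnit
    (isUnitaryModel_unitarySet.mul_mem _ hε.diagonal_mem_unitarySet u hu.1) h1
  rw [Matrix.det_mul, hu.2, mul_one, Matrix.det_diagonal] at h2
  obtain ⟨κ, D, d, hκ, hκ1⟩ := exists_isRationalCurve_diagonal ε hε h2
  obtain ⟨D', d', h'⟩ := hκ.isPolyCurve_norm
  exact ⟨κ, D', d', h', by rwa [hκ1]⟩

theorem planeRot_mem_specialOrthogonal {i j : Fin n} (hij : i ≠ j) :
    1 - planeProj ℝ i j + planeRot ℝ i j ∈ specialOrthogonal n := by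
  obtain ⟨u, hu, h⟩ := (isRotationPair_plane (F := ℝ) hij).quarter_sq
  rw [← h]
  exact mul_self_mem_specialOrthogonal hu

/-- A third index l, present because n ≥ 3, takes a second sign -1 and restores determinant 1. -/
theorem hasRealCommutant_specialOrthogonal (hn : 3 ≤ n) :
    HasRealCommutant (specialOrthogonal n) := by
  refine hasRealCommutant_of_signs (fun i j hij => ?_) fun _ _ hij =>
    planeRot_mem_specialOrthogonal hij
  obtain ⟨l, hl⟩ : ∃ l : Fin n, l ∉ ({i, j} : Finset (Fin n)) := by
    by_contra hcon
    push Not at hcon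
    have h1 : Finset.univ ⊆ ({i, j} : Finset (Fin n)) := fun l _ => hcon l
    have h2 := (Finset.card_le_card h1).trans Finset.card_le_two
    rw [Finset.card_univ, Fintype.card_fin] at h2
    omega
  simp only [Finset.mem_insert, Finset.mem_singleton, not_or] at hl
  refine ⟨fun k => if k = i ∨ k = l then -1 else 1, ⟨IsSigns.diagonal_mem_unitarySet fun k => ?_, ?_⟩,
    by simp, by simp [hij.symm, Ne.symm hl.2]⟩
  · by_cases h : k = i ∨ k = l <;> simp [h]
  · have e : ∀ k, (if k = i ∨ k = l then (-1 : ℝ) else 1)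
        = (if k = i then -1 else 1) * (if k = l then -1 else 1) := by
      intro k
      rcases eq_or_ne k i with rfl | hki
      · simp [Ne.symm hl.1]
      · simp [hki]
    rw [Matrix.det_diagonal]
    simp only [e, Finset.prod_mul_distrib, Finset.prod_ite_eq', Finset.mem_univ, if_true]
    norm_num

end OrthogonalGroup
-- Decay at -∞ for SO_n, in particular for odd n.
section OddOrthogonal

attribute [local instance] matRing matAlgebra

variable {n : ℕ}

/-- A rotation in odd dimension has an axis. -/
theorem exists_mulVec_eq_self (hn : Odd n) {u : Mat ℝ n} (hu : u ∈ specialOrthogonal n) :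
    ∃ v : Fin n → ℝ, v ≠ 0 ∧ u *ᵥ v = v := by
  have h1 : (1 - u).det = -(1 - u).det := by
    have e : 1 - u = -(u * star (1 - u)) := by
      rw [star_sub, star_one, mul_sub, mul_one, mul_star_of_star_mul hu.1]; abel
    conv_lhs => rw [e, Matrix.det_neg, Matrix.det_mul, det_star_real, hu.2, Fintype.card_fin,
      hn.neg_one_pow]
    ring
  have h2 : (1 - u).det = 0 := by linarith
  obtain ⟨v, hv, h⟩ := Matrix.exists_mulVec_eq_zero_iff.2 h2
  refine ⟨v, hv, ?_⟩
  rw [Matrix.sub_mulVec, Matrix.one_mulVec, sub_eq_zero] at h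
  exact h.symm

theorem flow_mulVec_eq_self {u : Mat ℝ n} (hu : star u * u = 1) {v : Fin n → ℝ} (hv : u *ᵥ v = v)
    (t : ℝ) : flow t u *ᵥ v = v := by
  obtain ⟨r, -, h2, h3, -⟩ := (isTrace_reTrace (F := ℝ) (n := n)).exists_flow_inverse hu t
  have he : Real.cosh t + Real.sinh t ≠ 0 := by
    rw [Real.cosh_add_sinh]; exact (Real.exp_pos t).ne'
  have h4 : r *ᵥ v = (Real.cosh t + Real.sinh t)⁻¹ • v := by
    rw [eq_inv_smul_iff₀ he]
    calc (Real.cosh t + Real.sinh t) • r *ᵥ v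
        = r *ᵥ ((Real.sinh t • u + Real.cosh t • (1 : Mat ℝ n)) *ᵥ v) := by
          rw [Matrix.add_mulVec, Matrix.smul_mulVec, Matrix.smul_mulVec, hv, Matrix.one_mulVec,
            ← add_smul, Matrix.mulVec_smul, add_comm]
      _ = v := by rw [Matrix.mulVec_mulVec, h2, Matrix.one_mulVec]
  rw [h3, ← Matrix.mulVec_mulVec, h4, Matrix.mulVec_smul, Matrix.add_mulVec, Matrix.smul_mulVec,
    Matrix.smul_mulVec, hv, Matrix.one_mulVec, ← add_smul, inv_smul_smul₀ he]

/-- The axis v makes 1 - u singular, so its column k is replaced by e_k, giving N. If N is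
invertible then v_k ≠ 0, and a matrix with columns along v can be subtracted from 1 + V to clear row
k. This changes neither (1 - u)(1 + V) nor (1 - V)(1 + V), and on the result N acts like 1 - u; the
adjugate of N then applies. -/
theorem det_smul_one_sub_sq {u V : Mat ℝ n} {v : Fin n → ℝ} (hv : v ≠ 0) (huv : u *ᵥ v = v)
    (hVv : V *ᵥ v = v) (k : Fin n)
    (hN : (1 - u * (1 - Matrix.single k k 1)).det ≠ 0) :
    (1 - u * (1 - Matrix.single k k 1)).det • (1 - V * V)
      = (1 - V) * ((1 - u * (1 - Matrix.single k k 1)).adjugate * ((1 - u) * (1 + V))) := by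
  set E : Mat ℝ n := Matrix.single k k 1 with hE
  set N := 1 - u * (1 - E) with hNdef
  have hEv : E *ᵥ v = Pi.single k (v k) := by
    rw [hE, Matrix.single_mulVec, one_mul]; rfl
  have hvk : v k ≠ 0 := by
    intro h0
    have h1 : N *ᵥ v = 0 := by
      rw [hNdef, Matrix.sub_mulVec, ← Matrix.mulVec_mulVec, Matrix.sub_mulVec, hEv, h0,
        Pi.single_zero, Matrix.one_mulVec, sub_zero, huv, sub_self]
    exact hN (Matrix.exists_mulVec_eq_zero_iff.1 ⟨v, hv, h1⟩)
  set B := 1 + V with hB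
  set w : Fin n → ℝ := fun j => B k j / v k with hw
  set B' := B - Matrix.vecMulVec v w with hB'
  have hmul : ∀ A : Mat ℝ n, A *ᵥ v = 0 → A * B' = A * B := by
    intro A hA
    rw [hB', mul_sub, Matrix.mul_vecMulVec, hA, Matrix.zero_vecMulVec, sub_zero]
  have hEB : E * B' = 0 := by
    ext i j
    rw [hE]
    rcases eq_or_ne i k with rfl | hi
    · rw [Matrix.single_mul_apply_same, one_mul, hB', Matrix.sub_apply, Matrix.vecMulVec_apply, hw]
      simp only [Matrix.zero_apply]
      field_simp
      ring
    · rw [Matrix.single_mul_apply_of_ne _ _ _ _ _ hi]; rfl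
  have h1 : (1 - u) * B' = (1 - u) * B := hmul _ (by
    rw [Matrix.sub_mulVec, Matrix.one_mulVec, huv, sub_self])
  have h2 : (1 - V) * B' = (1 - V) * B := hmul _ (by
    rw [Matrix.sub_mulVec, Matrix.one_mulVec, hVv, sub_self])
  have h3 : N * B' = (1 - u) * B := by
    have : N * B' = (1 - u) * B' + u * (E * B') := by rw [hNdef]; noncomm_ring
    rw [this, hEB, mul_zero, add_zero, h1]
  rw [← h3, ← mul_assoc N.adjugate, Matrix.adjugate_mul, smul_mul_assoc, one_mul, mul_smul_comm, h2,
    hB]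
  congr 1
  noncomm_ring

variable {μ : Measure (Mat ℝ n)}

/-- The sublevel method with f(u) = det(1 - uQ), Q deleting column k: by `det_smul_one_sub_sq` it
controls the speed directly, though V need not tend to a multiple of 1 here. -/
theorem hasBackwardDecay_specialOrthogonal (hn : Odd n)
    (hμ : IsInvariantOn (specialOrthogonal n) μ) : HasBackwardDecay μ := by
  classical
  have hfin := hμ.finite
  have hτ := isTrace_reTrace (F := ℝ) (n := n)
  have hM := isUnitaryModel_specialOrthogonal (n := n)
  have hMc := hM.isCompact hτ
  let k : Fin n := ⟨0, hn.pos⟩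
  set Q : Mat ℝ n := 1 - Matrix.single k k 1 with hQ
  set f : Mat ℝ n → ℝ := fun v => (1 - v * Q).det with hf
  have hfc : Continuous f := by fun_prop
  have hreach : ∀ u ∈ specialOrthogonal n,
      ∃ κ D d, IsPolyCurve (specialOrthogonal n) f κ D d ∧ f (κ 1 * u) ≠ 0 := by
    intro u hu
    obtain ⟨ε₀, hε₀, hunit⟩ := exists_isUnit_signColumns (-u) (Finset.univ.erase k)
    -- Column k of uQ is zero, so the sign at k is free; it is chosen to make the total product 1.
    set ε := Function.update ε₀ k (∏ i ∈ Finset.univ.erase k, ε₀ i) with hε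
    have hεne : ∀ i, i ≠ k → ε i = ε₀ i := fun i hi => Function.update_of_ne hi _ _
    have hprod0 : ∀ S : Finset (Fin n), ∏ i ∈ S, ε₀ i = 1 ∨ ∏ i ∈ S, ε₀ i = -1 := by
      intro S
      induction S using Finset.induction_on with
      | empty => simp
      | insert i S hi ih =>
        rw [Finset.prod_insert hi]
        rcases hε₀ i with h | h <;> rcases ih with h' | h' <;> simp [h, h']
    have hεs : IsSigns ε := by
      intro i
      rcases eq_or_ne i k with rfl | hi
      · rw [hε, Function.update_self]; exact hprod0 _
      · rw [hεne i hi]; exact hε₀ i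
    have hprod : ∏ i, ε i = 1 := by
      rw [← Finset.mul_prod_erase _ _ (Finset.mem_univ k),
        Finset.prod_congr rfl fun i hi => hεne i (Finset.ne_of_mem_erase hi), hε,
        Function.update_self]
      rcases hprod0 (Finset.univ.erase k) with h | h <;> rw [h] <;> norm_num
    obtain ⟨κ, D, d, hκ, hκ1⟩ := exists_isRationalCurve_diagonal ε hεs hprod
    have h1 := hκ.isPolyCurve 1 (-(LinearMap.mulRight ℝ Q))
    have e : (fun v => (1 + (-(LinearMap.mulRight ℝ Q)) v).det) = f := by
      funext v
      simp [hf, sub_eq_add_neg]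
    rw [e] at h1
    refine ⟨κ, _, _, h1, ?_⟩
    have e2 : Matrix.diagonal ε * (1 - κ 1 * u * Q)
        = signColumns (-u) (Finset.univ.erase k) ε₀
          * Matrix.diagonal (fun i => if i = k then ε k else 1) := by
      rw [hκ1, mul_sub, mul_one, mul_assoc, ← mul_assoc (Matrix.diagonal ε),
        hεs.diagonal_mul_self, one_mul]
      ext i j
      rw [Matrix.mul_diagonal, Matrix.sub_apply, hQ, mul_sub, mul_one, Matrix.sub_apply,
        Matrix.diagonal_apply, signColumns]
      rcases eq_or_ne j k with rfl | hj
      · rw [Matrix.mul_single_apply_same]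
        rcases eq_or_ne i k with rfl | hi
        · simp
        · simp [hi]
      · rw [Matrix.mul_single_apply_of_ne _ _ _ _ _ hj]
        rcases eq_or_ne i j with rfl | hi
        · simp [hj, hεne _ hj]; ring
        · simp [hj, hi]
    have h2 := congrArg Matrix.det e2
    rw [Matrix.det_mul, Matrix.det_mul, Matrix.det_diagonal, hprod, one_mul, Matrix.det_diagonal] at h2
    change (1 - κ 1 * u * Q).det ≠ 0
    rw [h2]
    refine mul_ne_zero ((Matrix.isUnit_iff_isUnit_det _).1 hunit).ne_zero ?_
    rw [Finset.prod_ite_eq' Finset.univ k fun _ => ε k, if_pos (Finset.mem_univ k)]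
    rcases hεs k with h | h <;> rw [h] <;> norm_num
  obtain ⟨C, a, hC, ha, hsub⟩ := hμ.exists_sublevel_le hτ hMc hM.unitary hfc hreach
  have hadj : Continuous fun u : Mat ℝ n => (1 - u * Q).adjugate := by fun_prop
  obtain ⟨K, hK⟩ := hMc.exists_bound_of_continuousOn hadj.continuousOn
  set c := 2 * ‖(1 : Mat ℝ n)‖ with hc
  have hc0 : 0 ≤ c := by positivity
  refine exists_integral_sq_le_of_sublevel hμ.ae_mem hfc hC ha hsub
    (G := fun t u => ‖1 - flow (-t) u * flow (-t) u‖) (K := c * (K * (c * c))) (L := c * c)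
    (fun _ _ _ _ => norm_nonneg _) (fun t _ u hu => ?_) fun t _ u hu => ?_
  · have hK0 : 0 ≤ K := (norm_nonneg _).trans (hK u hu)
    rcases eq_or_ne (f u) 0 with h0 | h0
    · rw [h0, abs_zero, zero_mul]; positivity
    obtain ⟨v, hv, huv⟩ := exists_mulVec_eq_self hn hu
    have h1 := det_smul_one_sub_sq hv huv (flow_mulVec_eq_self hu.1 huv (-t)) k h0
    -- At time -t the basic identity makes this product small instead of (1 - V)(1 + u).
    have h2 : (1 - u) * (1 + flow (-t) u)
        = Real.exp (-2 * t) • ((1 - flow (-t) u) * (1 + u)) := by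
      rw [hτ.one_sub_flow_mul hu.1, smul_smul, ← Real.exp_add]
      simp
    have h3 : ‖1 - flow (-t) u‖ ≤ c := hτ.norm_one_sub_flow_le hu.1 (-t)
    have h4 : ‖1 + u‖ ≤ c := by
      refine (norm_add_le _ _).trans ?_
      rw [hτ.norm_unitary hu.1, hc]; linarith
    have h5 : ‖(1 - u) * (1 + flow (-t) u)‖ ≤ Real.exp (-2 * t) * (c * c) := by
      rw [h2, norm_smul, Real.norm_of_nonneg (Real.exp_pos _).le]
      gcongr
      exact (norm_mul_le _ _).trans (mul_le_mul h3 h4 (norm_nonneg _) hc0)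
    calc |f u| * ‖1 - flow (-t) u * flow (-t) u‖
        = ‖f u • (1 - flow (-t) u * flow (-t) u)‖ := by rw [norm_smul, Real.norm_eq_abs]
      _ = ‖(1 - flow (-t) u) * ((1 - u * Q).adjugate * ((1 - u) * (1 + flow (-t) u)))‖ := by
          rw [← h1]
      _ ≤ c * (K * (Real.exp (-2 * t) * (c * c))) :=
          (norm_mul_le _ _).trans (mul_le_mul h3 ((norm_mul_le _ _).trans
            (mul_le_mul (hK u hu) h5 (norm_nonneg _) hK0)) (norm_nonneg _) hc0)
      _ = _ := by ring
  · refine (hτ.norm_one_sub_flow_sq_le hu.1 (-t)).trans ?_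
    exact mul_le_mul_of_nonneg_left (hτ.norm_one_sub_flow_le hu.1 (-t)) hc0

theorem hasDecay_specialOrthogonal (hμ : IsInvariantOn (specialOrthogonal n) μ) :
    HasDecay (reTrace ℝ n) μ := by
  have hτ := isTrace_reTrace (F := ℝ) (n := n)
  have hM := isUnitaryModel_specialOrthogonal (n := n)
  have hMc := hM.isCompact hτ
  have hback : HasBackwardDecay μ := by
    rcases Nat.even_or_odd n with hn | hn
    · refine hasBackwardDecay_of_neg_one_mem hτ hMc hM.unitary hμ ⟨neg_one_mem_unitarySet, ?_⟩
        exists_polyCurve_specialOrthogonal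
      rw [Matrix.det_neg, Fintype.card_fin, hn.neg_one_pow, Matrix.det_one, one_mul]
    · exact hasBackwardDecay_specialOrthogonal hn hμ
  exact hback.hasDecay hτ hMc hM.unitary hμ exists_polyCurve_specialOrthogonal

end OddOrthogonal
-- The one-parameter group γ, and the passage to the matrix groups.
section Bridge

variable {F : Type*} [NormedDivisionRing F] [StarRing F] [InnerProductSpace ℝ F] [MobiusScalars F]
  {n : ℕ}

attribute [local instance] MobiusScalars.finite

/-- The generator of the hyperbolic one-parameter group. -/
def boost (F : Type*) [NormedDivisionRing F] (n : ℕ) : Mat2 F n := Matrix.fromBlocks 0 1 1 0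

theorem boost_mul_self : boost F n * boost F n = 1 := by
  rw [boost, Matrix.fromBlocks_multiply, ← Matrix.fromBlocks_one]
  simp

/-- The generator squares to 1, so the even and odd terms of the exponential series sum to cosh and
sinh. -/
theorem gamma_eq (t : ℝ) : gamma F n t = Real.cosh t • 1 + Real.sinh t • boost F n := by
  let _ : Algebra ℝ (Mat2 F n) := (matAlgebra F (Fin n ⊕ Fin n)).toAlgebra
  rw [gamma, NormedSpace.exp_eq_tsum ℝ]
  refine HasSum.tsum_eq ?_
  have hZ : ∀ k, boost F n ^ (2 * k) = 1 := fun k => by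
    rw [pow_mul, pow_two, boost_mul_self, one_pow]
  have h1 := (Real.hasSum_cosh t).smul_const (1 : Mat2 F n)
  have h2 := (Real.hasSum_sinh t).smul_const (boost F n)
  have hp : ∀ k, (t • boost F n) ^ k = t ^ k • boost F n ^ k := fun k => smul_pow t _ k
  refine HasSum.even_add_odd ?_ ?_
  · convert! h1 using 1
    ext1 k
    change ((2 * k).factorial : ℝ)⁻¹ • (t • boost F n) ^ (2 * k) = _
    rw [hp, hZ, smul_smul, div_eq_inv_mul]
  · convert! h2 using 1
    ext1 k
    change ((2 * k + 1).factorial : ℝ)⁻¹ • (t • boost F n) ^ (2 * k + 1) = _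
    rw [hp, pow_succ (boost F n), hZ, one_mul, smul_smul, div_eq_inv_mul]

theorem gamma_eq_fromBlocks (t : ℝ) : gamma F n t = Matrix.fromBlocks (Real.cosh t • 1)
    (Real.sinh t • 1) (Real.sinh t • 1) (Real.cosh t • 1) := by
  rw [gamma_eq, boost, ← Matrix.fromBlocks_one, Matrix.fromBlocks_smul, Matrix.fromBlocks_smul,
    Matrix.fromBlocks_add]
  simp

theorem contDiff_gamma : ContDiff ℝ ∞ (gamma F n) := by
  have e : gamma F n = fun t => Real.cosh t • 1 + Real.sinh t • boost F n := funext gamma_eq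
  rw [e]
  exact (Real.contDiff_cosh.smul contDiff_const).add (Real.contDiff_sinh.smul contDiff_const)

theorem hasDerivAt_gamma (t : ℝ) :
    HasDerivAt (gamma F n) (Real.sinh t • 1 + Real.cosh t • boost F n) t := by
  have e : gamma F n = fun t => Real.cosh t • 1 + Real.sinh t • boost F n := funext gamma_eq
  rw [e]
  exact ((Real.hasDerivAt_cosh t).smul_const _).add ((Real.hasDerivAt_sinh t).smul_const _)

theorem smul_mul_mat (r : ℝ) (x y : Mat2 F n) : r • x * y = r • (x * y) := by
  ext i j
  simp [Matrix.mul_apply, MobiusScalars.smul_mul, Finset.smul_sum]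

theorem mul_smul_mat (r : ℝ) (x y : Mat2 F n) : x * r • y = r • (x * y) := by
  ext i j
  simp [Matrix.mul_apply, MobiusScalars.mul_smul, Finset.smul_sum]

theorem gamma_zero : gamma F n 0 = 1 := by rw [gamma_eq]; simp

theorem deriv_gamma (t : ℝ) :
    deriv (gamma F n) t = Real.sinh t • 1 + Real.cosh t • boost F n :=
  (hasDerivAt_gamma t).deriv

theorem deriv_gamma_zero : deriv (gamma F n) 0 = boost F n := by
  rw [deriv_gamma]; simp

/-- With `boost_mul_gamma`, the velocity of γ is a translate of the generator from either side; this
is what contradicts invariance when the speed varies. -/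
theorem gamma_mul_boost (t : ℝ) : gamma F n t * boost F n = deriv (gamma F n) t := by
  rw [deriv_gamma, gamma_eq, add_mul, smul_mul_mat, smul_mul_mat, one_mul,
    boost_mul_self, add_comm]

theorem boost_mul_gamma (t : ℝ) : boost F n * gamma F n t = deriv (gamma F n) t := by
  rw [deriv_gamma, gamma_eq, mul_add, mul_smul_mat, mul_smul_mat, mul_one,
    boost_mul_self, add_comm]

theorem gamma_mul_gamma_neg (t : ℝ) : gamma F n t * gamma F n (-t) = 1 := by
  rw [gamma_eq, gamma_eq, Real.cosh_neg, Real.sinh_neg]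
  simp only [add_mul, mul_add, smul_mul_mat, mul_smul_mat, one_mul, mul_one, boost_mul_self]
  have h : Real.cosh t * Real.cosh t = 1 + Real.sinh t * Real.sinh t := by
    linarith [Real.cosh_sq t]
  simp only [smul_smul, h]
  module

theorem conjTranspose_gamma (t : ℝ) : (gamma F n t)ᴴ = gamma F n t := by
  have hs : ∀ r : ℝ, (r • (1 : Mat F n))ᴴ = r • 1 := fun r => by
    ext i j
    rcases eq_or_ne i j with rfl | h
    · simp [MobiusScalars.star_smul]
    · simp [Matrix.one_apply_ne h, Matrix.one_apply_ne h.symm]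
  rw [gamma_eq_fromBlocks, Matrix.fromBlocks_conjTranspose, hs, hs]

theorem gamma_mem_splitUnitary (t : ℝ) : gamma F n t ∈ splitUnitary F n := by
  have hinv : gamma F n (-t) * gamma F n t = 1 := by
    simpa only [neg_neg] using gamma_mul_gamma_neg (F := F) (n := n) (-t)
  refine ⟨⟨⟨gamma F n t, gamma F n (-t), gamma_mul_gamma_neg t, hinv⟩, rfl⟩, ?_⟩
  -- The generator anticommutes with the form, so moving γ(t) past the form turns it into γ(-t).
  have hZ : boost F n * signature F n = -(signature F n * boost F n) := by
    simp [boost, signature, Matrix.fromBlocks_multiply, Matrix.fromBlocks_neg]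
  have h : gamma F n t * signature F n = signature F n * gamma F n (-t) := by
    rw [gamma_eq, gamma_eq, Real.cosh_neg, Real.sinh_neg, add_mul, mul_add, smul_mul_mat,
      smul_mul_mat, mul_smul_mat, mul_smul_mat, hZ, one_mul, mul_one, smul_neg, neg_smul]
  rw [conjTranspose_gamma, h, mul_assoc, hinv, mul_one]

end Bridge

section Bridge

variable {F : Type*} [NormedDivisionRing F] [StarRing F] [InnerProductSpace ℝ F] [MobiusScalars F]
  {n : ℕ}

theorem finiteDimensional_mat2 : FiniteDimensional ℝ (Mat2 F n) :=
  have : FiniteDimensional ℝ F := MobiusScalars.finite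
  inferInstanceAs (Module.Finite ℝ (Matrix (Fin n ⊕ Fin n) (Fin n ⊕ Fin n) F))

attribute [local instance] finiteDimensional_mat2

/-- A linear map on `2n × 2n` matrices is continuous. -/
noncomputable def blockMap (f : Mat2 F n →ₗ[ℝ] Mat F n) : Mat2 F n →L[ℝ] Mat F n :=
  LinearMap.toContinuousLinearMap f

attribute [local instance] matRing matAlgebra

theorem isSplit_of_mem {g : Mat2 F n} (hg : g ∈ splitUnitary F n) :
    IsSplit g.toBlocks₁₁ g.toBlocks₁₂ g.toBlocks₂₁ g.toBlocks₂₂ := by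
  have h := hg.2
  rw [← Matrix.fromBlocks_toBlocks g, signature, Matrix.fromBlocks_conjTranspose,
    Matrix.fromBlocks_multiply, Matrix.fromBlocks_multiply, Matrix.fromBlocks_inj] at h
  simp only [mul_one, mul_zero, add_zero, zero_add, mul_neg, neg_mul] at h
  obtain ⟨h1, h2, h3, h4⟩ := h
  refine ⟨?_, ?_, ?_, ?_⟩ <;> simp only [Matrix.star_eq_conjTranspose]
  · rw [sub_eq_add_neg, h1]
  · rw [← sub_eq_zero, ← h2]; abel
  · rw [← sub_eq_zero, ← h3]; abel
  · rw [← neg_inj, ← h4]; abel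

/-- The four blocks of a matrix. -/
noncomputable def matBlocks (F : Type*) [NormedDivisionRing F] [StarRing F]
    [InnerProductSpace ℝ F] [MobiusScalars F] (n : ℕ) :
    @Blocks (Mat2 F n) (Mat F n) Matrix.frobeniusNormedAddCommGroup Matrix.frobeniusNormedSpace _ _ where
  a := blockMap ⟨⟨Matrix.toBlocks₁₁, fun _ _ => rfl⟩, fun _ _ => rfl⟩
  b := blockMap ⟨⟨Matrix.toBlocks₁₂, fun _ _ => rfl⟩, fun _ _ => rfl⟩
  c := blockMap ⟨⟨Matrix.toBlocks₂₁, fun _ _ => rfl⟩, fun _ _ => rfl⟩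
  d := blockMap ⟨⟨Matrix.toBlocks₂₂, fun _ _ => rfl⟩, fun _ _ => rfl⟩

theorem kineticMetric_eq (M : Set (Mat F n)) :
    kineticMetric M = kinE (reTrace F n) (matBlocks F n) (riemVolume M) := rfl

theorem riemVolume_eq (M : Set (Mat F n)) :
    riemVolume M = (μHE[Module.finrank ℝ (skew (Mat F n))] : Measure (Mat F n)).restrict M := by
  rw [finrank_skew]; rfl

theorem isMobiusModel_gamma {S : Set (Mat2 F n)} (hS : S ⊆ splitUnitary F n)
    (hγ : ∀ t, gamma F n t ∈ S) : IsMobiusModel (matBlocks F n) S (gamma F n) where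
  split g hg := isSplit_of_mem (hS hg)
  smooth := contDiff_gamma
  mem := hγ
  a_eq t := by
    change (gamma F n t).toBlocks₁₁ = _
    rw [gamma_eq_fromBlocks, Matrix.toBlocks_fromBlocks₁₁]
  b_eq t := by
    change (gamma F n t).toBlocks₁₂ = _
    rw [gamma_eq_fromBlocks, Matrix.toBlocks_fromBlocks₁₂]
  c_eq t := by
    change (gamma F n t).toBlocks₂₁ = _
    rw [gamma_eq_fromBlocks, Matrix.toBlocks_fromBlocks₂₁]
  d_eq t := by
    change (gamma F n t).toBlocks₂₂ = _
    rw [gamma_eq_fromBlocks, Matrix.toBlocks_fromBlocks₂₂]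

theorem main_of_model {M : Set (Mat F n)} {S : Set (Mat2 F n)} (hS : S ⊆ splitUnitary F n)
    (hγ : ∀ t, gamma F n t ∈ S) (hM : IsUnitaryModel M) (hcom : HasRealCommutant M)
    (hdec : HasDecay (reTrace F n)
      ((μHE[Module.finrank ℝ (skew (Mat F n))] : Measure (Mat F n)).restrict M))
    (hne : ∃ u ∈ M, u * u ≠ 1) :
    (∀ t : ℝ, gamma F n t = Matrix.fromBlocks (Real.cosh t • 1) (Real.sinh t • 1)
        (Real.sinh t • 1) (Real.cosh t • 1) ∧ gamma F n t ∈ S) ∧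
      (∃ (I : Set ℝ) (φ : ℝ → ℝ), IsReparametrization φ I ∧
        IsInextendibleGeodesic (kineticMetric M) S (fun s => gamma F n (φ s)) I ∧
        curveLength (kineticMetric M) (fun s => gamma F n (φ s)) I < ⊤) ∧
      ¬ GeodesicallyComplete (kineticMetric M) S ∧
      ¬ MetricallyComplete (kineticMetric M) S ∧
      ¬ LeftInvariant (kineticMetric M) S ∧
      ¬ RightInvariant (kineticMetric M) S := by
  have hmodel := isMobiusModel_gamma hS hγ
  have hτ := isTrace_reTrace (F := F) (n := n)
  obtain ⟨h1, h2, h3, t, h4⟩ := hmodel.main hτ hM (hM.isInvariantOn hτ) hcom hdec hne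
  rw [← riemVolume_eq, ← kineticMetric_eq] at h1 h2 h3 h4
  have htan : boost F n ∈ tangentAt S (gamma F n 0) :=
    ⟨gamma F n, contDiff_gamma, hγ, rfl, deriv_gamma_zero⟩
  have ht : kineticMetric M (gamma F n t) (deriv (gamma F n) t) (deriv (gamma F n) t) ≠
      kineticMetric M (gamma F n 0) (deriv (gamma F n) 0) (deriv (gamma F n) 0) := h4
  rw [deriv_gamma_zero] at ht
  refine ⟨fun t => ⟨gamma_eq_fromBlocks t, hγ t⟩, h1, h2, h3, fun hinv => ht ?_, fun hinv => ht ?_⟩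
  · have := hinv _ (hγ t) _ (hγ 0) _ htan _ htan
    rwa [gamma_mul_boost, gamma_zero, mul_one, ← gamma_zero] at this
  · have := hinv _ (hγ t) _ (hγ 0) _ htan _ htan
    rwa [boost_mul_gamma, gamma_zero, one_mul, ← gamma_zero] at this

end Bridge
-- Membership of γ in the three groups, and non-involutive elements of M.
section Real

attribute [local instance] matRing matAlgebra

variable {n : ℕ}

theorem gamma_mem_Oo (t : ℝ) : gamma ℝ n t ∈ Oo n := by
  have hc : Continuous (gamma ℝ n) := contDiff_gamma.continuous
  exact (isPreconnected_range hc).subset_connectedComponentIn ⟨0, gamma_zero⟩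
    (range_subset_iff.2 gamma_mem_splitUnitary) ⟨t, rfl⟩

theorem Oo_subset_splitUnitary : Oo n ⊆ splitUnitary ℝ n := connectedComponentIn_subset _ _

theorem exists_mul_self_ne_one_specialOrthogonal (hn : 3 ≤ n) :
    ∃ u ∈ specialOrthogonal n, u * u ≠ 1 := by
  have hij : (⟨0, by omega⟩ : Fin n) ≠ ⟨1, by omega⟩ := by simp
  refine ⟨_, planeRot_mem_specialOrthogonal hij, fun h => ?_⟩
  -- The square of a quarter turn is the half turn 1 - 2P, which has a diagonal entry -1.
  have hsq := (isRotationPair_plane (F := ℝ) hij).sq 0 1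
  rw [zero_smul, add_zero, one_smul, h] at hsq
  have h' := congrFun (congrFun hsq ⟨0, by omega⟩) ⟨0, by omega⟩
  norm_num [planeProj, planeRot, Matrix.single_apply] at h'

theorem hasDecay_restrict_specialOrthogonal : HasDecay (reTrace ℝ n)
    ((μHE[Module.finrank ℝ (skew (Mat ℝ n))] : Measure (Mat ℝ n)).restrict (specialOrthogonal n)) :=
  hasDecay_specialOrthogonal (isUnitaryModel_specialOrthogonal.isInvariantOn isTrace_reTrace)

end Real

/-- The Schur complement of the block c·1 is (c - s²/c)·1 = c⁻¹·1, so the two determinants cancel.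
-/
theorem det_fromBlocks_scalar {R : Type*} [Field R] {n : ℕ} {c s : R} (hc : c ≠ 0)
    (h : c ^ 2 - s ^ 2 = 1) :
    (Matrix.fromBlocks (c • 1) (s • 1) (s • 1) (c • 1) : Mat2 R n).det = 1 := by
  let _ : Invertible (c • (1 : Mat R n)) :=
    ⟨c⁻¹ • 1, by simp [smul_smul, hc], by simp [smul_smul, hc]⟩
  have e : c • (1 : Mat R n) - s • 1 * (c⁻¹ • 1) * s • 1 = c⁻¹ • 1 := by
    simp only [Matrix.mul_smul, mul_one, smul_smul, ← sub_smul]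
    congr 1
    field_simp
    linear_combination h
  rw [Matrix.det_fromBlocks₁₁]
  change _ * (c • (1 : Mat R n) - s • 1 * (c⁻¹ • 1) * s • 1).det = 1
  rw [e, ← Matrix.det_mul]
  simp [smul_smul, hc]

theorem det_gamma {n : ℕ} (t : ℝ) : (gamma ℂ n t).det = 1 := by
  have hs : ∀ r : ℝ, (r • 1 : Mat ℂ n) = (r : ℂ) • 1 := fun r => by
    ext i j; simp
  rw [gamma_eq_fromBlocks, hs, hs]
  refine det_fromBlocks_scalar (Complex.ofReal_ne_zero.2 (Real.cosh_pos t).ne') ?_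
  exact_mod_cast congrArg (fun x : ℝ => (x : ℂ)) (Real.cosh_sq_sub_sinh_sq t)

theorem gamma_mem_SU {n : ℕ} (t : ℝ) : gamma ℂ n t ∈ SU n :=
  ⟨gamma_mem_splitUnitary t, det_gamma t⟩

section Scalars

variable {F : Type*} [NormedDivisionRing F] [StarRing F] [InnerProductSpace ℝ F]
  {n : ℕ}

theorem exists_mul_self_ne_one_unitarySet (hn : 1 ≤ n) {ι : F} (h1 : star ι = -ι)
    (h2 : ι * ι = -1) : ∃ u ∈ unitarySet F n, u * u ≠ 1 := by
  have h3 : (2 : F) ≠ 0 := by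
    rw [← one_add_one_eq_two, ← two_smul ℝ]
    exact smul_ne_zero two_ne_zero one_ne_zero
  refine ⟨Matrix.diagonal fun _ => ι, ?_, fun h => ?_⟩
  · change (Matrix.diagonal fun _ => ι)ᴴ * _ = 1
    rw [Matrix.diagonal_conjTranspose, Matrix.diagonal_mul_diagonal, ← Matrix.diagonal_one]
    congr 1
    funext i
    change star ι * ι = 1
    rw [h1, neg_mul, h2, neg_neg]
  · rw [Matrix.diagonal_mul_diagonal, h2] at h
    have h' := congrFun (congrFun h ⟨0, hn⟩) ⟨0, hn⟩
    rw [Matrix.diagonal_apply_eq, Matrix.one_apply_eq] at h'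
    refine h3 ?_
    rw [← one_add_one_eq_two]
    nth_rw 1 [← h']
    exact neg_add_cancel 1

end Scalars

end MobiusKinetic

theorem theorem1p1 (n : ℕ) :
    (3 ≤ n →
      (∀ t : ℝ, gamma ℝ n t =
          Matrix.fromBlocks (Real.cosh t • 1) (Real.sinh t • 1)
            (Real.sinh t • 1) (Real.cosh t • 1) ∧
        gamma ℝ n t ∈ Oo n) ∧
      (∃ (I : Set ℝ) (φ : ℝ → ℝ), IsReparametrization φ I ∧
        IsInextendibleGeodesic (kineticMetric (specialOrthogonal n)) (Oo n) (fun s => gamma ℝ n (φ s)) I ∧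
        curveLength (kineticMetric (specialOrthogonal n)) (fun s => gamma ℝ n (φ s)) I < ⊤) ∧
      ¬ GeodesicallyComplete (kineticMetric (specialOrthogonal n)) (Oo n) ∧
      ¬ MetricallyComplete (kineticMetric (specialOrthogonal n)) (Oo n) ∧
      ¬ LeftInvariant (kineticMetric (specialOrthogonal n)) (Oo n) ∧
      ¬ RightInvariant (kineticMetric (specialOrthogonal n)) (Oo n)) ∧
    (1 ≤ n →
      (∀ t : ℝ, gamma ℂ n t =
          Matrix.fromBlocks (Real.cosh t • 1) (Real.sinh t • 1)
            (Real.sinh t • 1) (Real.cosh t • 1) ∧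
        gamma ℂ n t ∈ SU n) ∧
      (∃ (I : Set ℝ) (φ : ℝ → ℝ), IsReparametrization φ I ∧
        IsInextendibleGeodesic (kineticMetric (unitaryGrp n)) (SU n) (fun s => gamma ℂ n (φ s)) I ∧
        curveLength (kineticMetric (unitaryGrp n)) (fun s => gamma ℂ n (φ s)) I < ⊤) ∧
      ¬ GeodesicallyComplete (kineticMetric (unitaryGrp n)) (SU n) ∧
      ¬ MetricallyComplete (kineticMetric (unitaryGrp n)) (SU n) ∧
      ¬ LeftInvariant (kineticMetric (unitaryGrp n)) (SU n) ∧
      ¬ RightInvariant (kineticMetric (unitaryGrp n)) (SU n)) ∧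
    (1 ≤ n →
      (∀ t : ℝ, gamma ℍ[ℝ] n t =
          Matrix.fromBlocks (Real.cosh t • 1) (Real.sinh t • 1)
            (Real.sinh t • 1) (Real.cosh t • 1) ∧
        gamma ℍ[ℝ] n t ∈ Sp n) ∧
      (∃ (I : Set ℝ) (φ : ℝ → ℝ), IsReparametrization φ I ∧
        IsInextendibleGeodesic (kineticMetric (symplecticGrp n)) (Sp n) (fun s => gamma ℍ[ℝ] n (φ s)) I ∧
        curveLength (kineticMetric (symplecticGrp n)) (fun s => gamma ℍ[ℝ] n (φ s)) I < ⊤) ∧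
      ¬ GeodesicallyComplete (kineticMetric (symplecticGrp n)) (Sp n) ∧
      ¬ MetricallyComplete (kineticMetric (symplecticGrp n)) (Sp n) ∧
      ¬ LeftInvariant (kineticMetric (symplecticGrp n)) (Sp n) ∧
      ¬ RightInvariant (kineticMetric (symplecticGrp n)) (Sp n)) := by
  refine ⟨fun hn => ?_, fun hn => ?_, fun hn => ?_⟩
  · exact main_of_model Oo_subset_splitUnitary gamma_mem_Oo isUnitaryModel_specialOrthogonal
      (hasRealCommutant_specialOrthogonal hn) hasDecay_restrict_specialOrthogonal
      (exists_mul_self_ne_one_specialOrthogonal hn)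
  · exact main_of_model (fun _ h => h.1) gamma_mem_SU isUnitaryModel_unitarySet
      hasRealCommutant_unitarySet (hasDecay_unitarySet (ι := Complex.I) (by simp) (by simp))
      (exists_mul_self_ne_one_unitarySet hn (ι := Complex.I) (by simp) (by simp))
  · have h1 : star (⟨0, 1, 0, 0⟩ : ℍ[ℝ]) = -⟨0, 1, 0, 0⟩ := by ext <;> simp
    have h2 : (⟨0, 1, 0, 0⟩ : ℍ[ℝ]) * ⟨0, 1, 0, 0⟩ = -1 := by ext <;> simp
    exact main_of_model (fun _ h => h) gamma_mem_splitUnitary isUnitaryModel_unitarySet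
      hasRealCommutant_unitarySet (hasDecay_unitarySet (F := ℍ[ℝ]) h1 h2)
      (exists_mul_self_ne_one_unitarySet (F := ℍ[ℝ]) hn h1 h2)
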